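/- Lemma 4.3. Let $\kappa>0$, let $3\kappa^2<c_2<c_1<9\kappa^2$, and let $y_{10},y_{20},d\in\mathbb R$. For $i=1,2$ put $$k_i=\frac1\kappa\sqrt{\frac{c_i-3\kappa^2}{c_i-\kappa^2}},\qquad \tilde c_i=\frac{2\kappa^3}{1-(\kappa k_i)^2},\qquad \xi_i=k_i(y-\tilde c_i\tau+y_{i0}),\qquad e^{-\psi_i}=\frac{1-\kappa k_i}{1+\kappa k_i},$$ $$f=1+e^{\xi_1}+e^{\xi_2}+\Big(\tfrac{k_1-k_2}{k_1+k_2}\Big)^2e^{\xi_1+\xi_2},\qquad g=1+e^{\xi_1-\psi_1}+e^{\xi_2-\psi_2}+\Big(\tfrac{k_1-k_2}{k_1+k_2}\Big)^2e^{\xi_1+\xi_2-\psi_1-\psi_2}.$$ Let $U^{(2)}(t,x)$ be the 2-soliton of the modified Camassa–Holm equation $m_t+((u^2-u_x^2)m)_x=0$, $m=u-u_{xx}$, given parametrically (with $t=\tau$) by $$u(y,\tau)=\kappa-(\ln(fg))_{\tau y},\qquad x(y,\tau)=\frac y\kappa+\kappa^2\tau+2\ln\frac gf+d,$$ and let $\tilde\mu=\tilde\mu(t,x;y_{10},y_{20})=U^{(2)}-U^{(2)}_{xx}$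 be its momentum profile. Put $$\lambda_1=-\frac1{16\kappa^4}+\frac1{2\kappa^2}\Big(\frac1{c_1-\kappa^2}+\frac1{c_2-\kappa^2}\Big)+\frac2{(c_1-\kappa^2)(c_2-\kappa^2)},\qquad \lambda_2=-\Big(\frac1{4\kappa^2}+\frac1{c_1-\kappa^2}+\frac1{c_2-\kappa^2}\Big).$$ For fixed $t$ let $\mathcal L$ be the operator in the real space $L^2(\mathbb R)$ with domain $H^4(\mathbb R)$ given by $$\mathcal L[h]=(\tilde\mu^{-7}h_{xx})_{xx}+\Big[\big(42\tilde\mu^{-9}\tilde\mu_x^2-14\tilde\mu^{-8}\tilde\mu_{xx}-\tfrac52\tilde\mu^{-7}-2\lambda_2\tilde\mu^{-5}\big)h_x\Big]_x+\big(\tfrac{15}8\tilde\mu^{-7}+2\lambda_1\tilde\mu^{-3}+3\lambda_2\tilde\mu^{-5}\big)h+q(\tilde\mu)h,$$ $$q(\tilde\mu)=28\tilde\mu^{-9}\tilde\mu_{xx}^2+70\tilde\mu^{-9}\tilde\mu_x^2-\tfrac52(\tilde\mu^{-7})_{xx}-315\tilde\mu^{-11}\tilde\mu_x^4-126(\tilde\mu^{-10}\tilde\mu_x^3)_x-7(\tilde\mu^{-8}\tilde\mu_{xx})_{xx}+30\lambda_2\tilde\mu^{-7}\tilde\mu_x^2-2\lambda_2(\tilde\mu^{-5})_{xx}.$$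 Then for every $t\in\mathbb R$ the derivatives $\mu_1=\partial_{y_{10}}\tilde\mu$ and $\mu_2=\partial_{y_{20}}\tilde\mu$ (taken at fixed $t,x$) exist at every $x\in\mathbb R$, they belong to $L^2(\mathbb R)$ and are linearly independent there, and $$\ker(\mathcal L)=\operatorname{span}\{\mu_1(t;y_{10},y_{20}),\mu_2(t;y_{10},y_{20})\}.$$ -/

import Mathlib

open MeasureTheory Set Filter
open scoped ContDiff ENNReal

noncomputable section

namespace MCH

/-! ### The two-soliton of the modified Camassa-Holm equation

Parameters throughout: the background `κ`, the speeds `c₁`, `c₂`, the constant `d` of the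
parametrization, and the phases `y₁`, `y₂` (written `y₁₀`, `y₂₀` in the literature). -/

/-- The wave number `k > 0` of a soliton of speed `c`: `(κ k)² = (c - 3κ²) / (c - κ²)`. -/
def waveNumber (κ c : ℝ) : ℝ := √((c - 3 * κ ^ 2) / (c - κ ^ 2)) / κ

/-- The speed `c̃ = 2κ³ / (1 - (κk)²)` in the reciprocal variables. -/
def recSpeed (κ k : ℝ) : ℝ := 2 * κ ^ 3 / (1 - (κ * k) ^ 2)

/-- The wave number corresponds to the speed through `c = c̃ / κ + κ²`. -/
theorem speed_eq (κ c : ℝ) (hκ : 0 < κ) (hc : 3 * κ ^ 2 < c) :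
    c = recSpeed κ (waveNumber κ c) / κ + κ ^ 2 := by
  have h1 : 0 < κ ^ 2 := by positivity
  have h2 : 0 < c - κ ^ 2 := by linarith
  have h3 : (κ * waveNumber κ c) ^ 2 = (c - 3 * κ ^ 2) / (c - κ ^ 2) := by
    rw [waveNumber, mul_div_cancel₀ _ hκ.ne']
    exact Real.sq_sqrt (div_nonneg (by linarith) h2.le)
  have h4 : 1 - (c - 3 * κ ^ 2) / (c - κ ^ 2) = 2 * κ ^ 2 / (c - κ ^ 2) := by
    field_simp
    ring
  rw [recSpeed, h3, h4]
  field_simp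
  ring

/-- The phase variable `ξ = k (y - c̃ τ + y₀)` of a soliton of speed `c`. -/
def xi (κ c y₀ τ y : ℝ) : ℝ :=
  waveNumber κ c * (y - recSpeed κ (waveNumber κ c) * τ + y₀)

/-- The factor `e^{-ψ} = (1 - κk) / (1 + κk)` of a soliton of speed `c`. -/
def expNegPsi (κ c : ℝ) : ℝ := (1 - κ * waveNumber κ c) / (1 + κ * waveNumber κ c)

/-- The interaction coefficient `((k₁ - k₂) / (k₁ + k₂))²`. -/
def interaction (κ c₁ c₂ : ℝ) : ℝ :=
  ((waveNumber κ c₁ - waveNumber κ c₂) / (waveNumber κ c₁ + waveNumber κ c₂)) ^ 2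

/-- The tau-function `f = 1 + e^{ξ₁} + e^{ξ₂} + ((k₁-k₂)/(k₁+k₂))² e^{ξ₁+ξ₂}`. -/
def tauF (κ c₁ c₂ y₁ y₂ τ y : ℝ) : ℝ :=
  1 + Real.exp (xi κ c₁ y₁ τ y) + Real.exp (xi κ c₂ y₂ τ y)
    + interaction κ c₁ c₂ * Real.exp (xi κ c₁ y₁ τ y + xi κ c₂ y₂ τ y)

/-- The tau-function
`g = 1 + e^{ξ₁-ψ₁} + e^{ξ₂-ψ₂} + ((k₁-k₂)/(k₁+k₂))² e^{ξ₁+ξ₂-ψ₁-ψ₂}`. -/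
def tauG (κ c₁ c₂ y₁ y₂ τ y : ℝ) : ℝ :=
  1 + expNegPsi κ c₁ * Real.exp (xi κ c₁ y₁ τ y) + expNegPsi κ c₂ * Real.exp (xi κ c₂ y₂ τ y)
    + interaction κ c₁ c₂ * (expNegPsi κ c₁ * expNegPsi κ c₂)
      * Real.exp (xi κ c₁ y₁ τ y + xi κ c₂ y₂ τ y)

/-- The solution in the reciprocal variables, `u(y,τ) = κ - (ln (f g))_{τy}`. -/
def uRec (κ c₁ c₂ y₁ y₂ τ y : ℝ) : ℝ :=
  κ - deriv (fun z => deriv (fun s =>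
    Real.log (tauF κ c₁ c₂ y₁ y₂ s z * tauG κ c₁ c₂ y₁ y₂ s z)) τ) y

/-- The space variable, `x(y,τ) = y/κ + κ² τ + 2 ln (g/f) + d`. -/
def xRec (κ c₁ c₂ d y₁ y₂ τ y : ℝ) : ℝ :=
  y / κ + κ ^ 2 * τ + 2 * Real.log (tauG κ c₁ c₂ y₁ y₂ τ y / tauF κ c₁ c₂ y₁ y₂ τ y) + d

/-- The inverse `y = y(t,x)` of the change of variables `y ↦ x(y,t)`. -/
def yRec (κ c₁ c₂ d y₁ y₂ t x : ℝ) : ℝ :=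
  Function.invFun (fun y => xRec κ c₁ c₂ d y₁ y₂ t y) x

/-- The two-soliton `U⁽²⁾(t,x)`. -/
def twoSoliton (κ c₁ c₂ d y₁ y₂ t x : ℝ) : ℝ :=
  uRec κ c₁ c₂ y₁ y₂ t (yRec κ c₁ c₂ d y₁ y₂ t x)

/-- The momentum profile `μ̃ = U⁽²⁾ - ∂ₓ² U⁽²⁾`. -/
def mu (κ c₁ c₂ d y₁ y₂ t x : ℝ) : ℝ :=
  twoSoliton κ c₁ c₂ d y₁ y₂ t x
    - deriv (deriv (fun z => twoSoliton κ c₁ c₂ d y₁ y₂ t z)) x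

/-- The translation mode `μ₁ = ∂μ̃/∂y₁₀`, as a function of `x`. -/
def mu₁ (κ c₁ c₂ d y₁ y₂ t x : ℝ) : ℝ := deriv (fun s => mu κ c₁ c₂ d s y₂ t x) y₁

/-- The translation mode `μ₂ = ∂μ̃/∂y₂₀`, as a function of `x`. -/
def mu₂ (κ c₁ c₂ d y₁ y₂ t x : ℝ) : ℝ := deriv (fun s => mu κ c₁ c₂ d y₁ s t x) y₂

/-! ### Weak derivatives and Sobolev spaces on the line -/

/-- `g` is a weak derivative of `f` on `ℝ`. -/
def IsWeakDeriv (f g : ℝ → ℝ) : Prop :=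
  LocallyIntegrable f ∧ LocallyIntegrable g ∧
    ∀ φ : ℝ → ℝ, ContDiff ℝ ∞ φ → HasCompactSupport φ →
      ∫ x, f x * deriv φ x = - ∫ x, g x * φ x

open Classical in
/-- The weak derivative of `f` (unique up to null sets), and `0` if there is none. -/
def weakDeriv (f : ℝ → ℝ) : ℝ → ℝ :=
  if h : ∃ g, IsWeakDeriv f g then h.choose else 0

/-- Membership in the Sobolev space `Hⁿ(ℝ)`: the function and its weak derivatives of order at
most `n` are in `L²(ℝ)`. -/
def MemH : ℕ → (ℝ → ℝ) → Prop
  | 0, f => MemLp f 2 volume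
  | n + 1, f => MemLp f 2 volume ∧ ∃ g, IsWeakDeriv f g ∧ MemH n g

/-! ### The second variation operator -/

/-- The multiplier `λ₁`. -/
def lam₁ (κ c₁ c₂ : ℝ) : ℝ :=
  -(1 / (16 * κ ^ 4)) + 1 / (2 * κ ^ 2) * (1 / (c₁ - κ ^ 2) + 1 / (c₂ - κ ^ 2))
    + 2 / ((c₁ - κ ^ 2) * (c₂ - κ ^ 2))

/-- The multiplier `λ₂`. -/
def lam₂ (κ c₁ c₂ : ℝ) : ℝ :=
  -(1 / (4 * κ ^ 2) + 1 / (c₁ - κ ^ 2) + 1 / (c₂ - κ ^ 2))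

/-- The potential `q(m)` for a multiplier `l₂` and a profile `m`. -/
def qPot (l₂ : ℝ) (m : ℝ → ℝ) (x : ℝ) : ℝ :=
  28 * m x ^ (-9 : ℤ) * deriv (deriv m) x ^ 2
    + 70 * m x ^ (-9 : ℤ) * deriv m x ^ 2
    - 5 / 2 * deriv (deriv fun z => m z ^ (-7 : ℤ)) x
    - 315 * m x ^ (-11 : ℤ) * deriv m x ^ 4
    - 126 * deriv (fun z => m z ^ (-10 : ℤ) * deriv m z ^ 3) x
    - 7 * deriv (deriv fun z => m z ^ (-8 : ℤ) * deriv (deriv m) z) x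
    + 30 * l₂ * m x ^ (-7 : ℤ) * deriv m x ^ 2
    - 2 * l₂ * deriv (deriv fun z => m z ^ (-5 : ℤ)) x

/-- The fourth order operator
`(m⁻⁷ h_xx)_xx + [(42 m⁻⁹ m_x² - 14 m⁻⁸ m_xx - (5/2) m⁻⁷ - 2 l₂ m⁻⁵) h_x]_x
  + ((15/8) m⁻⁷ + 2 l₁ m⁻³ + 3 l₂ m⁻⁵) h + q(m) h`,
with weak derivatives of `h`. It is defined up to null sets. -/
def opL (l₁ l₂ : ℝ) (m h : ℝ → ℝ) (x : ℝ) : ℝ :=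
  weakDeriv (weakDeriv fun z => m z ^ (-7 : ℤ) * weakDeriv (weakDeriv h) z) x
    + weakDeriv (fun z => (42 * m z ^ (-9 : ℤ) * deriv m z ^ 2
        - 14 * m z ^ (-8 : ℤ) * deriv (deriv m) z
        - 5 / 2 * m z ^ (-7 : ℤ) - 2 * l₂ * m z ^ (-5 : ℤ)) * weakDeriv h z) x
    + (15 / 8 * m x ^ (-7 : ℤ) + 2 * l₁ * m x ^ (-3 : ℤ) + 3 * l₂ * m x ^ (-5 : ℤ)) * h x
    + qPot l₂ m x * h x

/-- The kernel, in `L²(ℝ)`, of the operator `𝓛` with domain `H⁴(ℝ)` attached to the two-soliton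
profile at time `t`. -/
def kerL (κ c₁ c₂ d y₁ y₂ t : ℝ) : Set (Lp ℝ 2 (volume : Measure ℝ)) :=
  {h | MemH 4 h ∧
    opL (lam₁ κ c₁ c₂) (lam₂ κ c₁ c₂) (mu κ c₁ c₂ d y₁ y₂ t) h =ᵐ[volume] 0}

end MCH

end

/-! Everything is computed in the reciprocal variable `y`. Let s = x_y = 1/κ + 2 (ln(g/f))_y be the
slope of the change of variables. The bound c_i < 9κ² says κk_i < √3/2, and this makes s positive
(`SolitonData.slope_pos`): with κk_i = sin φ_i the numerator of s becomes a sum of nonnegative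
terms. Hence y ↦ x is a diffeomorphism of the line. Bilinear identities involving τ give U - U_xx =
1/s (`SolitonData.sub_deriv_deriv_eq_profile`), so the momentum profile is m = 1/s = y_x.

The modes lie in the kernel. Two Hirota bilinear identities show that K(s) is constant, where K = 0
would be a stationary equation of the defocusing mKdV hierarchy with multipliers λ₁, λ₂
(`SolitonData.slope_stationary`). A second expression E satisfies E' = -s K', so it is constant too,
and its limit as y → -∞ is the background value, the same for all phases
(`SolitonData.slopeExpr_eq`). In the variable x, with m = 1/s, this reads E(m, m_x, ..., m_xxxx) =
const. The Fréchet derivative of E is the operator, so differentiation in a phase gives 𝓛 μ_i = 0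
(`divForm_pderiv₁_eq_zero`). The modes and all their derivatives are bounded multiples of σ(1 - σ),
where σ = e^ξ/(1 + e^ξ), hence square integrable.

The kernel is at most two-dimensional. A kernel element has a classical representative, because the
equation expresses the fourth derivative by lower ones. The operator is formally self-adjoint, so
the bilinear concomitant of two solutions is constant in x; it is integrable when the derivatives up
to the third are in L², hence zero. The jets at 0 of such solutions therefore form an isotropic
subspace of ℝ⁴ for a nondegenerate alternating form, of dimension at most two, and a solution is
determined by its jet. No asymptotic analysis of the differential equation is needed.

The modes are independent. Since m = y_x, each mode is the x-derivative of a phase derivative of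
y(t,x), which is itself in L². A vanishing combination of the modes thus gives a constant in L²,
that is zero, and the two exponential rates as y → -∞ separate the coefficients. -/

noncomputable section

namespace MCH

/-! ### Functions all of whose derivatives are bounded -/

/-- `φ` is `n` times differentiable with `φ` and its derivatives of order at most `n` bounded. -/
def BddDiff : ℕ → (ℝ → ℝ) → Prop
  | 0, φ => ∃ C, ∀ x, |φ x| ≤ C
  | n + 1, φ => (∃ C, ∀ x, |φ x| ≤ C) ∧ Differentiable ℝ φ ∧ BddDiff n (deriv φ)

theorem BddDiff.of_succ {n : ℕ} {φ : ℝ → ℝ} (h : BddDiff (n + 1) φ) : BddDiff n φ := by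
  induction n generalizing φ with
  | zero => exact h.1
  | succ n ih => exact ⟨h.1, h.2.1, ih h.2.2⟩

theorem bddDiff_const (n : ℕ) (c : ℝ) : BddDiff n (fun _ => c) := by
  induction n generalizing c with
  | zero => exact ⟨|c|, fun _ => le_rfl⟩
  | succ n ih =>
    refine ⟨⟨|c|, fun _ => le_rfl⟩, differentiable_const c, ?_⟩
    rw [deriv_const']
    exact ih 0

theorem BddDiff.add {n : ℕ} {φ χ : ℝ → ℝ} (h : BddDiff n φ) (h' : BddDiff n χ) :
    BddDiff n (fun x => φ x + χ x) := by
  induction n generalizing φ χ with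
  | zero =>
    obtain ⟨C, hC⟩ := h
    obtain ⟨D, hD⟩ := h'
    exact ⟨C + D, fun x => (abs_add_le _ _).trans (add_le_add (hC x) (hD x))⟩
  | succ n ih =>
    obtain ⟨⟨C, hC⟩, h1, h2⟩ := h
    obtain ⟨⟨D, hD⟩, h3, h4⟩ := h'
    refine ⟨⟨C + D, fun x => (abs_add_le _ _).trans (add_le_add (hC x) (hD x))⟩, h1.add h3, ?_⟩
    have : deriv (fun x => φ x + χ x) = fun x => deriv φ x + deriv χ x :=
      funext fun x => deriv_fun_add (h1 x) (h3 x)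
    rw [this]
    exact ih h2 h4

theorem BddDiff.mul {n : ℕ} {φ χ : ℝ → ℝ} (h : BddDiff n φ) (h' : BddDiff n χ) :
    BddDiff n (fun x => φ x * χ x) := by
  have key : ∀ {φ χ : ℝ → ℝ}, (∃ C, ∀ x, |φ x| ≤ C) → (∃ C, ∀ x, |χ x| ≤ C) →
      ∃ C, ∀ x, |φ x * χ x| ≤ C := by
    rintro φ χ ⟨C, hC⟩ ⟨D, hD⟩
    refine ⟨C * D, fun x => ?_⟩
    rw [abs_mul]
    exact mul_le_mul (hC x) (hD x) (abs_nonneg _) ((abs_nonneg _).trans (hC x))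
  induction n generalizing φ χ with
  | zero => exact key h h'
  | succ n ih =>
    refine ⟨key h.1 h'.1, h.2.1.mul h'.2.1, ?_⟩
    have : deriv (fun x => φ x * χ x) = fun x => deriv φ x * χ x + φ x * deriv χ x :=
      funext fun x => deriv_fun_mul (h.2.1 x) (h'.2.1 x)
    rw [this]
    exact (ih h.2.2 h'.of_succ).add (ih h.of_succ h'.2.2)

theorem BddDiff.inv {n : ℕ} {φ : ℝ → ℝ} (h : BddDiff n φ) {c : ℝ} (hc : 0 < c)
    (hφ : ∀ x, c ≤ φ x) : BddDiff n (fun x => (φ x)⁻¹) := by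
  have b : ∃ C, ∀ x, |(φ x)⁻¹| ≤ C := by
    refine ⟨c⁻¹, fun x => ?_⟩
    rw [abs_of_pos (inv_pos.2 (hc.trans_le (hφ x)))]
    exact inv_anti₀ hc (hφ x)
  induction n generalizing φ with
  | zero => exact b
  | succ n ih =>
    have h0 : ∀ x, φ x ≠ 0 := fun x => (hc.trans_le (hφ x)).ne'
    refine ⟨b, fun x => (h.2.1 x).fun_inv (h0 x), ?_⟩
    have : deriv (fun x => (φ x)⁻¹) =
        fun x => (-1) * (deriv φ x * ((φ x)⁻¹ * (φ x)⁻¹)) := by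
      funext x
      rw [(h.2.1 x).hasDerivAt.fun_inv (h0 x) |>.deriv]
      field_simp
    rw [this]
    have i := ih h.of_succ hφ b
    exact (bddDiff_const n (-1)).mul (h.2.2.mul (i.mul i))

/-- All derivatives of `φ` exist and are bounded. -/
def BddSmooth (φ : ℝ → ℝ) : Prop := ∀ n, BddDiff n φ

namespace BddSmooth

variable {φ χ : ℝ → ℝ}

theorem const (c : ℝ) : BddSmooth (fun _ => c) := fun n => bddDiff_const n c

theorem add (h : BddSmooth φ) (h' : BddSmooth χ) : BddSmooth (fun x => φ x + χ x) :=
  fun n => (h n).add (h' n)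

theorem mul (h : BddSmooth φ) (h' : BddSmooth χ) : BddSmooth (fun x => φ x * χ x) :=
  fun n => (h n).mul (h' n)

theorem const_mul (c : ℝ) (h : BddSmooth φ) : BddSmooth (fun x => c * φ x) := (const c).mul h

theorem neg (h : BddSmooth φ) : BddSmooth (fun x => -φ x) := by
  simpa using h.const_mul (-1)

theorem sub (h : BddSmooth φ) (h' : BddSmooth χ) : BddSmooth (fun x => φ x - χ x) := by
  simpa [sub_eq_add_neg] using h.add h'.neg

theorem pow (h : BddSmooth φ) (k : ℕ) : BddSmooth (fun x => φ x ^ k) := by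
  induction k with
  | zero => simpa using const 1
  | succ k ih => simpa [pow_succ] using ih.mul h

theorem zpow_neg (h : BddSmooth (fun x => (φ x)⁻¹)) (k : ℕ) :
    BddSmooth (fun x => φ x ^ (-(k : ℤ))) := by
  simpa using h.pow k

theorem deriv (h : BddSmooth φ) : BddSmooth (deriv φ) := fun n => (h (n + 1)).2.2

theorem differentiable (h : BddSmooth φ) : Differentiable ℝ φ := (h 1).2.1

theorem continuous (h : BddSmooth φ) : Continuous φ := h.differentiable.continuous

theorem bdd (h : BddSmooth φ) : ∃ C, ∀ x, |φ x| ≤ C := h 0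

theorem contDiff (h : BddSmooth φ) : ContDiff ℝ ∞ φ := by
  rw [contDiff_infty]
  intro n
  induction n generalizing φ with
  | zero => simpa [contDiff_zero] using h.continuous
  | succ n ih =>
    push_cast
    exact contDiff_succ_iff_deriv.2 ⟨h.differentiable, by simp, ih h.deriv⟩

end BddSmooth

/-! ### Functions that decay together with all their derivatives -/

/-- If `ρ' = ρ χ` with `χ` smooth and bounded, products of `ρ` with bounded smooth functions are
stable under differentiation. -/
theorem exists_deriv_eq_mul {ρ χ φ : ℝ → ℝ} (hχ : BddSmooth χ)
    (hρ : ∀ x, HasDerivAt ρ (ρ x * χ x) x) (hφ : BddSmooth φ) :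
    ∃ φ', BddSmooth φ' ∧ ∀ x, HasDerivAt (fun x => ρ x * φ x) (ρ x * φ' x) x := by
  refine ⟨fun x => χ x * φ x + deriv φ x, (hχ.mul hφ).add hφ.deriv, fun x => ?_⟩
  exact ((hρ x).mul (hφ.differentiable x).hasDerivAt).congr_deriv (by ring)

theorem memLp_mul_bdd {ρ φ : ℝ → ℝ} (hρ : MemLp ρ 2 volume) (hφ : BddSmooth φ) :
    MemLp (fun x => ρ x * φ x) 2 volume := by
  obtain ⟨C, hC⟩ := hφ.bdd
  refine (hρ.const_mul C).of_le (hρ.1.mul hφ.continuous.aestronglyMeasurable)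
    (Eventually.of_forall fun x => ?_)
  simp only [Real.norm_eq_abs, abs_mul]
  rw [mul_comm]
  exact mul_le_mul_of_nonneg_right ((hC x).trans (le_abs_self C)) (abs_nonneg _)

/-! ### Weak derivatives -/

namespace IsWeakDeriv

variable {f f' g g' : ℝ → ℝ}

theorem congr (h : IsWeakDeriv f g) (hf : f =ᵐ[volume] f') (hg : g =ᵐ[volume] g') :
    IsWeakDeriv f' g' := by
  refine ⟨h.1.congr hf, h.2.1.congr hg, fun φ h1 h2 => ?_⟩
  have e1 : ∫ x, f' x * deriv φ x = ∫ x, f x * deriv φ x :=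
    integral_congr_ae (hf.mono fun x hx => by simp only [hx])
  have e2 : ∫ x, g' x * φ x = ∫ x, g x * φ x :=
    integral_congr_ae (hg.mono fun x hx => by simp only [hx])
  rw [e1, e2, h.2.2 φ h1 h2]

end IsWeakDeriv

theorem integrable_mul_test {f φ : ℝ → ℝ} (hf : LocallyIntegrable f) (h1 : Continuous φ)
    (h2 : HasCompactSupport φ) : Integrable (fun x => f x * φ x) := by
  simpa only [smul_eq_mul] using hf.integrable_smul_right_of_hasCompactSupport h1 h2

/-- Two locally integrable functions with the same integrals against test functions agree. -/
theorem ae_eq_of_integral_test {f g : ℝ → ℝ} (hf : LocallyIntegrable f) (hg : LocallyIntegrable g)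
    (h : ∀ φ : ℝ → ℝ, ContDiff ℝ ∞ φ → HasCompactSupport φ →
      ∫ x, f x * φ x = ∫ x, g x * φ x) : f =ᵐ[volume] g := by
  have h0 : LocallyIntegrable (fun x => f x - g x) := hf.sub hg
  have := ae_eq_zero_of_integral_contDiff_smul_eq_zero (μ := volume) h0 (fun φ h1 h2 => by
    have e : ∀ x, φ x • (f x - g x) = f x * φ x - g x * φ x := fun x => by
      rw [smul_eq_mul]; ring
    simp only [e]
    rw [integral_sub (integrable_mul_test hf h1.continuous h2)
      (integrable_mul_test hg h1.continuous h2), h φ h1 h2, sub_self])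
  filter_upwards [this] with x hx
  exact sub_eq_zero.1 hx

theorem continuous_deriv_test {φ : ℝ → ℝ} (h : ContDiff ℝ ∞ φ) : Continuous (deriv φ) :=
  h.continuous_deriv (by simp)

namespace IsWeakDeriv

variable {f f' g g' : ℝ → ℝ}

theorem unique (h : IsWeakDeriv f g) (h' : IsWeakDeriv f g') : g =ᵐ[volume] g' :=
  ae_eq_of_integral_test h.2.1 h'.2.1 fun φ h1 h2 =>
    neg_injective ((h.2.2 φ h1 h2).symm.trans (h'.2.2 φ h1 h2))

/-- `weakDeriv` is a choice, so it is known only through uniqueness up to null sets. -/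
theorem weakDeriv_ae (h : IsWeakDeriv f g) : weakDeriv f =ᵐ[volume] g := by
  have hex : ∃ g, IsWeakDeriv f g := ⟨g, h⟩
  rw [weakDeriv, dif_pos hex]
  exact hex.choose_spec.unique h

theorem add (h : IsWeakDeriv f g) (h' : IsWeakDeriv f' g') :
    IsWeakDeriv (fun x => f x + f' x) (fun x => g x + g' x) := by
  refine ⟨h.1.add h'.1, h.2.1.add h'.2.1, fun φ h1 h2 => ?_⟩
  have c := continuous_deriv_test h1
  have d := h2.deriv
  simp only [add_mul]
  rw [integral_add (integrable_mul_test h.1 c d) (integrable_mul_test h'.1 c d),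
    integral_add (integrable_mul_test h.2.1 h1.continuous h2)
      (integrable_mul_test h'.2.1 h1.continuous h2), h.2.2 φ h1 h2, h'.2.2 φ h1 h2]
  ring

/-- For a test function φ, the product `a φ` is again a test function; applying the hypothesis to it
gives the Leibniz rule. -/
theorem contDiff_mul {a : ℝ → ℝ} (ha : ContDiff ℝ ∞ a) (h : IsWeakDeriv f g) :
    IsWeakDeriv (fun x => a x * f x) (fun x => deriv a x * f x + a x * g x) := by
  have ca := continuous_deriv_test ha
  refine ⟨h.1.continuous_mul ha.continuous,
    (h.1.continuous_mul ca).add (h.2.1.continuous_mul ha.continuous), fun φ h1 h2 => ?_⟩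
  have c := continuous_deriv_test h1
  have d := h2.deriv
  have hs : HasCompactSupport (fun x => a x * φ x) := h2.mul_left
  have key := h.2.2 (fun x => a x * φ x) (ha.mul h1) hs
  have e : ∀ x, deriv (fun x => a x * φ x) x = deriv a x * φ x + a x * deriv φ x := fun x =>
    deriv_fun_mul (ha.differentiable (by simp) x) (h1.differentiable (by simp) x)
  simp only [e, mul_add] at key
  have i1 : Integrable (fun x => f x * (deriv a x * φ x)) :=
    integrable_mul_test h.1 (ca.mul h1.continuous) h2.mul_left
  have i2 : Integrable (fun x => f x * (a x * deriv φ x)) :=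
    integrable_mul_test h.1 (ha.continuous.mul c) d.mul_left
  have i3 : Integrable (fun x => g x * (a x * φ x)) :=
    integrable_mul_test h.2.1 (ha.continuous.mul h1.continuous) h2.mul_left
  rw [integral_add i1 i2] at key
  have e1 : ∀ x, a x * f x * deriv φ x = f x * (a x * deriv φ x) := fun x => by ring
  have e2 : ∀ x, (deriv a x * f x + a x * g x) * φ x =
      f x * (deriv a x * φ x) + g x * (a x * φ x) := fun x => by ring
  simp only [e1, e2]
  rw [integral_add i1 i3]
  linarith

end IsWeakDeriv

/-! ### Primitives and classical representatives -/

theorem intervalIntegrable_of_locallyIntegrable {g : ℝ → ℝ} (hg : LocallyIntegrable g) (a b : ℝ) :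
    IntervalIntegrable g volume a b :=
  (hg.integrableOn_isCompact isCompact_uIcc).intervalIntegrable

/-- The primitive is absolutely continuous on compact intervals and has derivative g almost
everywhere, so it can be integrated by parts against a test function. -/
theorem isWeakDeriv_integral {g : ℝ → ℝ} (hg : LocallyIntegrable g) (c : ℝ) :
    IsWeakDeriv (fun x => c + ∫ t in (0)..x, g t) g := by
  have hi := intervalIntegrable_of_locallyIntegrable hg
  have hc : Continuous fun x => ∫ t in (0)..x, g t :=
    intervalIntegral.continuous_primitive hi 0
  refine ⟨(continuous_const.add hc).locallyIntegrable, hg, fun φ h1 h2 => ?_⟩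
  obtain ⟨R, hR, hφ⟩ := h2.exists_pos_le_norm
  -- The margin 1 provides a neighbourhood of x on which φ vanishes, so that its derivative vanishes
  -- as well.
  have hφ' : ∀ x, R + 1 ≤ ‖x‖ → deriv φ x = 0 := fun x hx => by
    have : φ =ᶠ[nhds x] fun _ => 0 := by
      have : ∀ᶠ z in nhds x, R < ‖z‖ :=
        continuous_norm.continuousAt.eventually (lt_mem_nhds (by linarith))
      filter_upwards [this] with z hz
      exact hφ z hz.le
    rw [this.deriv_eq, deriv_const]
  have key : ∀ {u : ℝ → ℝ}, (∀ x, R + 1 ≤ ‖x‖ → u x = 0) →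
      ∫ x in (-(R + 1))..(R + 1), u x = ∫ x, u x := fun {u} hu => by
    refine intervalIntegral.integral_eq_integral_of_support_subset fun x hx => ?_
    have : ‖x‖ < R + 1 := by
      by_contra hc
      exact hx (hu x (not_lt.1 hc))
    rw [Real.norm_eq_abs, abs_lt] at this
    exact ⟨this.1, this.2.le⟩
  have aF : AbsolutelyContinuousOnInterval (fun x => ∫ t in (0)..x, g t) (-(R + 1)) (R + 1) :=
    (hi _ _).absolutelyContinuousOnInterval_intervalIntegral (by
      rw [uIcc_of_le (by linarith)]; constructor <;> linarith)
  have aC : AbsolutelyContinuousOnInterval (fun _ : ℝ => c) (-(R + 1)) (R + 1) :=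
    contDiff_const.contDiffOn.absolutelyContinuousOnInterval
  have aφ : AbsolutelyContinuousOnInterval φ (-(R + 1)) (R + 1) :=
    (h1.of_le (by simp)).contDiffOn.absolutelyContinuousOnInterval
  have ibp := (aC.add aF).integral_mul_deriv_eq_deriv_mul aφ
  rw [hφ (R + 1) (by rw [Real.norm_eq_abs]; linarith [le_abs_self (R + 1)]),
    hφ (-(R + 1)) (by rw [norm_neg, Real.norm_eq_abs]; linarith [le_abs_self (R + 1)])] at ibp
  have e1 : ∫ x in (-(R + 1))..(R + 1),
      deriv ((fun _ : ℝ => c) + fun x => ∫ t in (0)..x, g t) x * φ x =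
      ∫ x in (-(R + 1))..(R + 1), g x * φ x := by
    refine intervalIntegral.integral_congr_ae ?_
    filter_upwards [_root_.LocallyIntegrable.ae_hasDerivAt_integral hg] with x hx _
    have := (hasDerivAt_const x c).add (hx 0)
    rw [this.deriv, zero_add]
  have e2 := key (u := fun x => (c + ∫ t in (0)..x, g t) * deriv φ x)
    (fun x hx => by rw [hφ' x hx, mul_zero])
  have e3 := key (u := fun x => g x * φ x) (fun x hx => by rw [hφ x (by linarith), mul_zero])
  rw [e1, e3, mul_zero, mul_zero, sub_zero, zero_sub] at ibp
  rw [← e2, ← ibp]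
  rfl

theorem isWeakDeriv_of_hasDerivAt {f f' : ℝ → ℝ} (hf : ∀ x, HasDerivAt f (f' x) x)
    (hc : Continuous f') : IsWeakDeriv f f' := by
  have h := isWeakDeriv_integral hc.locallyIntegrable (f 0)
  have e : (fun x => f 0 + ∫ t in (0)..x, f' t) = f := by
    funext x
    rw [intervalIntegral.integral_eq_sub_of_hasDerivAt (fun y _ => hf y)
      (hc.intervalIntegrable _ _)]
    ring
  rwa [e] at h

/-- A function with vanishing weak derivative is constant. -/
theorem IsWeakDeriv.ae_eq_const {f : ℝ → ℝ} (h : IsWeakDeriv f (fun _ => 0)) :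
    ∃ c, f =ᵐ[volume] fun _ => c := by
  let η : ContDiffBump (0 : ℝ) := default
  set w : ℝ → ℝ := η.normed volume with hw
  have w1 : ContDiff ℝ ∞ w := η.contDiff_normed
  have w2 : HasCompactSupport w := η.hasCompactSupport_normed
  have w3 : ∫ x, w x = 1 := η.integral_normed
  refine ⟨∫ x, f x * w x, ?_⟩
  refine ae_eq_of_integral_test h.1 continuous_const.locallyIntegrable fun φ h1 h2 => ?_
  set J := ∫ x, φ x with hJ
  have iφ : Integrable φ := h1.continuous.integrable_of_hasCompactSupport h2
  have iw : Integrable w := w1.continuous.integrable_of_hasCompactSupport w2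
  -- Subtracting a multiple of the bump w leaves a test function of mean zero. Its primitive Φ is
  -- therefore compactly supported, and testing with Φ gives ∫ f χ = 0.
  set χ : ℝ → ℝ := fun x => φ x - J * w x with hχ
  have χ1 : ContDiff ℝ ∞ χ := h1.sub (contDiff_const.mul w1)
  have χ2 : HasCompactSupport χ := h2.sub w2.mul_left
  have χ3 : ∫ x, χ x = 0 := by
    rw [integral_sub iφ (iw.const_mul J), integral_const_mul, w3, mul_one, sub_self]
  obtain ⟨R, hR, hz⟩ := χ2.exists_pos_le_norm
  set Φ : ℝ → ℝ := fun x => ∫ t in (-R)..x, χ t with hΦ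
  have dΦ : ∀ x, HasDerivAt Φ (χ x) x := fun x =>
    intervalIntegral.integral_hasDerivAt_right (χ1.continuous.intervalIntegrable _ _)
      (χ1.continuous.stronglyMeasurableAtFilter _ _) χ1.continuous.continuousAt
  have dΦ' : deriv Φ = χ := funext fun x => (dΦ x).deriv
  have Φ1 : ContDiff ℝ ∞ Φ :=
    contDiff_infty_iff_deriv.2 ⟨fun x => (dΦ x).differentiableAt, by rwa [dΦ']⟩
  have Φ2 : HasCompactSupport Φ := by
    refine HasCompactSupport.intro (isCompact_Icc (a := -R) (b := R)) fun x hx => ?_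
    rw [mem_Icc, not_and_or, not_le, not_le] at hx
    rcases hx with hx | hx
    · refine intervalIntegral.integral_zero_ae (Eventually.of_forall fun t ht => hz t ?_)
      rw [uIoc_of_ge hx.le, mem_Ioc] at ht
      rw [Real.norm_eq_abs]
      linarith [neg_le_abs t]
    · refine (intervalIntegral.integral_eq_integral_of_support_subset fun t ht => ?_).trans χ3
      have : ‖t‖ < R := by
        by_contra hc
        exact ht (hz t (not_lt.1 hc))
      rw [Real.norm_eq_abs, abs_lt] at this
      exact ⟨this.1, (this.2.trans hx).le⟩
  have key := h.2.2 Φ Φ1 Φ2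
  have e : ∀ x, f x * χ x = f x * φ x - J * (f x * w x) := fun x => by rw [hχ]; ring
  simp only [dΦ', zero_mul, integral_zero, neg_zero, e] at key
  rw [integral_sub (integrable_mul_test h.1 h1.continuous h2)
    ((integrable_mul_test h.1 w1.continuous w2).const_mul J), integral_const_mul] at key
  rw [integral_const_mul]
  linarith

theorem IsWeakDeriv.ae_eq_integral {f g : ℝ → ℝ} (h : IsWeakDeriv f g) :
    ∃ c, f =ᵐ[volume] fun x => c + ∫ t in (0)..x, g t := by
  have h2 := isWeakDeriv_integral h.2.1 0
  have h3 : IsWeakDeriv (fun x => f x + (-1) * (0 + ∫ t in (0)..x, g t)) (fun _ => 0) := by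
    refine (h.add (h2.contDiff_mul (contDiff_const (c := (-1 : ℝ))))).congr EventuallyEq.rfl
      (Eventually.of_forall fun x => ?_)
    simp
  obtain ⟨c, hc⟩ := h3.ae_eq_const
  refine ⟨c, ?_⟩
  filter_upwards [hc] with x hx
  linarith

/-- A function whose weak derivative has a continuous representative has a `C¹` representative. -/
theorem IsWeakDeriv.exists_hasDerivAt {f g G : ℝ → ℝ} (h : IsWeakDeriv f g) (hg : g =ᵐ[volume] G)
    (hG : Continuous G) : ∃ F, f =ᵐ[volume] F ∧ ∀ x, HasDerivAt F (G x) x := by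
  obtain ⟨c, hc⟩ := (h.congr EventuallyEq.rfl hg).ae_eq_integral
  refine ⟨_, hc, fun x => ?_⟩
  simpa using (intervalIntegral.integral_hasDerivAt_right (hG.intervalIntegrable _ _)
      (hG.stronglyMeasurableAtFilter _ _) hG.continuousAt).const_add c

theorem hasDerivAt_iteratedDeriv {h : ℝ → ℝ} {N : ℕ} (hh : ContDiff ℝ N h) {n : ℕ} (hn : n < N)
    (x : ℝ) : HasDerivAt (iteratedDeriv n h) (iteratedDeriv (n + 1) h x) x := by
  rw [iteratedDeriv_succ]
  exact (hh.differentiable_iteratedDeriv n (by exact_mod_cast hn) x).hasDerivAt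

theorem continuous_of_hasDerivAt {f f' : ℝ → ℝ} (h : ∀ x, HasDerivAt f (f' x) x) :
    Continuous f := continuous_iff_continuousAt.2 fun x => (h x).continuousAt

/-- Functions `H₀, …, H₄`, each the derivative of the previous one, are the iterated derivatives
of `H₀`. -/
theorem contDiff_four_of_hasDerivAt {H₀ H₁ H₂ H₃ H₄ : ℝ → ℝ} (h0 : ∀ x, HasDerivAt H₀ (H₁ x) x)
    (h1 : ∀ x, HasDerivAt H₁ (H₂ x) x) (h2 : ∀ x, HasDerivAt H₂ (H₃ x) x)
    (h3 : ∀ x, HasDerivAt H₃ (H₄ x) x) (h4 : Continuous H₄) :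
    ContDiff ℝ 4 H₀ ∧ iteratedDeriv 1 H₀ = H₁ ∧ iteratedDeriv 2 H₀ = H₂ ∧
      iteratedDeriv 3 H₀ = H₃ ∧ iteratedDeriv 4 H₀ = H₄ := by
  have e1 : iteratedDeriv 1 H₀ = H₁ := by
    rw [iteratedDeriv_one]; exact funext fun x => (h0 x).deriv
  have e2 : iteratedDeriv 2 H₀ = H₂ := by
    rw [iteratedDeriv_succ, e1]; exact funext fun x => (h1 x).deriv
  have e3 : iteratedDeriv 3 H₀ = H₃ := by
    rw [iteratedDeriv_succ, e2]; exact funext fun x => (h2 x).deriv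
  have e4 : iteratedDeriv 4 H₀ = H₄ := by
    rw [iteratedDeriv_succ, e3]; exact funext fun x => (h3 x).deriv
  refine ⟨?_, e1, e2, e3, e4⟩
  have c3 := continuous_of_hasDerivAt h3
  have c2 := continuous_of_hasDerivAt h2
  have c1 := continuous_of_hasDerivAt h1
  have c0 := continuous_of_hasDerivAt h0
  have := contDiff_nat_iff_iteratedDeriv (n := 4) (f := H₀) (𝕜 := ℝ)
  refine this.2 ⟨fun k hk => ?_, fun k hk => ?_⟩
  · interval_cases k
    · simpa using c0
    · rwa [e1]
    · rwa [e2]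
    · rwa [e3]
    · rwa [e4]
  · interval_cases k
    · rw [iteratedDeriv_zero]; exact fun x => (h0 x).differentiableAt
    · rw [e1]; exact fun x => (h1 x).differentiableAt
    · rw [e2]; exact fun x => (h2 x).differentiableAt
    · rw [e3]; exact fun x => (h3 x).differentiableAt

/-! ### The operator in divergence form -/

/-- The expression `(a h'')'' + (b h')' + c h` with the derivatives of the products expanded, in
terms of the derivatives `h₀, …, h₄` of `h`. -/
def divForm (a b c : ℝ → ℝ) (h₀ h₁ h₂ h₃ h₄ : ℝ → ℝ) (x : ℝ) : ℝ :=
  a x * h₄ x + 2 * deriv a x * h₃ x + deriv (deriv a) x * h₂ x + b x * h₂ x + deriv b x * h₁ x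
    + c x * h₀ x

/-- The coefficient of the fourth order term of `opL`. -/
def coefA (m : ℝ → ℝ) (z : ℝ) : ℝ := m z ^ (-7 : ℤ)

/-- The coefficient of the second order term of `opL`. -/
def coefB (l₂ : ℝ) (m : ℝ → ℝ) (z : ℝ) : ℝ :=
  42 * m z ^ (-9 : ℤ) * deriv m z ^ 2 - 14 * m z ^ (-8 : ℤ) * deriv (deriv m) z
    - 5 / 2 * m z ^ (-7 : ℤ) - 2 * l₂ * m z ^ (-5 : ℤ)

/-- The coefficient of the zeroth order term of `opL`. -/
def coefC (l₁ l₂ : ℝ) (m : ℝ → ℝ) (x : ℝ) : ℝ :=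
  15 / 8 * m x ^ (-7 : ℤ) + 2 * l₁ * m x ^ (-3 : ℤ) + 3 * l₂ * m x ^ (-5 : ℤ) + qPot l₂ m x

/-- The nested weak derivatives are identified from the inside out, each only almost everywhere. The
last function g is only required to be a weak derivative of `H₃`: that is all that is known of a
kernel element before regularity is established. -/
theorem opL_ae_eq_divForm {l₁ l₂ : ℝ} {m h H₀ H₁ H₂ H₃ g : ℝ → ℝ}
    (ha : ContDiff ℝ ∞ (coefA m)) (hb : ContDiff ℝ ∞ (coefB l₂ m))
    (h0 : h =ᵐ[volume] H₀) (d0 : ∀ x, HasDerivAt H₀ (H₁ x) x)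
    (d1 : ∀ x, HasDerivAt H₁ (H₂ x) x) (d2 : ∀ x, HasDerivAt H₂ (H₃ x) x)
    (d3 : IsWeakDeriv H₃ g) (c3 : Continuous H₃) :
    opL l₁ l₂ m h =ᵐ[volume] divForm (coefA m) (coefB l₂ m) (coefC l₁ l₂ m) H₀ H₁ H₂ H₃ g := by
  have c2 := continuous_of_hasDerivAt d2
  have c1 := continuous_of_hasDerivAt d1
  have ha' : ContDiff ℝ ∞ (deriv (coefA m)) := (contDiff_infty_iff_deriv.1 ha).2
  have w1 : weakDeriv h =ᵐ[volume] H₁ :=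
    ((isWeakDeriv_of_hasDerivAt d0 c1).congr h0.symm EventuallyEq.rfl).weakDeriv_ae
  have w2 : weakDeriv (weakDeriv h) =ᵐ[volume] H₂ :=
    ((isWeakDeriv_of_hasDerivAt d1 c2).congr w1.symm EventuallyEq.rfl).weakDeriv_ae
  have W2 := isWeakDeriv_of_hasDerivAt d2 c3
  have w3 : weakDeriv (fun z => m z ^ (-7 : ℤ) * weakDeriv (weakDeriv h) z) =ᵐ[volume]
      fun x => deriv (coefA m) x * H₂ x + coefA m x * H₃ x :=
    ((W2.contDiff_mul ha).congr (w2.mono fun x hx => by simp only [hx, coefA])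
      EventuallyEq.rfl).weakDeriv_ae
  have w4 := (((W2.contDiff_mul ha').add (d3.contDiff_mul ha)).congr w3.symm
    EventuallyEq.rfl).weakDeriv_ae
  have w5 : weakDeriv (fun z => (42 * m z ^ (-9 : ℤ) * deriv m z ^ 2
        - 14 * m z ^ (-8 : ℤ) * deriv (deriv m) z
        - 5 / 2 * m z ^ (-7 : ℤ) - 2 * l₂ * m z ^ (-5 : ℤ)) * weakDeriv h z) =ᵐ[volume]
      fun x => deriv (coefB l₂ m) x * H₁ x + coefB l₂ m x * H₂ x :=
    (((isWeakDeriv_of_hasDerivAt d1 c2).contDiff_mul hb).congr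
      (w1.mono fun x hx => by simp only [hx, coefB]) EventuallyEq.rfl).weakDeriv_ae
  filter_upwards [w4, w5, h0] with x e4 e5 e0
  rw [opL, e4, e5, e0, divForm, coefC]
  ring

/-- `h` is a square integrable classical solution, with its derivatives up to the third, of
`(a h'')'' + (b h')' + c h = 0`. -/
structure IsL2Solution (a b c h : ℝ → ℝ) : Prop where
  contDiff : ContDiff ℝ 4 h
  eq_zero : ∀ x, divForm a b c h (iteratedDeriv 1 h) (iteratedDeriv 2 h) (iteratedDeriv 3 h)
    (iteratedDeriv 4 h) x = 0
  memLp : ∀ n ≤ 3, MemLp (iteratedDeriv n h) 2 volume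

/-- Elements of the kernel of `opL` have representatives that are classical solutions. -/
theorem exists_isL2Solution {l₁ l₂ : ℝ} {m h : ℝ → ℝ} (ha : ContDiff ℝ ∞ (coefA m))
    (hb : ContDiff ℝ ∞ (coefB l₂ m)) (hc : Continuous (coefC l₁ l₂ m)) (ha0 : ∀ x, coefA m x ≠ 0)
    (hh : MemH 4 h) (h0 : opL l₁ l₂ m h =ᵐ[volume] 0) :
    ∃ H, h =ᵐ[volume] H ∧ IsL2Solution (coefA m) (coefB l₂ m) (coefC l₁ l₂ m) H := by
  obtain ⟨m0, g1, w0, m1, g2, w1, m2, g3, w2, m3, g4, w3, m4⟩ := hh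
  obtain ⟨c, hG⟩ := w3.ae_eq_integral
  have hGc : Continuous fun x => c + ∫ t in (0)..x, g4 t := continuous_const.add
    (intervalIntegral.continuous_primitive (intervalIntegrable_of_locallyIntegrable w3.2.1) 0)
  obtain ⟨H2, e2, d2⟩ := w2.exists_hasDerivAt hG hGc
  obtain ⟨H1, e1, d1⟩ := w1.exists_hasDerivAt e2 (continuous_of_hasDerivAt d2)
  obtain ⟨H0, e0, d0⟩ := w0.exists_hasDerivAt e1 (continuous_of_hasDerivAt d1)
  set G : ℝ → ℝ := fun x => c + ∫ t in (0)..x, g4 t with hGdef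
  have WG : IsWeakDeriv G g4 := w3.congr hG EventuallyEq.rfl
  have key := (opL_ae_eq_divForm (l₁ := l₁) ha hb e0 d0 d1 d2 WG hGc).symm.trans h0
  have a1 : ContDiff ℝ ∞ (deriv (coefA m)) := (contDiff_infty_iff_deriv.1 ha).2
  have a2 : ContDiff ℝ ∞ (deriv (deriv (coefA m))) := (contDiff_infty_iff_deriv.1 a1).2
  have b1 : ContDiff ℝ ∞ (deriv (coefB l₂ m)) := (contDiff_infty_iff_deriv.1 hb).2
  have c2 := continuous_of_hasDerivAt d2
  have c1 := continuous_of_hasDerivAt d1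
  have c0 := continuous_of_hasDerivAt d0
  -- The equation solved for the fourth derivative. The right-hand side is continuous, so the weak
  -- derivative of G has a continuous representative and G is continuously differentiable.
  set H4 : ℝ → ℝ := fun x => -(2 * deriv (coefA m) x * G x + deriv (deriv (coefA m)) x * H2 x
    + coefB l₂ m x * H2 x + deriv (coefB l₂ m) x * H1 x + coefC l₁ l₂ m x * H0 x) / coefA m x
    with hH4
  have c4 : Continuous H4 := by
    refine Continuous.div ?_ ha.continuous ha0
    have := a1.continuous
    have := a2.continuous
    have := b1.continuous
    have := hb.continuous
    fun_prop
  have e4 : g4 =ᵐ[volume] H4 := by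
    filter_upwards [key] with x hx
    rw [divForm, Pi.zero_apply] at hx
    rw [hH4]
    field_simp [ha0 x]
    linarith
  obtain ⟨H3, e3, d3⟩ := WG.exists_hasDerivAt e4 c4
  have e3' : G = H3 := (hGc.ae_eq_iff_eq volume (continuous_of_hasDerivAt d3)).1 e3
  have d2 : ∀ x, HasDerivAt H2 (H3 x) x := e3' ▸ d2
  obtain ⟨hC, i1, i2, i3, i4⟩ := contDiff_four_of_hasDerivAt d0 d1 d2 d3 c4
  refine ⟨H0, e0, hC, fun x => ?_, fun n hn => ?_⟩
  · rw [i1, i2, i3, i4, divForm, hH4, ← e3']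
    field_simp [ha0 x]
    ring
  · interval_cases n
    · simpa using (memLp_congr_ae e0).1 m0
    · rw [i1]; exact (memLp_congr_ae e1).1 m1
    · rw [i2]; exact (memLp_congr_ae e2).1 m2
    · rw [i3]; exact (memLp_congr_ae (hG.trans e3)).1 m3

/-! ### The space of square integrable solutions -/

/-- The bilinear concomitant of the operator `(a h'')'' + (b h')' + c h`, as a function of the
derivatives of order at most three of two functions; `a₀`, `a₁` and `b₀` are the values of `a`,
`a'` and `b`. -/
def concomitant (a₀ a₁ b₀ : ℝ) (u v : Fin 4 → ℝ) : ℝ :=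
  u 0 * (a₀ * v 3 + a₁ * v 2) - v 0 * (a₀ * u 3 + a₁ * u 2) - a₀ * u 1 * v 2 + a₀ * v 1 * u 2
    + b₀ * (u 0 * v 1 - v 0 * u 1)

/-- The derivatives of order at most three of `h` at `x`. -/
def jet (h : ℝ → ℝ) (x : ℝ) (i : Fin 4) : ℝ := iteratedDeriv i h x

namespace IsL2Solution

variable {a b c h k : ℝ → ℝ}

theorem hasDerivAt_jet (H : IsL2Solution a b c h) (x : ℝ) :
    HasDerivAt h (iteratedDeriv 1 h x) x ∧
    HasDerivAt (iteratedDeriv 1 h) (iteratedDeriv 2 h x) x ∧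
    HasDerivAt (iteratedDeriv 2 h) (iteratedDeriv 3 h x) x ∧
    HasDerivAt (iteratedDeriv 3 h) (iteratedDeriv 4 h x) x := by
  have := H.contDiff
  refine ⟨?_, hasDerivAt_iteratedDeriv (N := 4) this (by norm_num) x,
    hasDerivAt_iteratedDeriv (N := 4) this (by norm_num) x,
    hasDerivAt_iteratedDeriv (N := 4) this (by norm_num) x⟩
  simpa using hasDerivAt_iteratedDeriv (N := 4) (n := 0) this (by norm_num) x

theorem combination (H : IsL2Solution a b c h) (K : IsL2Solution a b c k) (α β : ℝ) :
    IsL2Solution a b c (fun x => α * h x + β * k x) := by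
  have e : ∀ n ≤ 4, iteratedDeriv n (fun x => α * h x + β * k x) =
      fun x => α * iteratedDeriv n h x + β * iteratedDeriv n k x := fun n hn => by
    have hn' : (n : WithTop ℕ∞) ≤ 4 := by exact_mod_cast hn
    have h1 := (H.contDiff.of_le hn')
    have k1 := (K.contDiff.of_le hn')
    funext x
    rw [iteratedDeriv_fun_add (contDiff_const.mul h1).contDiffAt (contDiff_const.mul k1).contDiffAt,
      iteratedDeriv_const_mul_field, iteratedDeriv_const_mul_field]
  refine ⟨(contDiff_const.mul H.contDiff).add (contDiff_const.mul K.contDiff), fun x => ?_,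
    fun n hn => ?_⟩
  · have h1 := H.eq_zero x
    have k1 := K.eq_zero x
    rw [divForm] at h1 k1
    rw [e 1 (by norm_num), e 2 (by norm_num), e 3 (by norm_num), e 4 (by norm_num), divForm]
    linear_combination α * h1 + β * k1
  · rw [e n (by omega)]
    exact ((H.memLp n hn).const_mul α).add ((K.memLp n hn).const_mul β)

/-- The bilinear concomitant of two square integrable solutions vanishes. -/
theorem concomitant_eq_zero (H : IsL2Solution a b c h) (K : IsL2Solution a b c k)
    (ha : BddSmooth a) (hb : BddSmooth b) (x : ℝ) :
    concomitant (a x) (deriv a x) (b x) (jet h x) (jet k x) = 0 := by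
  set W : ℝ → ℝ := fun x => concomitant (a x) (deriv a x) (b x) (jet h x) (jet k x) with hW
  -- Formal self-adjointness: W' = h L[k] - k L[h], where L is the operator in divergence form, and
  -- both terms vanish.
  have dW : ∀ x, HasDerivAt W 0 x := fun x => by
    obtain ⟨h0, h1, h2, h3⟩ := H.hasDerivAt_jet x
    obtain ⟨k0, k1, k2, k3⟩ := K.hasDerivAt_jet x
    have a0 := (ha.differentiable x).hasDerivAt
    have a1 := (ha.deriv.differentiable x).hasDerivAt
    have b0 := (hb.differentiable x).hasDerivAt
    have D := (((h0.mul ((a0.mul k3).add (a1.mul k2))).sub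
      (k0.mul ((a0.mul h3).add (a1.mul h2)))).sub ((a0.mul h1).mul k2)).add
      ((a0.mul k1).mul h2) |>.add (b0.mul ((h0.mul k1).sub (k0.mul h1)))
    have e : W = h * (a * iteratedDeriv 3 k + deriv a * iteratedDeriv 2 k)
        - k * (a * iteratedDeriv 3 h + deriv a * iteratedDeriv 2 h)
        - a * iteratedDeriv 1 h * iteratedDeriv 2 k + a * iteratedDeriv 1 k * iteratedDeriv 2 h
        + b * (h * iteratedDeriv 1 k - k * iteratedDeriv 1 h) := by
      funext x
      simp [hW, concomitant, jet]
    rw [e]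
    refine D.congr_deriv ?_
    have h1 := H.eq_zero x
    have k1 := K.eq_zero x
    rw [divForm] at h1 k1
    simp only [Pi.add_apply, Pi.mul_apply, Pi.sub_apply]
    linear_combination h x * k1 - k x * h1
  have cW : ∀ x, W x = W 0 := fun x =>
    is_const_of_deriv_eq_zero (fun x => (dW x).differentiableAt) (fun x => (dW x).deriv) x 0
  -- Each term is a bounded coefficient times a product of two functions in L². A constant that is
  -- integrable on the whole line is zero.
  have iW : Integrable W := by
    have hm : ∀ {φ f g : ℝ → ℝ}, BddSmooth φ → MemLp f 2 volume → MemLp g 2 volume →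
        Integrable (fun x => φ x * (f x * g x)) := fun {φ f g} hφ hf hg => by
      obtain ⟨C, hC⟩ := hφ.bdd
      exact (hf.integrable_mul hg).bdd_mul hφ.continuous.aestronglyMeasurable
        (Eventually.of_forall hC)
    have H0 := H.memLp 0 (by norm_num)
    have K0 := K.memLp 0 (by norm_num)
    rw [iteratedDeriv_zero] at H0 K0
    have H1 := H.memLp 1 (by norm_num)
    have K1 := K.memLp 1 (by norm_num)
    have H2 := H.memLp 2 (by norm_num)
    have K2 := K.memLp 2 (by norm_num)
    have H3 := H.memLp 3 (by norm_num)
    have K3 := K.memLp 3 (by norm_num)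
    have I := (((((((hm ha H0 K3).add (hm ha.deriv H0 K2)).sub (hm ha K0 H3)).sub
      (hm ha.deriv K0 H2)).sub (hm ha H1 K2)).add (hm ha K1 H2)).add (hm hb H0 K1)).sub
      (hm hb K0 H1)
    refine I.congr (Eventually.of_forall fun x => ?_)
    simp only [Pi.add_apply, Pi.sub_apply, hW, concomitant, jet]
    simp
    ring
  have e : W = fun _ => W 0 := funext cW
  rw [e, integrable_const_iff] at iW
  rcases iW with h0 | h0
  · exact (cW x).trans h0
  · exact absurd h0.measure_univ_lt_top (by simp)

/-- A solution whose derivatives of order at most three vanish at a point is zero. -/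
theorem eq_zero_of_jet_eq_zero (H : IsL2Solution a b c h) (ha : BddSmooth a) (hb : BddSmooth b)
    (hc : BddSmooth c) (hi : BddSmooth (fun x => (a x)⁻¹)) (ha0 : ∀ x, a x ≠ 0)
    (h0 : jet h 0 = 0) (x : ℝ) : h x = 0 := by
  -- Gronwall argument for the squared length of the jet: the target is |N'| ≤ C N.
  set N : ℝ → ℝ := fun x => h x ^ 2 + iteratedDeriv 1 h x ^ 2 + iteratedDeriv 2 h x ^ 2
    + iteratedDeriv 3 h x ^ 2 with hN
  obtain ⟨B0, hB0⟩ := (hi.mul hc).bdd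
  obtain ⟨B1, hB1⟩ := (hi.mul hb.deriv).bdd
  obtain ⟨B2, hB2⟩ := (hi.mul (ha.deriv.deriv.add hb)).bdd
  obtain ⟨B3, hB3⟩ := (hi.mul (ha.deriv.const_mul 2)).bdd
  have p0 : 0 ≤ B0 := (abs_nonneg _).trans (hB0 0)
  have p1 : 0 ≤ B1 := (abs_nonneg _).trans (hB1 0)
  have p2 : 0 ≤ B2 := (abs_nonneg _).trans (hB2 0)
  have p3 : 0 ≤ B3 := (abs_nonneg _).trans (hB3 0)
  -- From 2pr ≤ p² + r²: the 3 covers the products of consecutive derivatives, B0, B1, B2 the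
  -- lower-order terms of the equation multiplied by the third derivative, and 2 * B3 the term in
  -- which the third derivative meets itself.
  set C : ℝ := 3 + B0 + B1 + B2 + 2 * B3 with hC
  have dN : ∀ x, ∃ N', HasDerivAt N N' x ∧ |N'| ≤ C * N x := fun x => by
    obtain ⟨d0, d1, d2, d3⟩ := H.hasDerivAt_jet x
    have e := H.eq_zero x
    rw [divForm] at e
    set u := h x with hu
    set v := iteratedDeriv 1 h x with hv
    set w := iteratedDeriv 2 h x with hw
    set z := iteratedDeriv 3 h x with hz
    have e4 : iteratedDeriv 4 h x = -((a x)⁻¹ * c x * u + (a x)⁻¹ * deriv b x * v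
        + (a x)⁻¹ * (deriv (deriv a) x + b x) * w + (a x)⁻¹ * (2 * deriv a x) * z) := by
      field_simp [ha0 x]
      linear_combination e
    refine ⟨_, (((d0.fun_pow 2).add (d1.fun_pow 2)).add (d2.fun_pow 2)).add (d3.fun_pow 2), ?_⟩
    rw [e4]
    have q : ∀ {s B : ℝ} (p r : ℝ), |s| ≤ B → |2 * s * p * r| ≤ B * (p ^ 2 + r ^ 2) := by
      intro s B p r hs
      have : |2 * s * p * r| = |s| * (2 * |p| * |r|) := by
        simp only [abs_mul, abs_two]; ring
      rw [this]
      have h2 : 2 * |p| * |r| ≤ p ^ 2 + r ^ 2 := by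
        nlinarith [sq_nonneg (|p| - |r|), sq_abs p, sq_abs r]
      exact mul_le_mul hs h2 (by positivity) ((abs_nonneg _).trans hs)
    have q0 := q u z (hB0 x)
    have q1 := q v z (hB1 x)
    have q2 := q w z (hB2 x)
    have q3 := q z z (hB3 x)
    have q4 := q (s := 1) (B := 1) u v (by simp)
    have q5 := q (s := 1) (B := 1) v w (by simp)
    have q6 := q (s := 1) (B := 1) w z (by simp)
    have hNx : N x = u ^ 2 + v ^ 2 + w ^ 2 + z ^ 2 := rfl
    have r1 : ∀ p : ℝ, 0 ≤ p ^ 2 := sq_nonneg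
    rw [hNx, hC]
    rw [abs_le] at q0 q1 q2 q3 q4 q5 q6 ⊢
    have P0 := mul_nonneg p0 (add_nonneg (r1 v) (r1 w))
    have P1 := mul_nonneg p1 (add_nonneg (r1 u) (r1 w))
    have P2 := mul_nonneg p2 (add_nonneg (r1 u) (r1 v))
    have P3 := mul_nonneg p3 (add_nonneg (add_nonneg (r1 u) (r1 v)) (r1 w))
    have P4 := r1 u
    have P5 := r1 v
    have P6 := r1 w
    have P7 := r1 z
    push_cast
    constructor <;> linarith
  have N0 : N 0 = 0 := by
    have g0 : h 0 = 0 := by simpa [jet] using congrFun h0 0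
    have g1 : iteratedDeriv 1 h 0 = 0 := by simpa [jet] using congrFun h0 1
    have g2 : iteratedDeriv 2 h 0 = 0 := by simpa [jet] using congrFun h0 2
    have g3 : iteratedDeriv 3 h 0 = 0 := by simpa [jet] using congrFun h0 3
    rw [hN]
    simp [g0, g1, g2, g3]
  have Nn : ∀ x, 0 ≤ N x := fun x => by positivity
  have key : N x = 0 := by
    have E : ∀ s x : ℝ, HasDerivAt (fun x => Real.exp (s * x)) (s * Real.exp (s * x)) x :=
      fun s x => by
        simpa [mul_comm] using ((hasDerivAt_id x).const_mul s).exp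
    -- N exp(-Cx) is nonincreasing and N exp(Cx) is nondecreasing; both vanish at 0, which settles
    -- the two half-lines.
    rcases le_total 0 x with hx | hx
    · have : Antitone (fun x => N x * Real.exp (-C * x)) := by
        refine antitone_of_hasDerivAt_nonpos
          (f' := fun x => deriv N x * Real.exp (-C * x) + N x * (-C * Real.exp (-C * x))) (fun y => ?_) fun y => ?_
        · obtain ⟨N', h1, -⟩ := dN y
          exact h1.differentiableAt.hasDerivAt.mul (E _ y)
        · obtain ⟨N', h1, h2⟩ := dN y
          simp only [h1.deriv, Pi.zero_apply]
          have := mul_le_mul_of_nonneg_right ((le_abs_self _).trans h2) (Real.exp_pos (-C * y)).le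
          nlinarith
      have h1 := this hx
      simp only [N0, zero_mul] at h1
      exact le_antisymm (nonpos_of_mul_nonpos_left h1 (Real.exp_pos _)) (Nn x)
    · have : Monotone (fun x => N x * Real.exp (C * x)) := by
        refine monotone_of_hasDerivAt_nonneg
          (f' := fun x => deriv N x * Real.exp (C * x) + N x * (C * Real.exp (C * x))) (fun y => ?_) fun y => ?_
        · obtain ⟨N', h1, -⟩ := dN y
          exact h1.differentiableAt.hasDerivAt.mul (E _ y)
        · obtain ⟨N', h1, h2⟩ := dN y
          simp only [h1.deriv, Pi.zero_apply]
          have := mul_le_mul_of_nonneg_right ((neg_le_abs _).trans h2) (Real.exp_pos (C * y)).le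
          nlinarith
      have h1 := this hx
      simp only [N0, zero_mul] at h1
      exact le_antisymm (nonpos_of_mul_nonpos_left h1 (Real.exp_pos _)) (Nn x)
  rw [hN] at key
  simp only at key
  have : h x ^ 2 ≤ 0 := by
    nlinarith [sq_nonneg (iteratedDeriv 1 h x),
      sq_nonneg (iteratedDeriv 2 h x), sq_nonneg (iteratedDeriv 3 h x)]
  exact pow_eq_zero_iff two_ne_zero |>.1 (le_antisymm this (sq_nonneg _))

end IsL2Solution

/-- The bilinear concomitant as a bilinear form on `ℝ⁴`. -/
def concomitantForm (a₀ a₁ b₀ : ℝ) : LinearMap.BilinForm ℝ (Fin 4 → ℝ) :=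
  LinearMap.mk₂ ℝ (concomitant a₀ a₁ b₀)
    (fun u u' v => by simp [concomitant]; ring) (fun r u v => by simp [concomitant]; ring)
    (fun u v v' => by simp [concomitant]; ring) (fun r u v => by simp [concomitant]; ring)

theorem concomitantForm_apply (a₀ a₁ b₀ : ℝ) (u v : Fin 4 → ℝ) :
    concomitantForm a₀ a₁ b₀ u v = concomitant a₀ a₁ b₀ u v := rfl

theorem concomitant_swap (a₀ a₁ b₀ : ℝ) (u v : Fin 4 → ℝ) :
    concomitant a₀ a₁ b₀ v u = -concomitant a₀ a₁ b₀ u v := by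
  simp only [concomitant]; ring

theorem concomitant_self (a₀ a₁ b₀ : ℝ) (u : Fin 4 → ℝ) : concomitant a₀ a₁ b₀ u u = 0 := by
  simp only [concomitant]; ring

/-- Pairing u with the basis vectors from the last to the first is a triangular system for u 0, u 1,
u 2, u 3 in turn, with diagonal entries ±a₀. -/
theorem concomitantForm_nondegenerate {a₀ : ℝ} (a₁ b₀ : ℝ) (ha : a₀ ≠ 0) :
    (concomitantForm a₀ a₁ b₀).Nondegenerate := by
  have key : ∀ u, (∀ v, concomitant a₀ a₁ b₀ u v = 0) → u = 0 := fun u h => by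
    have h3 := h ![0, 0, 0, 1]
    have h2 := h ![0, 0, 1, 0]
    have h1 := h ![0, 1, 0, 0]
    have h0 := h ![1, 0, 0, 0]
    simp [concomitant, ha] at h3
    simp [concomitant, h3, ha] at h2
    simp [concomitant, h3, ha] at h1
    simp [concomitant, h3, h2, h1, ha] at h0
    funext i
    fin_cases i <;> simp [h0, h1, h2, h3]
  refine ⟨fun u h => key u h, fun u h => key u fun v => ?_⟩
  rw [← neg_eq_zero, ← concomitant_swap]
  exact h v

/-- In `ℝ⁴` an isotropic plane for the concomitant is its own orthogonal. -/
theorem exists_eq_combination {a₀ a₁ b₀ : ℝ} (ha : a₀ ≠ 0) {u v z : Fin 4 → ℝ}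
    (hi : LinearIndependent ℝ ![u, v]) (huv : concomitant a₀ a₁ b₀ u v = 0)
    (huz : concomitant a₀ a₁ b₀ u z = 0) (hvz : concomitant a₀ a₁ b₀ v z = 0) :
    ∃ α β : ℝ, α • u + β • v = z := by
  set B := concomitantForm a₀ a₁ b₀ with hB
  set V := Submodule.span ℝ (Set.range ![u, v]) with hV
  have dV : Module.finrank ℝ V = 2 := by
    rw [hV, finrank_span_eq_card hi]; simp
  have dW := LinearMap.BilinForm.finrank_orthogonal (concomitantForm_nondegenerate a₁ b₀ ha) V
  rw [dV, Module.finrank_fin_fun] at dW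
  have mem : ∀ w, concomitant a₀ a₁ b₀ u w = 0 → concomitant a₀ a₁ b₀ v w = 0 →
      w ∈ B.orthogonal V := fun w h1 h2 => by
    rw [LinearMap.BilinForm.mem_orthogonal_iff]
    intro n hn
    rw [hV, Matrix.range_cons_cons_empty, Submodule.mem_span_pair] at hn
    obtain ⟨α, β, rfl⟩ := hn
    change B (α • u + β • v) w = 0
    rw [map_add, map_smul, map_smul, LinearMap.add_apply, LinearMap.smul_apply,
      LinearMap.smul_apply, hB, concomitantForm_apply, concomitantForm_apply, h1, h2]
    simp
  have le : V ≤ B.orthogonal V := by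
    rw [Submodule.span_le]
    rintro w hw
    rw [Matrix.range_cons_cons_empty] at hw
    rcases hw with rfl | rfl
    · exact mem _ (concomitant_self ..) (by rw [concomitant_swap, huv, neg_zero])
    · exact mem _ huv (concomitant_self ..)
  -- The orthogonal has dimension 4 - 2 = 2, so the isotropic plane fills it.
  have eq : V = B.orthogonal V := Submodule.eq_of_le_of_finrank_eq le (by rw [dV, dW])
  have := mem z huz hvz
  rw [← eq, hV, Matrix.range_cons_cons_empty, Submodule.mem_span_pair] at this
  exact this

theorem MemH.congr {n : ℕ} {f f' : ℝ → ℝ} (h : MemH n f) (e : f =ᵐ[volume] f') : MemH n f' := by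
  cases n with
  | zero => exact (memLp_congr_ae e).1 h
  | succ n =>
    obtain ⟨h0, g, h1, h2⟩ := h
    exact ⟨(memLp_congr_ae e).1 h0, g, h1.congr e EventuallyEq.rfl, h2⟩

/-! ### Membership in H⁴ and the bound on the dimension -/

namespace IsL2Solution

variable {a b c h k : ℝ → ℝ}

theorem continuous_four (H : IsL2Solution a b c h) : Continuous (iteratedDeriv 4 h) :=
  H.contDiff.continuous_iteratedDeriv 4 (by norm_num)

/-- The equation divided by a expresses the fourth derivative by the lower ones with bounded
coefficients. -/
theorem memLp_four (H : IsL2Solution a b c h) (ha : BddSmooth a) (hb : BddSmooth b)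
    (hc : BddSmooth c) (hi : BddSmooth (fun x => (a x)⁻¹)) (ha0 : ∀ x, a x ≠ 0) :
    MemLp (iteratedDeriv 4 h) 2 volume := by
  have i0 := memLp_mul_bdd (H.memLp 0 (by norm_num)) (hi.mul hc)
  have i1 := memLp_mul_bdd (H.memLp 1 (by norm_num)) (hi.mul hb.deriv)
  have i2 := memLp_mul_bdd (H.memLp 2 (by norm_num)) (hi.mul (ha.deriv.deriv.add hb))
  have i3 := memLp_mul_bdd (H.memLp 3 (by norm_num)) (hi.mul (ha.deriv.const_mul 2))
  refine (memLp_congr_ae ?_).1 (((i0.add i1).add i2).add i3).neg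
  refine Eventually.of_forall fun x => ?_
  have e := H.eq_zero x
  rw [divForm] at e
  simp only [Pi.neg_apply, Pi.add_apply, iteratedDeriv_zero]
  field_simp [ha0 x]
  linear_combination -e

theorem memH (H : IsL2Solution a b c h) (ha : BddSmooth a) (hb : BddSmooth b)
    (hc : BddSmooth c) (hi : BddSmooth (fun x => (a x)⁻¹)) (ha0 : ∀ x, a x ≠ 0) : MemH 4 h := by
  have d := H.hasDerivAt_jet
  have c3 := continuous_of_hasDerivAt fun x => (d x).2.2.2
  have c2 := continuous_of_hasDerivAt fun x => (d x).2.2.1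
  have c1 := continuous_of_hasDerivAt fun x => (d x).2.1
  have m0 := H.memLp 0 (by norm_num)
  rw [iteratedDeriv_zero] at m0
  exact ⟨m0, _, isWeakDeriv_of_hasDerivAt (fun x => (d x).1) c1, H.memLp 1 (by norm_num), _,
    isWeakDeriv_of_hasDerivAt (fun x => (d x).2.1) c2, H.memLp 2 (by norm_num), _,
    isWeakDeriv_of_hasDerivAt (fun x => (d x).2.2.1) c3, H.memLp 3 (by norm_num), _,
    isWeakDeriv_of_hasDerivAt (fun x => (d x).2.2.2) H.continuous_four,
    H.memLp_four ha hb hc hi ha0⟩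

/-- Two linearly independent square integrable solutions span the space of all such. -/
theorem exists_combination {h₁ h₂ : ℝ → ℝ} (H : IsL2Solution a b c h) (K₁ : IsL2Solution a b c h₁)
    (K₂ : IsL2Solution a b c h₂) (ha : BddSmooth a) (hb : BddSmooth b)
    (hc : BddSmooth c) (hi : BddSmooth (fun x => (a x)⁻¹)) (ha0 : ∀ x, a x ≠ 0)
    (ind : ∀ α β : ℝ, (∀ x, α * h₁ x + β * h₂ x = 0) → α = 0 ∧ β = 0) :
    ∃ α β : ℝ, ∀ x, h x = α * h₁ x + β * h₂ x := by
  have jl : ∀ {f g : ℝ → ℝ} (α β : ℝ), IsL2Solution a b c f → IsL2Solution a b c g →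
      jet (fun x => α * f x + β * g x) 0 = α • jet f 0 + β • jet g 0 := fun {f g} α β F G => by
    funext i
    have hn' : ((i : ℕ) : WithTop ℕ∞) ≤ 4 := by exact_mod_cast i.2.le
    have h1 := (F.contDiff.of_le hn')
    have k1 := (G.contDiff.of_le hn')
    simp only [jet, Pi.add_apply, Pi.smul_apply, smul_eq_mul]
    rw [iteratedDeriv_fun_add (contDiff_const.mul h1).contDiffAt (contDiff_const.mul k1).contDiffAt,
      iteratedDeriv_const_mul_field, iteratedDeriv_const_mul_field]
  have zero : ∀ {f : ℝ → ℝ}, IsL2Solution a b c f → jet f 0 = 0 → ∀ x, f x = 0 :=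
    fun F h0 => F.eq_zero_of_jet_eq_zero ha hb hc hi ha0 h0
  -- A dependency between the jets at 0 would, by uniqueness for the initial value problem, be a
  -- dependency between the functions.
  have li : LinearIndependent ℝ ![jet h₁ 0, jet h₂ 0] := by
    rw [LinearIndependent.pair_iff]
    intro α β e
    exact ind α β (zero (K₁.combination K₂ α β) (by rw [jl α β K₁ K₂, e]))
  obtain ⟨α, β, e⟩ := exists_eq_combination (ha0 0) li (K₁.concomitant_eq_zero K₂ ha hb 0)
    (K₁.concomitant_eq_zero H ha hb 0) (K₂.concomitant_eq_zero H ha hb 0)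
  refine ⟨α, β, fun x => ?_⟩
  have := zero (H.combination (K₁.combination K₂ α β) 1 (-1)) (by
    rw [jl 1 (-1) H (K₁.combination K₂ α β), jl α β K₁ K₂, e]; simp) x
  linarith

end IsL2Solution

/-- If `opL` has two linearly independent square integrable classical solutions, its kernel is
their span. -/
theorem ker_opL_eq_span {l₁ l₂ : ℝ} {m h₁ h₂ : ℝ → ℝ} (ha : BddSmooth (coefA m))
    (hb : BddSmooth (coefB l₂ m)) (hc : BddSmooth (coefC l₁ l₂ m))
    (hi : BddSmooth (fun x => (coefA m x)⁻¹)) (ha0 : ∀ x, coefA m x ≠ 0)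
    (K₁ : IsL2Solution (coefA m) (coefB l₂ m) (coefC l₁ l₂ m) h₁)
    (K₂ : IsL2Solution (coefA m) (coefB l₂ m) (coefC l₁ l₂ m) h₂)
    (ind : ∀ α β : ℝ, (∀ x, α * h₁ x + β * h₂ x = 0) → α = 0 ∧ β = 0) :
    ∃ (m₁ : MemLp h₁ 2 volume) (m₂ : MemLp h₂ 2 volume),
      LinearIndependent ℝ ![m₁.toLp, m₂.toLp] ∧
      {h : Lp ℝ 2 (volume : Measure ℝ) | MemH 4 h ∧ opL l₁ l₂ m h =ᵐ[volume] 0} =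
        (Submodule.span ℝ {m₁.toLp, m₂.toLp} : Set (Lp ℝ 2 (volume : Measure ℝ))) := by
  have m₁ : MemLp h₁ 2 volume := by simpa using K₁.memLp 0 (by norm_num)
  have m₂ : MemLp h₂ 2 volume := by simpa using K₂.memLp 0 (by norm_num)
  have co : ∀ α β : ℝ, (α • m₁.toLp + β • m₂.toLp : Lp ℝ 2 (volume : Measure ℝ)) =ᵐ[volume]
      fun x => α * h₁ x + β * h₂ x := fun α β => by
    filter_upwards [Lp.coeFn_add (α • m₁.toLp) (β • m₂.toLp), Lp.coeFn_smul α m₁.toLp,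
      Lp.coeFn_smul β m₂.toLp, m₁.coeFn_toLp, m₂.coeFn_toLp] with x e1 e2 e3 e4 e5
    rw [e1, Pi.add_apply, e2, e3, Pi.smul_apply, Pi.smul_apply, e4, e5, smul_eq_mul, smul_eq_mul]
  refine ⟨m₁, m₂, ?_, ?_⟩
  · rw [LinearIndependent.pair_iff]
    intro α β e
    refine ind α β fun x => ?_
    have h0 : (fun x => α * h₁ x + β * h₂ x) =ᵐ[volume] fun _ => 0 := by
      refine (co α β).symm.trans ?_
      rw [e]
      exact Lp.coeFn_zero ..
    have hcont : Continuous fun x => α * h₁ x + β * h₂ x :=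
      (K₁.combination K₂ α β).contDiff.continuous
    exact congrFun ((hcont.ae_eq_iff_eq volume continuous_const).1 h0) x
  · ext h
    rw [mem_ofPred_eq, SetLike.mem_coe, Submodule.mem_span_pair]
    constructor
    · rintro ⟨hH, h0⟩
      obtain ⟨H, e, K⟩ := exists_isL2Solution ha.contDiff hb.contDiff hc.continuous ha0 hH h0
      obtain ⟨α, β, hαβ⟩ := K.exists_combination K₁ K₂ ha hb hc hi ha0 ind
      refine ⟨α, β, Lp.ext ((co α β).trans ?_)⟩
      filter_upwards [e] with x hx
      rw [hx, hαβ]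
    · rintro ⟨α, β, rfl⟩
      have K := K₁.combination K₂ α β
      have d := K.hasDerivAt_jet
      refine ⟨(K.memH ha hb hc hi ha0).congr (co α β).symm, ?_⟩
      refine (opL_ae_eq_divForm ha.contDiff hb.contDiff (co α β) (fun x => (d x).1)
        (fun x => (d x).2.1) (fun x => (d x).2.2.1)
        (isWeakDeriv_of_hasDerivAt (fun x => (d x).2.2.2) K.continuous_four)
        (continuous_of_hasDerivAt fun x => (d x).2.2.2)).trans ?_
      exact Eventually.of_forall K.eq_zero

/-! ### Smooth functions of two variables -/

/-- Partial derivative in the second variable. -/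
def pderiv₂ (F : ℝ → ℝ → ℝ) (s x : ℝ) : ℝ := deriv (F s) x

/-- Partial derivative in the first variable. -/
def pderiv₁ (F : ℝ → ℝ → ℝ) (s x : ℝ) : ℝ := deriv (fun r => F r x) s

/-- Joint smoothness of a function of two real variables. -/
def JointSmooth (F : ℝ → ℝ → ℝ) : Prop := ContDiff ℝ ∞ fun p : ℝ × ℝ => F p.1 p.2

namespace JointSmooth

variable {F : ℝ → ℝ → ℝ}

theorem hasFDerivAt (hF : JointSmooth F) (p : ℝ × ℝ) :
    HasFDerivAt (fun p : ℝ × ℝ => F p.1 p.2) (fderiv ℝ (fun p : ℝ × ℝ => F p.1 p.2) p) p :=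
  (ContDiff.differentiable hF (by simp) p).hasFDerivAt

theorem hasDerivAt_curve (hF : JointSmooth F) {u v : ℝ → ℝ} {u' v' r : ℝ}
    (hu : HasDerivAt u u' r) (hv : HasDerivAt v v' r) :
    HasDerivAt (fun r => F (u r) (v r))
      (fderiv ℝ (fun p : ℝ × ℝ => F p.1 p.2) (u r, v r) (u', v')) r :=
  HasFDerivAt.comp_hasDerivAt r (f := fun r => (u r, v r)) (hF.hasFDerivAt (u r, v r))
    (hu.prodMk hv)

theorem pderiv₁_eq (hF : JointSmooth F) (s x : ℝ) :
    pderiv₁ F s x = fderiv ℝ (fun p : ℝ × ℝ => F p.1 p.2) (s, x) (1, 0) :=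
  (hF.hasDerivAt_curve (hasDerivAt_id s) (hasDerivAt_const s x)).deriv

theorem pderiv₂_eq (hF : JointSmooth F) (s x : ℝ) :
    pderiv₂ F s x = fderiv ℝ (fun p : ℝ × ℝ => F p.1 p.2) (s, x) (0, 1) :=
  (hF.hasDerivAt_curve (hasDerivAt_const x s) (hasDerivAt_id x)).deriv

theorem hasDerivAt₁ (hF : JointSmooth F) (s x : ℝ) :
    HasDerivAt (fun r => F r x) (pderiv₁ F s x) s :=
  (hF.hasDerivAt_curve (hasDerivAt_id s) (hasDerivAt_const s x)).differentiableAt.hasDerivAt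

theorem hasDerivAt₂ (hF : JointSmooth F) (s x : ℝ) :
    HasDerivAt (F s) (pderiv₂ F s x) x :=
  (hF.hasDerivAt_curve (hasDerivAt_const x s) (hasDerivAt_id x)).differentiableAt.hasDerivAt

/-- The chain rule along a curve. -/
theorem hasDerivAt_comp (hF : JointSmooth F) {u v : ℝ → ℝ} {u' v' r : ℝ}
    (hu : HasDerivAt u u' r) (hv : HasDerivAt v v' r) :
    HasDerivAt (fun r => F (u r) (v r))
      (u' * pderiv₁ F (u r) (v r) + v' * pderiv₂ F (u r) (v r)) r := by
  refine (hF.hasDerivAt_curve hu hv).congr_deriv ?_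
  rw [hF.pderiv₁_eq, hF.pderiv₂_eq, ← smul_eq_mul, ← smul_eq_mul, ← map_smul, ← map_smul, ← map_add]
  simp

theorem contDiff_fderiv (hF : JointSmooth F) :
    ContDiff ℝ ∞ (fderiv ℝ fun p : ℝ × ℝ => F p.1 p.2) :=
  ContDiff.fderiv_right hF (by simp)

theorem jointSmooth₁ (hF : JointSmooth F) : JointSmooth (pderiv₁ F) := by
  have : (fun p : ℝ × ℝ => pderiv₁ F p.1 p.2) =
      fun p => fderiv ℝ (fun p : ℝ × ℝ => F p.1 p.2) p (1, 0) :=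
    funext fun p => hF.pderiv₁_eq p.1 p.2
  rw [JointSmooth, this]
  exact hF.contDiff_fderiv.clm_apply contDiff_const

theorem jointSmooth₂ (hF : JointSmooth F) : JointSmooth (pderiv₂ F) := by
  have : (fun p : ℝ × ℝ => pderiv₂ F p.1 p.2) =
      fun p => fderiv ℝ (fun p : ℝ × ℝ => F p.1 p.2) p (0, 1) :=
    funext fun p => hF.pderiv₂_eq p.1 p.2
  rw [JointSmooth, this]
  exact hF.contDiff_fderiv.clm_apply contDiff_const

theorem pderiv_comm (hF : JointSmooth F) :
    pderiv₁ (pderiv₂ F) = pderiv₂ (pderiv₁ F) := by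
  funext s x
  set G : ℝ × ℝ → ℝ := fun p => F p.1 p.2 with hG
  have d : HasFDerivAt (fderiv ℝ G) (fderiv ℝ (fderiv ℝ G) (s, x)) (s, x) :=
    (hF.contDiff_fderiv.differentiable (by simp) (s, x)).hasFDerivAt
  have key : ∀ v w : ℝ × ℝ, fderiv ℝ (fun p => fderiv ℝ G p v) (s, x) w =
      fderiv ℝ (fderiv ℝ G) (s, x) w v := fun v w => by
    have := d.clm_apply (hasFDerivAt_const v (s, x))
    rw [this.fderiv]
    simp
  have e1 : (fun p : ℝ × ℝ => pderiv₂ F p.1 p.2) = fun p => fderiv ℝ G p (0, 1) :=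
    funext fun p => hF.pderiv₂_eq p.1 p.2
  have e2 : (fun p : ℝ × ℝ => pderiv₁ F p.1 p.2) = fun p => fderiv ℝ G p (1, 0) :=
    funext fun p => hF.pderiv₁_eq p.1 p.2
  rw [hF.jointSmooth₂.pderiv₁_eq, hF.jointSmooth₁.pderiv₂_eq, e1, e2, key, key]
  exact second_derivative_symmetric (fun p => hF.hasFDerivAt p) d _ _

theorem contDiff_right (hF : JointSmooth F) (s : ℝ) : ContDiff ℝ ∞ (F s) :=
  ContDiff.comp (g := fun p : ℝ × ℝ => F p.1 p.2) hF (contDiff_const.prodMk contDiff_id)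

end JointSmooth

/-- The inverses of a smooth family of increasing diffeomorphisms of the line form a smooth
family. -/
theorem JointSmooth.invFun {F : ℝ → ℝ → ℝ} (hF : JointSmooth F) (hpos : ∀ s y, 0 < pderiv₂ F s y)
    (hbij : ∀ s, Function.Bijective (F s)) : JointSmooth fun s x => Function.invFun (F s) x := by
  -- The differential of (s, y) ↦ (s, F s y) is triangular with diagonal 1, ∂F/∂y, hence invertible.
  -- The inverse function theorem gives a smooth local inverse, and bijectivity makes it agree with
  -- the global inverse Ψ.
  set Φ : ℝ × ℝ → ℝ × ℝ := fun p => (p.1, F p.1 p.2) with hΦ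
  have cΦ : ContDiff ℝ ∞ Φ := contDiff_fst.prodMk hF
  set Ψ : ℝ × ℝ → ℝ × ℝ := fun p => (p.1, Function.invFun (F p.1) p.2) with hΨ
  have ΨΦ : ∀ p, Ψ (Φ p) = p := fun p => by
    simp only [hΨ, hΦ]
    rw [Function.leftInverse_invFun (hbij p.1).1 p.2]
  have ΦΨ : ∀ p, Φ (Ψ p) = p := fun p => by
    simp only [hΨ, hΦ]
    rw [Function.rightInverse_invFun (hbij p.1).2 p.2]
  have cΨ : ContDiff ℝ ∞ Ψ := contDiff_iff_contDiffAt.2 fun P => by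
    obtain ⟨p, rfl⟩ : ∃ p, Φ p = P := ⟨_, ΦΨ P⟩
    set b := pderiv₂ F p.1 p.2 with hb
    set a := pderiv₁ F p.1 p.2 with ha
    have b0 : b ≠ 0 := (hpos _ _).ne'
    have dF := hF.hasFDerivAt p
    have val : ∀ v : ℝ × ℝ, fderiv ℝ (fun p : ℝ × ℝ => F p.1 p.2) p v = v.1 * a + v.2 * b :=
      fun v => by
        rw [ha, hb, hF.pderiv₁_eq, hF.pderiv₂_eq, ← smul_eq_mul, ← smul_eq_mul, ← map_smul,
          ← map_smul, ← map_add]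
        simp
    let e : (ℝ × ℝ) ≃L[ℝ] (ℝ × ℝ) := ContinuousLinearEquiv.equivOfInverse
      ((ContinuousLinearMap.fst ℝ ℝ ℝ).prod (fderiv ℝ (fun p : ℝ × ℝ => F p.1 p.2) p))
      ((ContinuousLinearMap.fst ℝ ℝ ℝ).prod (b⁻¹ • (ContinuousLinearMap.snd ℝ ℝ ℝ
        - a • ContinuousLinearMap.fst ℝ ℝ ℝ)))
      (fun v => by
        ext
        · simp
        · simp [val]; field_simp; ring)
      (fun v => by
        ext
        · simp
        · simp [val]; field_simp; ring)
    have d : HasFDerivAt Φ (e : ℝ × ℝ →L[ℝ] ℝ × ℝ) p := hasFDerivAt_fst.prodMk dF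
    have loc := ContDiffAt.to_localInverse (cΦ.contDiffAt (x := p)) d (by simp)
    refine loc.congr_of_eventuallyEq ?_
    have right := (cΦ.contDiffAt (x := p)).hasStrictFDerivAt' d (by simp) |>.eventually_right_inverse
    filter_upwards [right] with z hz
    rw [← hz, ΨΦ]
    exact congrArg _ hz.symm
  exact contDiff_snd.comp cΨ

/-! ### The operator as a Fréchet derivative -/

/-- The Euler-Lagrange expression, in terms of the inverse `z` of the profile and the derivatives
`m₁, …, m₄` of the profile, whose Fréchet derivative is `opL`. -/
def eulerExpr (l₁ l₂ z m₁ m₂ m₃ m₄ : ℝ) : ℝ :=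
  z ^ 7 * m₄ - 14 * (z ^ 8 * (m₁ * m₃)) - 21 / 2 * (z ^ 8 * m₂ ^ 2) + 98 * (z ^ 9 * (m₁ ^ 2 * m₂))
    - 189 / 2 * (z ^ 10 * m₁ ^ 4) + 35 / 4 * (z ^ 8 * m₁ ^ 2) - 5 / 2 * (z ^ 7 * m₂)
    - 5 / 16 * z ^ 6 + l₂ * (5 * (z ^ 6 * m₁ ^ 2) - 2 * (z ^ 5 * m₂) - 3 / 4 * z ^ 4)
    - l₁ * z ^ 2

/-! ### The coefficients as polynomials in 1/m and the derivatives of m -/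

section coefficients

variable {m m₁ m₂ m₃ m₄ : ℝ → ℝ}

theorem hasDerivAt_inv_of_pos {m' x : ℝ} (h : HasDerivAt m m' x) (hm : 0 < m x) :
    HasDerivAt (fun x => (m x)⁻¹) (-((m x)⁻¹ ^ 2 * m')) x :=
  (h.fun_inv hm.ne').congr_deriv (by field_simp)

theorem zpow_neg_eq (n : ℕ) [n.AtLeastTwo] (y : ℝ) :
    y ^ (-(OfNat.ofNat n : ℤ)) = y⁻¹ ^ (OfNat.ofNat n : ℕ) := by
  rw [zpow_neg, inv_pow]
  exact congrArg _ (zpow_natCast y n)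

/-- The derivative of `(1 / m)ⁿ⁺¹ f`. -/
theorem deriv_zpow_mul (h0 : ∀ x, HasDerivAt m (m₁ x) x) (hm : ∀ x, 0 < m x) (n : ℕ) {f f' : ℝ → ℝ}
    (hf : ∀ x, HasDerivAt f (f' x) x) (x : ℝ) :
    HasDerivAt (fun x => (m x)⁻¹ ^ (n + 1) * f x)
      (-(n + 1) * (m x)⁻¹ ^ (n + 2) * m₁ x * f x + (m x)⁻¹ ^ (n + 1) * f' x) x := by
  refine (((hasDerivAt_inv_of_pos (h0 x) (hm x)).fun_pow (n + 1)).mul (hf x)).congr_deriv ?_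
  push_cast
  ring

theorem deriv_coefA (h0 : ∀ x, HasDerivAt m (m₁ x) x) (hm : ∀ x, 0 < m x) :
    deriv (coefA m) = fun x => -7 * ((m x)⁻¹ ^ 8 * m₁ x) := by
  funext x
  have e : coefA m = fun x => (m x)⁻¹ ^ (6 + 1) * 1 := by
    funext x; rw [coefA, mul_one]; exact zpow_neg_eq 7 _
  rw [e, (deriv_zpow_mul h0 hm 6 (fun x => hasDerivAt_const x 1) x).deriv]
  norm_num
  ring

theorem deriv_deriv_coefA (h0 : ∀ x, HasDerivAt m (m₁ x) x) (h1 : ∀ x, HasDerivAt m₁ (m₂ x) x)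
    (hm : ∀ x, 0 < m x) :
    deriv (deriv (coefA m)) =
      fun x => -7 * ((m x)⁻¹ ^ 8 * m₂ x) + 56 * ((m x)⁻¹ ^ 9 * m₁ x ^ 2) := by
  rw [deriv_coefA h0 hm]
  funext x
  rw [((deriv_zpow_mul h0 hm 7 h1 x).const_mul (-7)).deriv]
  norm_num
  ring

theorem coefB_eq (h0 : ∀ x, HasDerivAt m (m₁ x) x) (h1 : ∀ x, HasDerivAt m₁ (m₂ x) x) (l₂ : ℝ) :
    coefB l₂ m = fun x => 42 * ((m x)⁻¹ ^ 9 * m₁ x ^ 2) - 14 * ((m x)⁻¹ ^ 8 * m₂ x)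
      - 5 / 2 * (m x)⁻¹ ^ 7 - 2 * l₂ * (m x)⁻¹ ^ 5 := by
  have e1 : deriv m = m₁ := funext fun x => (h0 x).deriv
  have e2 : deriv m₁ = m₂ := funext fun x => (h1 x).deriv
  funext x
  rw [coefB, e1, e2, zpow_neg_eq 9, zpow_neg_eq 8, zpow_neg_eq 7, zpow_neg_eq 5]
  ring

theorem deriv_coefB (h0 : ∀ x, HasDerivAt m (m₁ x) x) (h1 : ∀ x, HasDerivAt m₁ (m₂ x) x)
    (h2 : ∀ x, HasDerivAt m₂ (m₃ x) x) (hm : ∀ x, 0 < m x) (l₂ : ℝ) :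
    deriv (coefB l₂ m) = fun x => -378 * ((m x)⁻¹ ^ 10 * m₁ x ^ 3)
      + 196 * ((m x)⁻¹ ^ 9 * (m₁ x * m₂ x)) - 14 * ((m x)⁻¹ ^ 8 * m₃ x)
      + 35 / 2 * ((m x)⁻¹ ^ 8 * m₁ x) + 10 * l₂ * ((m x)⁻¹ ^ 6 * m₁ x) := by
  rw [coefB_eq h0 h1 l₂]
  funext x
  have D := ((((deriv_zpow_mul h0 hm 8 (fun x => (h1 x).fun_pow 2) x).const_mul 42).sub
    ((deriv_zpow_mul h0 hm 7 h2 x).const_mul 14)).sub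
    (((hasDerivAt_inv_of_pos (h0 x) (hm x)).fun_pow 7).const_mul (5 / 2))).sub
    (((hasDerivAt_inv_of_pos (h0 x) (hm x)).fun_pow 5).const_mul (2 * l₂))
  refine D.deriv.trans ?_
  norm_num
  ring

/-- With every product differentiated out, comparing the operator with the linearized Euler-Lagrange
expression becomes a polynomial identity. -/
theorem qPot_eq (h0 : ∀ x, HasDerivAt m (m₁ x) x) (h1 : ∀ x, HasDerivAt m₁ (m₂ x) x)
    (h2 : ∀ x, HasDerivAt m₂ (m₃ x) x) (h3 : ∀ x, HasDerivAt m₃ (m₄ x) x)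
    (hm : ∀ x, 0 < m x) (l₂ x : ℝ) :
    qPot l₂ m x = 28 * ((m x)⁻¹ ^ 9 * m₂ x ^ 2) + 70 * ((m x)⁻¹ ^ 9 * m₁ x ^ 2)
      - 5 / 2 * (-7 * ((m x)⁻¹ ^ 8 * m₂ x) + 56 * ((m x)⁻¹ ^ 9 * m₁ x ^ 2))
      - 315 * ((m x)⁻¹ ^ 11 * m₁ x ^ 4)
      - 126 * (-10 * ((m x)⁻¹ ^ 11 * m₁ x ^ 4) + 3 * ((m x)⁻¹ ^ 10 * (m₁ x ^ 2 * m₂ x)))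
      - 7 * (72 * ((m x)⁻¹ ^ 10 * (m₁ x ^ 2 * m₂ x)) - 8 * ((m x)⁻¹ ^ 9 * m₂ x ^ 2)
        - 16 * ((m x)⁻¹ ^ 9 * (m₁ x * m₃ x)) + (m x)⁻¹ ^ 8 * m₄ x)
      + 30 * l₂ * ((m x)⁻¹ ^ 7 * m₁ x ^ 2)
      - 2 * l₂ * (-5 * ((m x)⁻¹ ^ 6 * m₂ x) + 30 * ((m x)⁻¹ ^ 7 * m₁ x ^ 2)) := by
  have e1 : deriv m = m₁ := funext fun x => (h0 x).deriv
  have e2 : deriv m₁ = m₂ := funext fun x => (h1 x).deriv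
  have t1 : deriv (deriv fun z => m z ^ (-7 : ℤ)) x =
      -7 * ((m x)⁻¹ ^ 8 * m₂ x) + 56 * ((m x)⁻¹ ^ 9 * m₁ x ^ 2) :=
    congrFun (deriv_deriv_coefA h0 h1 hm) x
  have t2 : deriv (fun z => m z ^ (-10 : ℤ) * m₁ z ^ 3) x =
      -10 * ((m x)⁻¹ ^ 11 * m₁ x ^ 4) + 3 * ((m x)⁻¹ ^ 10 * (m₁ x ^ 2 * m₂ x)) := by
    have e : (fun z => m z ^ (-10 : ℤ) * m₁ z ^ 3) = fun z => (m z)⁻¹ ^ (9 + 1) * m₁ z ^ 3 := by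
      funext z; rw [zpow_neg_eq 10]
    rw [e, (deriv_zpow_mul h0 hm 9 (fun x => (h1 x).fun_pow 3) x).deriv]
    norm_num
    ring
  have t3 : deriv (fun z => m z ^ (-8 : ℤ) * m₂ z) =
      fun x => -8 * ((m x)⁻¹ ^ 9 * (m₁ x * m₂ x)) + (m x)⁻¹ ^ 8 * m₃ x := by
    have e : (fun z => m z ^ (-8 : ℤ) * m₂ z) = fun z => (m z)⁻¹ ^ (7 + 1) * m₂ z := by
      funext z; rw [zpow_neg_eq 8]
    funext x
    rw [e, (deriv_zpow_mul h0 hm 7 h2 x).deriv]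
    norm_num
    ring
  have t4 : deriv (deriv fun z => m z ^ (-8 : ℤ) * m₂ z) x =
      72 * ((m x)⁻¹ ^ 10 * (m₁ x ^ 2 * m₂ x)) - 8 * ((m x)⁻¹ ^ 9 * m₂ x ^ 2)
        - 16 * ((m x)⁻¹ ^ 9 * (m₁ x * m₃ x)) + (m x)⁻¹ ^ 8 * m₄ x := by
    rw [t3]
    refine (((deriv_zpow_mul h0 hm 8 (fun x => (h1 x).mul (h2 x)) x).const_mul (-8)).add
      (deriv_zpow_mul h0 hm 7 h3 x)).deriv.trans ?_
    norm_num
    ring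
  have t5 : deriv (fun z => m z ^ (-5 : ℤ)) = fun x => -5 * ((m x)⁻¹ ^ 6 * m₁ x) := by
    have e : (fun z => m z ^ (-5 : ℤ)) = fun z => (m z)⁻¹ ^ (4 + 1) * 1 := by
      funext z; rw [mul_one, zpow_neg_eq 5]
    funext x
    rw [e, (deriv_zpow_mul h0 hm 4 (fun x => hasDerivAt_const x 1) x).deriv]
    norm_num
    ring
  have t6 : deriv (deriv fun z => m z ^ (-5 : ℤ)) x =
      -5 * ((m x)⁻¹ ^ 6 * m₂ x) + 30 * ((m x)⁻¹ ^ 7 * m₁ x ^ 2) := by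
    rw [t5, ((deriv_zpow_mul h0 hm 5 h1 x).const_mul (-5)).deriv]
    norm_num
    ring
  rw [qPot, e1, e2, t1, t2, t4, t6, zpow_neg_eq 9, zpow_neg_eq 11, zpow_neg_eq 7]
  ring

end coefficients

/-- If the Euler-Lagrange expression is constant along a smooth family of profiles, the derivative
of the family is annihilated by the operator. -/
theorem divForm_pderiv₁_eq_zero {M : ℝ → ℝ → ℝ} (hM : JointSmooth M) (hpos : ∀ s x, 0 < M s x)
    {l₁ l₂ C : ℝ} (hE : ∀ s x, eulerExpr l₁ l₂ (M s x)⁻¹ (pderiv₂ M s x)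
      (pderiv₂ (pderiv₂ M) s x) (pderiv₂ (pderiv₂ (pderiv₂ M)) s x)
      (pderiv₂ (pderiv₂ (pderiv₂ (pderiv₂ M))) s x) = C) (s x : ℝ) :
    divForm (coefA (M s)) (coefB l₂ (M s)) (coefC l₁ l₂ (M s)) (pderiv₁ M s)
      (iteratedDeriv 1 (pderiv₁ M s)) (iteratedDeriv 2 (pderiv₁ M s))
      (iteratedDeriv 3 (pderiv₁ M s)) (iteratedDeriv 4 (pderiv₁ M s)) x = 0 := by
  have J1 := hM.jointSmooth₂
  have J2 := J1.jointSmooth₂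
  have J3 := J2.jointSmooth₂
  have J4 := J3.jointSmooth₂
  have c1 := hM.pderiv_comm
  have c2 := J1.pderiv_comm
  have c3 := J2.pderiv_comm
  have c4 := J3.pderiv_comm
  -- The phase derivative is moved inward past one x-derivative at a time.
  rw [c1] at c2
  rw [c2] at c3
  rw [c3] at c4
  have i1 : iteratedDeriv 1 (pderiv₁ M s) = pderiv₂ (pderiv₁ M) s := iteratedDeriv_one
  have i2 : iteratedDeriv 2 (pderiv₁ M s) = pderiv₂ (pderiv₂ (pderiv₁ M)) s := by
    rw [iteratedDeriv_succ, i1]; rfl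
  have i3 : iteratedDeriv 3 (pderiv₁ M s) = pderiv₂ (pderiv₂ (pderiv₂ (pderiv₁ M))) s := by
    rw [iteratedDeriv_succ, i2]; rfl
  have i4 : iteratedDeriv 4 (pderiv₁ M s) =
      pderiv₂ (pderiv₂ (pderiv₂ (pderiv₂ (pderiv₁ M)))) s := by
    rw [iteratedDeriv_succ, i3]; rfl
  have d0 := hM.hasDerivAt₁ s x
  have d1 := J1.hasDerivAt₁ s x
  have d2 := J2.hasDerivAt₁ s x
  have d3 := J3.hasDerivAt₁ s x
  have d4 := J4.hasDerivAt₁ s x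
  rw [c1] at d1
  rw [c2] at d2
  rw [c3] at d3
  rw [c4] at d4
  have z := hasDerivAt_inv_of_pos d0 (hpos s x)
  -- The phase derivative of `eulerExpr`, monomial by monomial. It is zero because the expression is
  -- constant along the family, and it expands to the operator applied to `pderiv₁ M s`.
  have D := ((((((((((z.fun_pow 7).mul d4).sub (((z.fun_pow 8).mul (d1.mul d3)).const_mul 14)).sub
    (((z.fun_pow 8).mul (d2.fun_pow 2)).const_mul (21 / 2))).add
    (((z.fun_pow 9).mul ((d1.fun_pow 2).mul d2)).const_mul 98)).sub
    (((z.fun_pow 10).mul (d1.fun_pow 4)).const_mul (189 / 2))).add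
    (((z.fun_pow 8).mul (d1.fun_pow 2)).const_mul (35 / 4))).sub
    (((z.fun_pow 7).mul d2).const_mul (5 / 2))).sub
    ((z.fun_pow 6).const_mul (5 / 16))).add
    ((((((z.fun_pow 6).mul (d1.fun_pow 2)).const_mul 5).sub
      (((z.fun_pow 5).mul d2).const_mul 2)).sub
      ((z.fun_pow 4).const_mul (3 / 4))).const_mul l₂)).sub ((z.fun_pow 2).const_mul l₁)
  have D0 : HasDerivAt (fun r => eulerExpr l₁ l₂ (M r x)⁻¹ (pderiv₂ M r x)
      (pderiv₂ (pderiv₂ M) r x) (pderiv₂ (pderiv₂ (pderiv₂ M)) r x)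
      (pderiv₂ (pderiv₂ (pderiv₂ (pderiv₂ M))) r x)) 0 s := by
    simp only [hE]
    exact hasDerivAt_const s C
  have key := D.unique D0
  have x0 := hM.hasDerivAt₂ s
  have x1 := J1.hasDerivAt₂ s
  have x2 := J2.hasDerivAt₂ s
  have x3 := J3.hasDerivAt₂ s
  rw [i1, i2, i3, i4, divForm, deriv_deriv_coefA x0 x1 (hpos s), deriv_coefA x0 (hpos s),
    deriv_coefB x0 x1 x2 (hpos s), coefB_eq x0 x1, coefC, qPot_eq x0 x1 x2 x3 (hpos s), coefA,
    zpow_neg_eq 7, zpow_neg_eq 3, zpow_neg_eq 5]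
  simp only [Pi.mul_apply] at key
  norm_num at key
  linear_combination key

/-! ### Bilinear identities -/

/-- The `n`-th derivative in `y` of the tau-function `1 + a X + b Y + A a b X Y`, where `X' = k₁ X`
and `Y' = k₂ Y`, for `n ≥ 1`. -/
def tauD (k₁ k₂ A a b : ℝ) (n : ℕ) (X Y : ℝ) : ℝ :=
  k₁ ^ n * (a * X) + k₂ ^ n * (b * Y) + (k₁ + k₂) ^ n * (A * (a * b) * (X * Y))

/-- The tau-function `1 + a X + b Y + A a b X Y`. -/
def tau (A a b X Y : ℝ) : ℝ := 1 + a * X + b * Y + A * (a * b) * (X * Y)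

/-- In Hirota notation this is (κ D² + D) g·f = 0. Once p, q, A are replaced by their values it is
an identity of polynomials in X, Y. Divided by κ f g, with v = (log(g/f))', it reads (log(fg))'' =
-(v² + v/κ). -/
theorem bilinear_two {κ k₁ k₂ A p q : ℝ} (hp : p * (1 + κ * k₁) = 1 - κ * k₁)
    (hq : q * (1 + κ * k₂) = 1 - κ * k₂) (hA : A * (k₁ + k₂) ^ 2 = (k₁ - k₂) ^ 2)
    (h1 : 1 + κ * k₁ ≠ 0) (h2 : 1 + κ * k₂ ≠ 0) (h3 : k₁ + k₂ ≠ 0) (X Y : ℝ) :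
    κ * (tauD k₁ k₂ A p q 2 X Y * tau A 1 1 X Y - 2 * tauD k₁ k₂ A p q 1 X Y * tauD k₁ k₂ A 1 1 1 X Y
      + tau A p q X Y * tauD k₁ k₂ A 1 1 2 X Y) + (tauD k₁ k₂ A p q 1 X Y * tau A 1 1 X Y
      - tau A p q X Y * tauD k₁ k₂ A 1 1 1 X Y) = 0 := by
  rw [← eq_div_iff h1] at hp
  rw [← eq_div_iff h2] at hq
  rw [← eq_div_iff (pow_ne_zero 2 h3)] at hA
  subst hp hq hA
  simp only [tau, tauD]
  field_simp
  ring

/-- The bilinear form of the stationary equation: (2κ² D⁵ + 5κ D⁴ + (5 - 2κ²(k₁² + k₂²)) D³ +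
2κ²k₁²k₂² D) g·f = 0. -/
theorem bilinear_five {κ k₁ k₂ A p q : ℝ} (hp : p * (1 + κ * k₁) = 1 - κ * k₁)
    (hq : q * (1 + κ * k₂) = 1 - κ * k₂) (hA : A * (k₁ + k₂) ^ 2 = (k₁ - k₂) ^ 2)
    (h1 : 1 + κ * k₁ ≠ 0) (h2 : 1 + κ * k₂ ≠ 0) (h3 : k₁ + k₂ ≠ 0) (X Y : ℝ) :
    let f := tau A 1 1 X Y
    let g := tau A p q X Y
    let F := fun n => tauD k₁ k₂ A 1 1 n X Y
    let G := fun n => tauD k₁ k₂ A p q n X Y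
    2 * κ ^ 2 * (G 5 * f - 5 * G 4 * F 1 + 10 * G 3 * F 2 - 10 * G 2 * F 3 + 5 * G 1 * F 4 - g * F 5)
      + 5 * κ * (G 4 * f - 4 * G 3 * F 1 + 6 * G 2 * F 2 - 4 * G 1 * F 3 + g * F 4)
      + (5 - 2 * κ ^ 2 * (k₁ ^ 2 + k₂ ^ 2)) * (G 3 * f - 3 * G 2 * F 1 + 3 * G 1 * F 2 - g * F 3)
      + 2 * κ ^ 2 * (k₁ ^ 2 * k₂ ^ 2) * (G 1 * f - g * F 1) = 0 := by
  rw [← eq_div_iff h1] at hp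
  rw [← eq_div_iff h2] at hq
  rw [← eq_div_iff (pow_ne_zero 2 h3)] at hA
  subst hp hq hA
  simp only [tau, tauD]
  field_simp
  ring

/-! ### Positivity of the Jacobian of the reciprocal transformation -/

/-- The quantities u = a - 1/2, v = b - a, w = 1 - b are positive with u + v + w = 1/2. This
relation turns the expression into a homogeneous quartic in u, v, w whose nonzero coefficients are
all positive. In the application a and b are cosines of angles below π/3. -/
theorem interaction_quartic_pos {a b : ℝ} (ha : 1 / 2 < a) (hab : a < b) (hb : b < 1) :
    0 < 2 * (b - a) * (1 + a * b) - 4 * (b - a) * (a + b) ^ 2 + (a + b) ^ 2 * (4 * (a * b) - 2)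
      + 4 * (a * b) * (a + b) := by
  obtain ⟨u, hu⟩ : ∃ u, u = a - 1 / 2 := ⟨_, rfl⟩
  obtain ⟨v, hv⟩ : ∃ v, v = b - a := ⟨_, rfl⟩
  obtain ⟨w, hw⟩ : ∃ w, w = 1 - b := ⟨_, rfl⟩
  have u0 : 0 < u := by linarith
  have v0 : 0 < v := by linarith
  have w0 : 0 < w := by linarith
  have e : 2 * (b - a) * (1 + a * b) - 4 * (b - a) * (a + b) ^ 2 + (a + b) ^ 2 * (4 * (a * b) - 2)
      + 4 * (a * b) * (a + b) = 12 * v * w ^ 3 + 28 * v ^ 2 * w ^ 2 + 16 * v ^ 3 * w + 48 * u * w ^ 3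
      + 236 * u * v * w ^ 2 + 332 * u * v ^ 2 * w + 144 * u * v ^ 3 + 256 * u ^ 2 * w ^ 2
      + 752 * u ^ 2 * v * w + 528 * u ^ 2 * v ^ 2 + 448 * u ^ 3 * w + 640 * u ^ 3 * v
      + 256 * u ^ 4 := by
    subst hu hv hw
    ring
  rw [e]
  positivity

/-- The coefficient of `X` in the Jacobian, in the variable `θ = tan (φ / 2)`, `s = sin φ`. -/
theorem jacobian_linear_coeff {θ : ℝ} (h0 : 0 < θ) (h1 : θ < 1) :
    ((1 - θ) / (1 + θ)) ^ 2 * (1 + 2 * (2 * θ / (1 + θ ^ 2))) + (1 - 2 * (2 * θ / (1 + θ ^ 2))) =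
      (1 - θ) / (1 + θ) * (4 * (1 - 3 * θ ^ 2) / ((1 + θ ^ 2) * (1 - θ ^ 2)) - 2) := by
  have : 1 - θ ^ 2 ≠ 0 := by nlinarith
  have : 1 + θ ≠ 0 := by linarith
  have : 1 + θ ^ 2 ≠ 0 := by positivity
  have e : 1 - θ ^ 2 = (1 - θ) * (1 + θ) := by ring
  have : 1 - θ ≠ 0 := by linarith
  rw [e]
  field_simp
  ring

/-- With θ = tan(φ/2) and η = tan(χ/2), the letters s, r are sines, a, b cosines, and p, q, R² are
the soliton factors. The identity isolates the part of the XY coefficient not accounted for by the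
squares in `jacobian_eq_sum_of_squares`; its sign is that of the quartic in
`interaction_quartic_pos`. -/
theorem jacobian_mixed_coeff {θ η : ℝ} (h0 : 0 < η) (h1 : η < θ) (h2 : θ < 1) :
    let s := 2 * θ / (1 + θ ^ 2)
    let r := 2 * η / (1 + η ^ 2)
    let a := (1 - θ ^ 2) / (1 + θ ^ 2)
    let b := (1 - η ^ 2) / (1 + η ^ 2)
    let p := ((1 - θ) / (1 + θ)) ^ 2
    let q := ((1 - η) / (1 + η)) ^ 2
    let R := (θ - η) * (1 - θ * η) / ((θ + η) * (1 + θ * η))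
    R ^ 2 * (p * q * (1 + 2 * (s + r)) + (1 - 2 * (s + r))) + p * (1 + 2 * (s - r))
        + q * (1 - 2 * (s - r)) =
      (1 - θ) / (1 + θ) * ((1 - η) / (1 + η)) * (2 * (b - a) * (2 * (b - a) * (1 + a * b)
        - 4 * (b - a) * (a + b) ^ 2 + (a + b) ^ 2 * (4 * (a * b) - 2) + 4 * (a * b) * (a + b))
        / ((s + r) ^ 2 * (a * b)) + 2 + 2 * R ^ 2
        - 2 * R * (4 * (1 - 3 * θ ^ 2) / ((1 + θ ^ 2) * (1 - θ ^ 2))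
          + 4 * (1 - 3 * η ^ 2) / ((1 + η ^ 2) * (1 - η ^ 2)))) := by
  intro s r a b p q R
  have t0 : 0 < θ := h0.trans h1
  have : 1 - θ ≠ 0 := by linarith
  have : 1 + θ ≠ 0 := by linarith
  have : 1 + θ ^ 2 ≠ 0 := by positivity
  have : 1 - η ≠ 0 := by linarith
  have : 1 + η ≠ 0 := by linarith
  have : 1 + η ^ 2 ≠ 0 := by positivity
  have : θ + η ≠ 0 := by linarith
  have : 1 + θ * η ≠ 0 := by positivity
  have e1 : 1 - θ ^ 2 = (1 - θ) * (1 + θ) := by ring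
  have e2 : 1 - η ^ 2 = (1 - η) * (1 + η) := by ring
  have e3 : s + r = 2 * (θ + η) * (1 + θ * η) / ((1 + θ ^ 2) * (1 + η ^ 2)) := by
    simp only [s, r]; field_simp; ring
  have e4 : s - r = 2 * (θ - η) * (1 - θ * η) / ((1 + θ ^ 2) * (1 + η ^ 2)) := by
    simp only [s, r]; field_simp; ring
  have e5 : b - a = 2 * (θ - η) * (θ + η) / ((1 + θ ^ 2) * (1 + η ^ 2)) := by
    simp only [a, b]; field_simp; ring
  have e6 : a + b = 2 * (1 - θ * η) * (1 + θ * η) / ((1 + θ ^ 2) * (1 + η ^ 2)) := by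
    simp only [a, b]; field_simp; ring
  have e7 : a * b = (1 - θ) * (1 + θ) * ((1 - η) * (1 + η)) / ((1 + θ ^ 2) * (1 + η ^ 2)) := by
    simp only [a, b]; rw [e1, e2]; field_simp
  rw [e3, e4, e5, e6, e7, e1, e2]
  simp only [p, q, R]
  field_simp
  ring

/-- Every `s = sin φ` with `0 < φ < π / 3` is `2 θ / (1 + θ²)` with `3 θ² < 1`. -/
theorem exists_tan_half {s : ℝ} (h0 : 0 < s) (h1 : 4 * s ^ 2 < 3) :
    ∃ θ, 0 < θ ∧ 3 * θ ^ 2 < 1 ∧ s = 2 * θ / (1 + θ ^ 2) := by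
  set c := √(1 - s ^ 2) with hc
  have c2 : c ^ 2 = 1 - s ^ 2 := Real.sq_sqrt (by linarith)
  have c0 : 0 ≤ c := Real.sqrt_nonneg _
  have c1 : 1 / 2 < c := by
    by_contra hh
    nlinarith
  have e : 1 + (s / (1 + c)) ^ 2 = 2 / (1 + c) := by
    have : (1 + c) ≠ 0 := by linarith
    field_simp
    linear_combination c2
  refine ⟨s / (1 + c), by positivity, ?_, ?_⟩
  · rw [div_pow, mul_div_assoc', div_lt_one (by positivity)]
    nlinarith
  · rw [e]
    field_simp

/-- After clearing denominators the hypothesis is (θ - η)(1 - θη) > 0, and the second factor is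
positive. -/
theorem lt_of_double_angle_lt {θ η : ℝ} (h0 : 0 < θ) (h1 : θ < 1) (h2 : 0 < η) (h3 : η < 1)
    (h : 2 * η / (1 + η ^ 2) < 2 * θ / (1 + θ ^ 2)) : η < θ := by
  rw [div_lt_div_iff₀ (by positivity) (by positivity)] at h
  by_contra hc
  have : 0 < 1 - θ * η := by nlinarith
  nlinarith

/-- Comparison of coefficients. `h₁` matches X and XY², `h₂` matches Y and X²Y, and `h` matches XY;
the remaining ones agree because w, v, R are square roots of p, q, A. -/
theorem jacobian_eq_sum_of_squares {s r A p q w v R T β₁ β₂ : ℝ} (hp : p = w ^ 2) (hq : q = v ^ 2)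
    (hA : A = R ^ 2) (h₁ : p * (1 + 2 * s) + (1 - 2 * s) = w * (β₁ - 2))
    (h₂ : q * (1 + 2 * r) + (1 - 2 * r) = v * (β₂ - 2))
    (h : A * (p * q * (1 + 2 * (s + r)) + (1 - 2 * (s + r))) + p * (1 + 2 * (s - r))
      + q * (1 - 2 * (s - r)) = w * v * (T + 2 + 2 * A - 2 * R * (β₁ + β₂))) (X Y : ℝ) :
    tau A 1 1 X Y * tau A p q X Y + 2 * (tauD s r A p q 1 X Y * tau A 1 1 X Y
      - tau A p q X Y * tauD s r A 1 1 1 X Y) = (1 - w * X - v * Y + A * (w * X) * (v * Y)) ^ 2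
      + β₁ * (w * X) * (1 - R * (v * Y)) ^ 2 + β₂ * (v * Y) * (1 - R * (w * X)) ^ 2
      + T * (w * X) * (v * Y) := by
  subst hp hq hA
  simp only [tau, tauD]
  linear_combination (X + R ^ 2 * v ^ 2 * X * Y ^ 2) * h₁ + (Y + R ^ 2 * w ^ 2 * X ^ 2 * Y) * h₂
    + X * Y * h

/-- For s = sin φ, (1 - s)/(1 + s) = tan²(π/4 - φ/2), so p is the square of (1 - θ)/(1 + θ). The
condition 3θ² < 1 means φ < π/3; it gives cos φ > 1/2 and the positivity of the coefficient β in the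
sum of squares. -/
theorem tan_half_facts {s p θ : ℝ} (t0 : 0 < θ) (t1 : 3 * θ ^ 2 < 1) (es : s = 2 * θ / (1 + θ ^ 2))
    (hp : p * (1 + s) = 1 - s) : θ < 1 ∧ p = ((1 - θ) / (1 + θ)) ^ 2 ∧ 0 < (1 - θ) / (1 + θ) ∧
      0 < 4 * (1 - 3 * θ ^ 2) / ((1 + θ ^ 2) * (1 - θ ^ 2)) ∧
      1 / 2 < (1 - θ ^ 2) / (1 + θ ^ 2) ∧ (1 - θ ^ 2) / (1 + θ ^ 2) < 1 := by
  have t2 : θ < 1 := by nlinarith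
  have sq : θ ^ 2 < 1 := by linarith
  have sq0 : 0 < θ ^ 2 := by positivity
  refine ⟨t2, ?_, div_pos (by linarith) (by linarith), div_pos (by linarith)
    (mul_pos (by positivity) (by linarith)), ?_, ?_⟩
  · have h1 : 1 + s ≠ 0 := by
      have : 0 < s := es ▸ by positivity
      linarith
    have e : 1 + θ ^ 2 + 2 * θ = (1 + θ) ^ 2 := by ring
    rw [← eq_div_iff h1] at hp
    rw [hp, es]
    field_simp
    rw [e]
    field_simp
    ring
  · rw [div_lt_div_iff₀ (by norm_num) (by positivity)]; linarith
  · rw [div_lt_one (by positivity)]; linarith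

theorem interaction_tan_half {s r A θ η : ℝ} (t0 : 0 < θ) (n0 : 0 < η)
    (es : s = 2 * θ / (1 + θ ^ 2)) (er : r = 2 * η / (1 + η ^ 2))
    (hA : A * (s + r) ^ 2 = (s - r) ^ 2) :
    A = ((θ - η) * (1 - θ * η) / ((θ + η) * (1 + θ * η))) ^ 2 := by
  have h1 : s + r ≠ 0 := by
    have : 0 < s := es ▸ by positivity
    have : 0 < r := er ▸ by positivity
    linarith
  rw [← eq_div_iff (pow_ne_zero 2 h1), ← div_pow] at hA
  have e3 : s + r = 2 * (θ + η) * (1 + θ * η) / ((1 + θ ^ 2) * (1 + η ^ 2)) := by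
    rw [es, er]; field_simp; ring
  have e4 : s - r = 2 * (θ - η) * (1 - θ * η) / ((1 + θ ^ 2) * (1 + η ^ 2)) := by
    rw [es, er]; field_simp; ring
  rw [hA, e3, e4]
  congr 1
  field_simp

/-- The half-angle substitution makes p, q and A squares. In the resulting sum every term is
nonnegative, and the T term is strictly positive because r < s puts the cosines in the order
required by `interaction_quartic_pos`. -/
theorem jacobian_pos_of_lt {s r A p q X Y : ℝ} (hr : 0 < r) (hrs : r < s) (hs : 4 * s ^ 2 < 3)
    (hp : p * (1 + s) = 1 - s) (hq : q * (1 + r) = 1 - r) (hA : A * (s + r) ^ 2 = (s - r) ^ 2)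
    (hX : 0 < X) (hY : 0 < Y) :
    0 < tau A 1 1 X Y * tau A p q X Y + 2 * (tauD s r A p q 1 X Y * tau A 1 1 X Y
      - tau A p q X Y * tauD s r A 1 1 1 X Y) := by
  obtain ⟨θ, t0, t1, es⟩ := exists_tan_half (hr.trans hrs) hs
  obtain ⟨η, n0, n1, er⟩ := exists_tan_half hr (by nlinarith)
  obtain ⟨t2, ep, w0, β₁0, a1, -⟩ := tan_half_facts t0 t1 es hp
  obtain ⟨n2, eq, v0, β₂0, b0, b1⟩ := tan_half_facts n0 n1 er hq
  have nt : η < θ := lt_of_double_angle_lt t0 t2 n0 n2 (by rw [← es, ← er]; exact hrs)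
  have eA := interaction_tan_half t0 n0 es er hA
  have L1 := jacobian_linear_coeff t0 t2
  have L2 := jacobian_linear_coeff n0 n2
  have Q := jacobian_mixed_coeff n0 nt t2
  simp only at Q
  have ab : (1 - θ ^ 2) / (1 + θ ^ 2) < (1 - η ^ 2) / (1 + η ^ 2) := by
    have : η ^ 2 < θ ^ 2 := by gcongr
    rw [div_lt_div_iff₀ (by positivity) (by positivity)]; nlinarith
  have V := interaction_quartic_pos a1 ab b1
  rw [← ep, ← eq, ← eA, ← es, ← er] at Q
  rw [← ep, ← es] at L1
  rw [← eq, ← er] at L2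
  rw [jacobian_eq_sum_of_squares ep eq eA L1 L2 Q]
  have sr : 0 < s + r := by linarith
  have T0 := div_pos (mul_pos (mul_pos two_pos (sub_pos.2 ab)) V) (mul_pos (pow_pos sr 2)
    (mul_pos ((by norm_num : (0 : ℝ) < 1 / 2).trans a1) ((by norm_num : (0 : ℝ) < 1 / 2).trans b0)))
  exact add_pos_of_nonneg_of_pos (add_nonneg (add_nonneg (sq_nonneg _)
    (mul_nonneg (mul_pos β₁0 (mul_pos w0 hX)).le (sq_nonneg _)))
    (mul_nonneg (mul_pos β₂0 (mul_pos v0 hY)).le (sq_nonneg _)))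
    (mul_pos (mul_pos T0 (mul_pos w0 hX)) (mul_pos v0 hY))

/-! ### The tau-functions along the line -/

/-- Parameters of a two-soliton: wave numbers `k₁, k₂`, interaction coefficient `A` and factors
`p, q` (the numbers `e^{-ψ}`). -/
structure SolitonData (κ k₁ k₂ A p q : ℝ) : Prop where
  κ_pos : 0 < κ
  k₁_pos : 0 < k₁
  k₂_pos : 0 < k₂
  ne : k₁ ≠ k₂
  lt₁ : 4 * (κ * k₁) ^ 2 < 3
  lt₂ : 4 * (κ * k₂) ^ 2 < 3
  hp : p * (1 + κ * k₁) = 1 - κ * k₁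
  hq : q * (1 + κ * k₂) = 1 - κ * k₂
  hA : A * (k₁ + k₂) ^ 2 = (k₁ - k₂) ^ 2

theorem tau_swap (A a b X Y : ℝ) : tau A a b X Y = tau A b a Y X := by
  simp only [tau]; ring

theorem tauD_swap (k₁ k₂ A a b : ℝ) (n : ℕ) (X Y : ℝ) :
    tauD k₁ k₂ A a b n X Y = tauD k₂ k₁ A b a n Y X := by
  simp only [tauD]; rw [add_comm k₂ k₁]; ring

theorem tau_pos {A a b X Y : ℝ} (hA : 0 < A) (ha : 0 < a) (hb : 0 < b) (hX : 0 < X) (hY : 0 < Y) :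
    0 < tau A a b X Y := by
  simp only [tau]; positivity

namespace SolitonData

variable {κ k₁ k₂ A p q : ℝ}

theorem symm (S : SolitonData κ k₁ k₂ A p q) : SolitonData κ k₂ k₁ A q p where
  κ_pos := S.κ_pos
  k₁_pos := S.k₂_pos
  k₂_pos := S.k₁_pos
  ne := S.ne.symm
  lt₁ := S.lt₂
  lt₂ := S.lt₁
  hp := S.hq
  hq := S.hp
  hA := by rw [add_comm, S.hA]; ring

theorem A_pos (S : SolitonData κ k₁ k₂ A p q) : 0 < A := by
  have h1 : 0 < (k₁ + k₂) ^ 2 := pow_pos (add_pos S.k₁_pos S.k₂_pos) 2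
  have h2 : 0 < (k₁ - k₂) ^ 2 := by
    have := sub_ne_zero.2 S.ne
    positivity
  have := S.hA
  by_contra hc
  nlinarith [mul_nonneg (neg_nonneg.2 (not_lt.1 hc)) h1.le]

theorem κk_pos (S : SolitonData κ k₁ k₂ A p q) : 0 < κ * k₁ := mul_pos S.κ_pos S.k₁_pos

theorem κk_lt_one (S : SolitonData κ k₁ k₂ A p q) : κ * k₁ < 1 := by
  have := S.lt₁
  nlinarith

theorem p_pos (S : SolitonData κ k₁ k₂ A p q) : 0 < p := by
  have h1 := S.κk_pos
  have h2 := S.κk_lt_one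
  have := S.hp
  by_contra hc
  nlinarith [not_lt.1 hc]

theorem p_lt_one (S : SolitonData κ k₁ k₂ A p q) : p < 1 := by
  have h1 := S.κk_pos
  have := S.hp
  by_contra hc
  nlinarith [not_lt.1 hc]

theorem q_pos (S : SolitonData κ k₁ k₂ A p q) : 0 < q := S.symm.p_pos

theorem jacobian_numerator_pos (S : SolitonData κ k₁ k₂ A p q) {X Y : ℝ} (hX : 0 < X) (hY : 0 < Y) :
    0 < tau A 1 1 X Y * tau A p q X Y + 2 * (κ * (tauD k₁ k₂ A p q 1 X Y * tau A 1 1 X Y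
      - tau A p q X Y * tauD k₁ k₂ A 1 1 1 X Y)) := by
  have sc : ∀ a b : ℝ, tauD (κ * k₁) (κ * k₂) A a b 1 X Y = κ * tauD k₁ k₂ A a b 1 X Y :=
    fun a b => by simp only [tauD]; ring
  have hA : A * (κ * k₁ + κ * k₂) ^ 2 = (κ * k₁ - κ * k₂) ^ 2 := by
    linear_combination κ ^ 2 * S.hA
  -- The positivity lemma wants the larger wave number first; otherwise the two solitons are
  -- exchanged.
  rcases lt_or_gt_of_ne S.ne with h | h
  · have := jacobian_pos_of_lt (A := A) S.κk_pos (mul_lt_mul_of_pos_left h S.κ_pos) S.lt₂ S.hq S.hp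
      (by linear_combination hA) hY hX
    rw [tauD_swap, tauD_swap _ _ A 1 1, tau_swap, tau_swap A q p, sc, sc] at this
    linarith
  · have := jacobian_pos_of_lt S.symm.κk_pos (mul_lt_mul_of_pos_left h S.κ_pos) S.lt₁ S.hp S.hq
      hA hX hY
    rw [sc, sc] at this
    linarith

end SolitonData

/-- The exponential `e^{k (y + η)}`. -/
def phase (k η y : ℝ) : ℝ := Real.exp (k * (y + η))

theorem phase_pos (k η y : ℝ) : 0 < phase k η y := Real.exp_pos _

theorem hasDerivAt_phase (k η y : ℝ) : HasDerivAt (phase k η) (k * phase k η y) y := by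
  exact (((hasDerivAt_id y).add_const η).const_mul k).exp.congr_deriv (by simp [phase, mul_comm])

theorem hasDerivAt_tau {X Y : ℝ → ℝ} {k₁ k₂ y : ℝ} (hX : HasDerivAt X (k₁ * X y) y)
    (hY : HasDerivAt Y (k₂ * Y y) y) (A a b : ℝ) :
    HasDerivAt (fun y => tau A a b (X y) (Y y)) (tauD k₁ k₂ A a b 1 (X y) (Y y)) y := by
  refine ((((hX.const_mul a).const_add 1).add (hY.const_mul b)).add
    ((hX.mul hY).const_mul (A * (a * b)))).congr_deriv ?_
  simp only [tauD]
  ring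

theorem hasDerivAt_tauD {X Y : ℝ → ℝ} {k₁ k₂ y : ℝ} (hX : HasDerivAt X (k₁ * X y) y)
    (hY : HasDerivAt Y (k₂ * Y y) y) (A a b : ℝ) (n : ℕ) :
    HasDerivAt (fun y => tauD k₁ k₂ A a b n (X y) (Y y))
      (tauD k₁ k₂ A a b (n + 1) (X y) (Y y)) y := by
  refine ((((hX.const_mul a).const_mul (k₁ ^ n)).add ((hY.const_mul b).const_mul (k₂ ^ n))).add
    (((hX.mul hY).const_mul (A * (a * b))).const_mul ((k₁ + k₂) ^ n))).congr_deriv ?_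
  simp only [tauD]
  ring

/-- The derivatives of `f` in terms of those of `log f`. -/
theorem deriv_eq_bell {f f₁ f₂ f₃ f₄ f₅ : ℝ → ℝ} (hf : ∀ y, 0 < f y) (hs : ContDiff ℝ ∞ f)
    (h0 : ∀ y, HasDerivAt f (f₁ y) y) (h1 : ∀ y, HasDerivAt f₁ (f₂ y) y)
    (h2 : ∀ y, HasDerivAt f₂ (f₃ y) y) (h3 : ∀ y, HasDerivAt f₃ (f₄ y) y)
    (h4 : ∀ y, HasDerivAt f₄ (f₅ y) y) :
    let L := fun n => iteratedDeriv n fun y => Real.log (f y)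
    (∀ n y, HasDerivAt (L n) (L (n + 1) y) y) ∧
    (∀ y, f₁ y = f y * L 1 y) ∧ (∀ y, f₂ y = f y * (L 2 y + L 1 y ^ 2)) ∧
    (∀ y, f₃ y = f y * (L 3 y + 3 * L 1 y * L 2 y + L 1 y ^ 3)) ∧
    (∀ y, f₄ y = f y * (L 4 y + 4 * L 1 y * L 3 y + 3 * L 2 y ^ 2 + 6 * L 1 y ^ 2 * L 2 y
      + L 1 y ^ 4)) ∧
    (∀ y, f₅ y = f y * (L 5 y + 5 * L 1 y * L 4 y + 10 * L 2 y * L 3 y + 10 * L 1 y ^ 2 * L 3 y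
      + 15 * L 1 y * L 2 y ^ 2 + 10 * L 1 y ^ 3 * L 2 y + L 1 y ^ 5)) := by
  intro L
  have cL : ContDiff ℝ ∞ fun y => Real.log (f y) := hs.log fun y => (hf y).ne'
  have D : ∀ n y, HasDerivAt (L n) (L (n + 1) y) y := fun n y =>
    hasDerivAt_iteratedDeriv (N := n + 1) (cL.of_le (by exact_mod_cast le_top)) (by omega) y
  have d1 := D 1
  have d2 := D 2
  have d3 := D 3
  have d4 := D 4
  have e1 : ∀ y, f₁ y = f y * L 1 y := fun y => by
    have : L 1 y = f₁ y / f y := by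
      simp only [L, iteratedDeriv_one]
      exact ((h0 y).log (hf y).ne').deriv
    rw [this]
    field_simp [(hf y).ne']
  -- The recursion of the complete Bell polynomials: if u = f B then u' = f (L₁ B + B').
  have step : ∀ {u v : ℝ → ℝ} {B B' : ℝ → ℝ}, (∀ y, HasDerivAt u (v y) y) →
      (∀ y, u y = f y * B y) → (∀ y, HasDerivAt B (B' y) y) →
      ∀ y, v y = f y * (L 1 y * B y + B' y) := by
    intro u v B B' hu he hB y
    have : u = fun y => f y * B y := funext he
    subst this
    rw [(hu y).unique ((h0 y).mul (hB y)), e1]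
    ring
  have e2 : ∀ y, f₂ y = f y * (L 2 y + L 1 y ^ 2) := fun y => by
    rw [step h1 e1 d1 y]; ring
  have e3 : ∀ y, f₃ y = f y * (L 3 y + 3 * L 1 y * L 2 y + L 1 y ^ 3) := fun y => by
    rw [step h2 e2 (fun y => (d2 y).add ((d1 y).fun_pow 2)) y]
    push_cast
    ring
  have e4 : ∀ y, f₄ y = f y * (L 4 y + 4 * L 1 y * L 3 y + 3 * L 2 y ^ 2 + 6 * L 1 y ^ 2 * L 2 y
      + L 1 y ^ 4) := fun y => by
    rw [step h3 e3 (fun y => ((d3 y).add (((d1 y).const_mul 3).mul (d2 y))).add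
      ((d1 y).fun_pow 3)) y]
    push_cast
    ring
  refine ⟨D, e1, e2, e3, e4, fun y => ?_⟩
  rw [step h4 e4 (fun y => ((((d4 y).add (((d1 y).const_mul 4).mul (d3 y))).add
    (((d2 y).fun_pow 2).const_mul 3)).add ((((d1 y).fun_pow 2).const_mul 6).mul (d2 y))).add
    ((d1 y).fun_pow 4)) y]
  push_cast
  ring

/-! ### The stationary equation -/

/-- The tau-function as a function of `y`. -/
def tauLine (k₁ k₂ A a b η₁ η₂ y : ℝ) : ℝ := tau A a b (phase k₁ η₁ y) (phase k₂ η₂ y)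

/-- The derivatives of the tau-function as functions of `y`. -/
def tauLineD (k₁ k₂ A a b η₁ η₂ : ℝ) (n : ℕ) (y : ℝ) : ℝ :=
  tauD k₁ k₂ A a b n (phase k₁ η₁ y) (phase k₂ η₂ y)

/-- The derivative `x_y` of the reciprocal transformation. -/
def slope (κ k₁ k₂ A p q η₁ η₂ y : ℝ) : ℝ :=
  κ⁻¹ + 2 * (tauLineD k₁ k₂ A p q η₁ η₂ 1 y / tauLine k₁ k₂ A p q η₁ η₂ y
    - tauLineD k₁ k₂ A 1 1 η₁ η₂ 1 y / tauLine k₁ k₂ A 1 1 η₁ η₂ y)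

theorem hasDerivAt_tauLine (k₁ k₂ A a b η₁ η₂ y : ℝ) :
    HasDerivAt (tauLine k₁ k₂ A a b η₁ η₂) (tauLineD k₁ k₂ A a b η₁ η₂ 1 y) y :=
  hasDerivAt_tau (hasDerivAt_phase k₁ η₁ y) (hasDerivAt_phase k₂ η₂ y) A a b

theorem hasDerivAt_tauLineD (k₁ k₂ A a b η₁ η₂ : ℝ) (n : ℕ) (y : ℝ) :
    HasDerivAt (tauLineD k₁ k₂ A a b η₁ η₂ n) (tauLineD k₁ k₂ A a b η₁ η₂ (n + 1) y) y :=
  hasDerivAt_tauD (hasDerivAt_phase k₁ η₁ y) (hasDerivAt_phase k₂ η₂ y) A a b n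

theorem contDiff_tauLine (k₁ k₂ A a b η₁ η₂ : ℝ) :
    ContDiff ℝ ∞ (tauLine k₁ k₂ A a b η₁ η₂) := by
  unfold tauLine tau phase
  fun_prop

/-- The derivatives of the logarithm of the tau-function. -/
def logTauD (k₁ k₂ A a b η₁ η₂ : ℝ) (n : ℕ) : ℝ → ℝ :=
  iteratedDeriv n fun y => Real.log (tauLine k₁ k₂ A a b η₁ η₂ y)

theorem tauLine_pos {A a b : ℝ} (hA : 0 < A) (ha : 0 < a) (hb : 0 < b) (k₁ k₂ η₁ η₂ y : ℝ) :
    0 < tauLine k₁ k₂ A a b η₁ η₂ y :=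
  tau_pos hA ha hb (phase_pos ..) (phase_pos ..)

theorem tauLine_bell {A a b : ℝ} (hA : 0 < A) (ha : 0 < a) (hb : 0 < b) (k₁ k₂ η₁ η₂ : ℝ) :
    let L := logTauD k₁ k₂ A a b η₁ η₂
    let f := tauLine k₁ k₂ A a b η₁ η₂
    let fD := tauLineD k₁ k₂ A a b η₁ η₂
    (∀ n y, HasDerivAt (L n) (L (n + 1) y) y) ∧
    (∀ y, fD 1 y = f y * L 1 y) ∧ (∀ y, fD 2 y = f y * (L 2 y + L 1 y ^ 2)) ∧
    (∀ y, fD 3 y = f y * (L 3 y + 3 * L 1 y * L 2 y + L 1 y ^ 3)) ∧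
    (∀ y, fD 4 y = f y * (L 4 y + 4 * L 1 y * L 3 y + 3 * L 2 y ^ 2 + 6 * L 1 y ^ 2 * L 2 y
      + L 1 y ^ 4)) ∧
    (∀ y, fD 5 y = f y * (L 5 y + 5 * L 1 y * L 4 y + 10 * L 2 y * L 3 y + 10 * L 1 y ^ 2 * L 3 y
      + 15 * L 1 y * L 2 y ^ 2 + 10 * L 1 y ^ 3 * L 2 y + L 1 y ^ 5)) :=
  deriv_eq_bell (tauLine_pos hA ha hb k₁ k₂ η₁ η₂) (contDiff_tauLine k₁ k₂ A a b η₁ η₂)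
    (hasDerivAt_tauLine k₁ k₂ A a b η₁ η₂) (hasDerivAt_tauLineD k₁ k₂ A a b η₁ η₂ 1)
    (hasDerivAt_tauLineD k₁ k₂ A a b η₁ η₂ 2) (hasDerivAt_tauLineD k₁ k₂ A a b η₁ η₂ 3)
    (hasDerivAt_tauLineD k₁ k₂ A a b η₁ η₂ 4)

/-- The left-hand side of the stationary equation for the slope. -/
def stationaryExpr (l₁ l₂ s₀ s₁ s₂ s₄ : ℝ) : ℝ :=
  s₄ - 5 / 2 * s₀ ^ 2 * s₂ - 5 / 2 * s₀ * s₁ ^ 2 + 3 / 8 * s₀ ^ 5 - l₂ * (2 * s₂ - s₀ ^ 3)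
    + 2 * l₁ * s₀

/-- The Euler-Lagrange expression in terms of the slope and its derivatives. -/
def slopeExpr (l₁ l₂ s₀ s₁ s₂ s₃ s₄ : ℝ) : ℝ :=
  -s₀ * s₄ + s₁ * s₃ - 1 / 2 * s₂ ^ 2 + 5 / 2 * s₀ ^ 3 * s₂ + 5 / 4 * s₀ ^ 2 * s₁ ^ 2
    - 5 / 16 * s₀ ^ 6 + l₂ * (2 * s₀ * s₂ - s₁ ^ 2 - 3 / 4 * s₀ ^ 4) - l₁ * s₀ ^ 2

/-- The first multiplier, in terms of the wave numbers. -/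
def mult₁ (κ k₁ k₂ : ℝ) : ℝ :=
  15 / 16 * κ⁻¹ ^ 4 - 3 / 4 * κ⁻¹ ^ 2 * (k₁ ^ 2 + k₂ ^ 2) + 1 / 2 * (k₁ ^ 2 * k₂ ^ 2)

/-- The second multiplier, in terms of the wave numbers. -/
def mult₂ (κ k₁ k₂ : ℝ) : ℝ := -(5 * κ⁻¹ ^ 2 - 2 * (k₁ ^ 2 + k₂ ^ 2)) / 4

namespace SolitonData

variable {κ k₁ k₂ A p q : ℝ}

theorem tauLine_pos₁ (S : SolitonData κ k₁ k₂ A p q) (η₁ η₂ y : ℝ) :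
    0 < tauLine k₁ k₂ A 1 1 η₁ η₂ y :=
  tauLine_pos S.A_pos one_pos one_pos ..

theorem tauLine_pos₂ (S : SolitonData κ k₁ k₂ A p q) (η₁ η₂ y : ℝ) :
    0 < tauLine k₁ k₂ A p q η₁ η₂ y :=
  tauLine_pos S.A_pos S.p_pos S.q_pos ..

theorem one_add_ne (S : SolitonData κ k₁ k₂ A p q) : 1 + κ * k₁ ≠ 0 := by
  linarith [S.κk_pos]

theorem add_ne (S : SolitonData κ k₁ k₂ A p q) : k₁ + k₂ ≠ 0 := by
  linarith [S.k₁_pos, S.k₂_pos]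

theorem slope_pos (S : SolitonData κ k₁ k₂ A p q) (η₁ η₂ y : ℝ) :
    0 < slope κ k₁ k₂ A p q η₁ η₂ y := by
  have h := S.jacobian_numerator_pos (phase_pos k₁ η₁ y) (phase_pos k₂ η₂ y)
  have hf := S.tauLine_pos₁ η₁ η₂ y
  have hg := S.tauLine_pos₂ η₁ η₂ y
  have hκ := S.κ_pos
  have e : slope κ k₁ k₂ A p q η₁ η₂ y = (tauLine k₁ k₂ A 1 1 η₁ η₂ y * tauLine k₁ k₂ A p q η₁ η₂ y
      + 2 * (κ * (tauLineD k₁ k₂ A p q η₁ η₂ 1 y * tauLine k₁ k₂ A 1 1 η₁ η₂ y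
      - tauLine k₁ k₂ A p q η₁ η₂ y * tauLineD k₁ k₂ A 1 1 η₁ η₂ 1 y)))
      / (κ * (tauLine k₁ k₂ A 1 1 η₁ η₂ y * tauLine k₁ k₂ A p q η₁ η₂ y)) := by
    rw [slope]
    field_simp
  rw [e]
  exact div_pos h (by positivity)

theorem slope_eq (S : SolitonData κ k₁ k₂ A p q) (η₁ η₂ : ℝ) :
    slope κ k₁ k₂ A p q η₁ η₂ =
      fun y => κ⁻¹ + 2 * (logTauD k₁ k₂ A p q η₁ η₂ 1 y - logTauD k₁ k₂ A 1 1 η₁ η₂ 1 y) := by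
  obtain ⟨-, f1, -⟩ := tauLine_bell S.A_pos one_pos one_pos k₁ k₂ η₁ η₂
  obtain ⟨-, g1, -⟩ := tauLine_bell S.A_pos S.p_pos S.q_pos k₁ k₂ η₁ η₂
  funext y
  rw [slope, f1, g1, mul_div_cancel_left₀ _ (S.tauLine_pos₁ η₁ η₂ y).ne',
    mul_div_cancel_left₀ _ (S.tauLine_pos₂ η₁ η₂ y).ne']

theorem iteratedDeriv_slope (S : SolitonData κ k₁ k₂ A p q) (η₁ η₂ : ℝ) (n : ℕ) :
    iteratedDeriv (n + 1) (slope κ k₁ k₂ A p q η₁ η₂) =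
      fun y => 2 * (logTauD k₁ k₂ A p q η₁ η₂ (n + 2) y - logTauD k₁ k₂ A 1 1 η₁ η₂ (n + 2) y) := by
  obtain ⟨dF, -⟩ := tauLine_bell S.A_pos one_pos one_pos k₁ k₂ η₁ η₂
  obtain ⟨dG, -⟩ := tauLine_bell S.A_pos S.p_pos S.q_pos k₁ k₂ η₁ η₂
  induction n with
  | zero =>
    rw [zero_add, iteratedDeriv_one, S.slope_eq]
    exact funext fun y => ((((dG 1 y).sub (dF 1 y)).const_mul 2).const_add κ⁻¹).deriv
  | succ n ih =>
    rw [iteratedDeriv_succ, ih]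
    exact funext fun y => (((dG (n + 2) y).sub (dF (n + 2) y)).const_mul 2).deriv

/-- Put v = (log(g/f))', so that s = 1/κ + 2v. Dividing `bilinear_five` by 2κ² f g gives an equation
in the odd-order derivatives of log(g/f) and the even-order derivatives of log(fg). The relation
from `bilinear_two` and its derivatives express the latter by v, which leaves an equation for s
alone. The constant is the value on the background s = 1/κ. -/
theorem slope_stationary (S : SolitonData κ k₁ k₂ A p q) (η₁ η₂ y : ℝ) :
    let s := fun n => iteratedDeriv n (slope κ k₁ k₂ A p q η₁ η₂) y
    stationaryExpr (mult₁ κ k₁ k₂) (mult₂ κ k₁ k₂) (s 0) (s 1) (s 2) (s 4) =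
      3 / 8 * κ⁻¹ ^ 5 + mult₂ κ k₁ k₂ * κ⁻¹ ^ 3 + 2 * mult₁ κ k₁ k₂ * κ⁻¹ := by
  have hκ := S.κ_pos.ne'
  obtain ⟨dF, f1, f2, f3, f4, f5⟩ := tauLine_bell S.A_pos one_pos one_pos k₁ k₂ η₁ η₂
  obtain ⟨dG, g1, g2, g3, g4, g5⟩ := tauLine_bell S.A_pos S.p_pos S.q_pos k₁ k₂ η₁ η₂
  generalize hF : logTauD k₁ k₂ A 1 1 η₁ η₂ = F at *
  generalize hG : logTauD k₁ k₂ A p q η₁ η₂ = G at *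
  have fpos := S.tauLine_pos₁ η₁ η₂
  have gpos := S.tauLine_pos₂ η₁ η₂
  have e0 := S.slope_eq η₁ η₂
  have es := S.iteratedDeriv_slope η₁ η₂
  rw [hF, hG] at e0
  simp only [hF, hG] at es
  have two : ∀ y, F 2 y + G 2 y = -((G 1 y - F 1 y) ^ 2 + (G 1 y - F 1 y) * κ⁻¹) := fun y => by
    have h := bilinear_two S.hp S.hq S.hA S.one_add_ne S.symm.one_add_ne S.add_ne (phase k₁ η₁ y)
      (phase k₂ η₂ y)
    simp only [tauLineD, tauLine] at f1 f2 g1 g2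
    rw [f1, f2, g1, g2] at h
    have f0 := (fpos y).ne'
    have g0 := (gpos y).ne'
    rw [tauLine] at f0 g0
    have h' : κ * (F 2 y + G 2 y) = κ * -((G 1 y - F 1 y) ^ 2 + (G 1 y - F 1 y) * κ⁻¹) := by
      have hc : κ * -((G 1 y - F 1 y) ^ 2 + (G 1 y - F 1 y) * κ⁻¹) =
          -(κ * (G 1 y - F 1 y) ^ 2 + (G 1 y - F 1 y)) := by field_simp
      rw [hc]
      refine mul_left_cancel₀ (mul_ne_zero f0 g0) ?_
      linear_combination h
    exact mul_left_cancel₀ hκ h'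
  -- The quadratic relation `two` is differentiated here and once more in `four`.
  have three : ∀ y, F 3 y + G 3 y =
      -(2 * (G 1 y - F 1 y) * (G 2 y - F 2 y) + (G 2 y - F 2 y) * κ⁻¹) := fun y => by
    have h1 := (dF 2 y).add (dG 2 y)
    have h2 := ((((dG 1 y).sub (dF 1 y)).fun_pow 2).add (((dG 1 y).sub (dF 1 y)).mul_const κ⁻¹)).neg
    have e : F 2 + G 2 = _ := funext two
    rw [e] at h1
    rw [h1.unique h2]
    simp
  have four : F 4 y + G 4 y = -(2 * (G 2 y - F 2 y) ^ 2 + 2 * (G 1 y - F 1 y) * (G 3 y - F 3 y)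
      + (G 3 y - F 3 y) * κ⁻¹) := by
    have h1 := (dF 3 y).add (dG 3 y)
    have h2 := (((((dG 1 y).sub (dF 1 y)).const_mul 2).mul ((dG 2 y).sub (dF 2 y))).add
      (((dG 2 y).sub (dF 2 y)).mul_const κ⁻¹)).neg
    have e : F 3 + G 3 = _ := funext three
    rw [e] at h1
    rw [h1.unique h2]
    simp only [Pi.sub_apply]
    ring
  have five : (G 5 y - F 5 y) + 5 * (G 1 y - F 1 y) * (F 4 y + G 4 y)
      + 10 * (F 2 y + G 2 y) * (G 3 y - F 3 y) + 10 * (G 3 y - F 3 y) * (G 1 y - F 1 y) ^ 2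
      + 15 * (G 1 y - F 1 y) * (F 2 y + G 2 y) ^ 2 + 10 * (G 1 y - F 1 y) ^ 3 * (F 2 y + G 2 y)
      + (G 1 y - F 1 y) ^ 5
      + 5 / 2 * κ⁻¹ * ((F 4 y + G 4 y) + 3 * (F 2 y + G 2 y) ^ 2
        + 4 * (G 3 y - F 3 y) * (G 1 y - F 1 y) + 6 * (F 2 y + G 2 y) * (G 1 y - F 1 y) ^ 2
        + (G 1 y - F 1 y) ^ 4)
      + (5 / 2 * κ⁻¹ ^ 2 - (k₁ ^ 2 + k₂ ^ 2)) * ((G 3 y - F 3 y)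
        + 3 * (G 1 y - F 1 y) * (F 2 y + G 2 y) + (G 1 y - F 1 y) ^ 3)
      + k₁ ^ 2 * k₂ ^ 2 * (G 1 y - F 1 y) = 0 := by
    have h := bilinear_five S.hp S.hq S.hA S.one_add_ne S.symm.one_add_ne S.add_ne (phase k₁ η₁ y)
      (phase k₂ η₂ y)
    simp only [tauLineD, tauLine] at f1 f2 f3 f4 f5 g1 g2 g3 g4 g5
    simp only at h
    rw [f1, f2, f3, f4, f5, g1, g2, g3, g4, g5] at h
    have f0 := (fpos y).ne'
    have g0 := (gpos y).ne'
    rw [tauLine] at f0 g0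
    have c0 : 2 * κ ^ 2 * (tau A 1 1 (phase k₁ η₁ y) (phase k₂ η₂ y)
      * tau A p q (phase k₁ η₁ y) (phase k₂ η₂ y)) ≠ 0 := by positivity
    refine mul_left_cancel₀ c0 ?_
    rw [mul_zero, ← h]
    field_simp
    ring
  have s0 : iteratedDeriv 0 (slope κ k₁ k₂ A p q η₁ η₂) y = κ⁻¹ + 2 * (G 1 y - F 1 y) := by
    rw [iteratedDeriv_zero, e0]
  have s1 : iteratedDeriv 1 (slope κ k₁ k₂ A p q η₁ η₂) y = 2 * (G 2 y - F 2 y) := congrFun (es 0) y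
  have s2 : iteratedDeriv 2 (slope κ k₁ k₂ A p q η₁ η₂) y = 2 * (G 3 y - F 3 y) := congrFun (es 1) y
  have s4 : iteratedDeriv 4 (slope κ k₁ k₂ A p q η₁ η₂) y = 2 * (G 5 y - F 5 y) := congrFun (es 3) y
  simp only [s0, s1, s2, s4]
  rw [four, two] at five
  rw [stationaryExpr, mult₁, mult₂]
  linear_combination 2 * five

end SolitonData

/-! ### The first integral of the stationary equation -/

theorem tendsto_phase_atBot {k : ℝ} (hk : 0 < k) (η : ℝ) :
    Tendsto (phase k η) atBot (nhds 0) :=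
  Real.tendsto_exp_atBot.comp
    ((tendsto_id.atBot_add tendsto_const_nhds).const_mul_atBot hk)

theorem tendsto_tauLine_atBot {k₁ k₂ : ℝ} (h₁ : 0 < k₁) (h₂ : 0 < k₂) (A a b η₁ η₂ : ℝ) :
    Tendsto (tauLine k₁ k₂ A a b η₁ η₂) atBot (nhds 1) := by
  have hX := tendsto_phase_atBot h₁ η₁
  have hY := tendsto_phase_atBot h₂ η₂
  have := (((hX.const_mul a).const_add 1).add (hY.const_mul b)).add
    ((hX.mul hY).const_mul (A * (a * b)))
  simp only [mul_zero, add_zero] at this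
  exact this

theorem tendsto_tauLineD_atBot {k₁ k₂ : ℝ} (h₁ : 0 < k₁) (h₂ : 0 < k₂) (A a b η₁ η₂ : ℝ) (n : ℕ) :
    Tendsto (tauLineD k₁ k₂ A a b η₁ η₂ n) atBot (nhds 0) := by
  have hX := tendsto_phase_atBot h₁ η₁
  have hY := tendsto_phase_atBot h₂ η₂
  have := (((hX.const_mul a).const_mul (k₁ ^ n)).add ((hY.const_mul b).const_mul (k₂ ^ n))).add
    (((hX.mul hY).const_mul (A * (a * b))).const_mul ((k₁ + k₂) ^ n))
  simp only [mul_zero, add_zero] at this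
  exact this

/-- The quotients of the derivatives of the tau-function by the tau-function tend to 0; the
logarithmic derivatives follow one order at a time by removing the lower-order Bell terms. -/
theorem tendsto_logTauD_atBot {k₁ k₂ A a b : ℝ} (h₁ : 0 < k₁) (h₂ : 0 < k₂) (hA : 0 < A)
    (ha : 0 < a) (hb : 0 < b) (η₁ η₂ : ℝ) :
    let L := logTauD k₁ k₂ A a b η₁ η₂
    Tendsto (L 1) atBot (nhds 0) ∧ Tendsto (L 2) atBot (nhds 0) ∧ Tendsto (L 3) atBot (nhds 0) ∧
      Tendsto (L 4) atBot (nhds 0) ∧ Tendsto (L 5) atBot (nhds 0) := by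
  intro L
  obtain ⟨-, f1, f2, f3, f4, f5⟩ := tauLine_bell hA ha hb k₁ k₂ η₁ η₂
  have hq : ∀ {R : ℝ → ℝ} (n : ℕ), (∀ y, tauLineD k₁ k₂ A a b η₁ η₂ n y =
      tauLine k₁ k₂ A a b η₁ η₂ y * R y) → Tendsto R atBot (nhds 0) := by
    intro R n h
    have e : R = fun y => tauLineD k₁ k₂ A a b η₁ η₂ n y / tauLine k₁ k₂ A a b η₁ η₂ y :=
      funext fun y => by
        rw [h, mul_div_cancel_left₀ _ (tauLine_pos hA ha hb k₁ k₂ η₁ η₂ y).ne']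
    rw [e]
    have := (tendsto_tauLineD_atBot h₁ h₂ A a b η₁ η₂ n).div
      (tendsto_tauLine_atBot h₁ h₂ A a b η₁ η₂) one_ne_zero
    rwa [zero_div] at this
  have l1 : Tendsto (L 1) atBot (nhds 0) := hq 1 f1
  have l2 : Tendsto (L 2) atBot (nhds 0) := by
    have := (hq 2 f2).sub (l1.pow 2)
    norm_num at this
    refine this.congr fun y => ?_
    ring
  have l3 : Tendsto (L 3) atBot (nhds 0) := by
    have := (hq 3 f3).sub (((l1.const_mul 3).mul l2).add (l1.pow 3))
    norm_num at this
    refine this.congr fun y => ?_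
    ring
  have l4 : Tendsto (L 4) atBot (nhds 0) := by
    have := (hq 4 f4).sub ((((l1.const_mul 4).mul l3).add ((l2.pow 2).const_mul 3)).add
      ((((l1.pow 2).const_mul 6).mul l2).add (l1.pow 4)))
    norm_num at this
    refine this.congr fun y => ?_
    ring
  have l5 : Tendsto (L 5) atBot (nhds 0) := by
    have := (hq 5 f5).sub (((((l1.const_mul 5).mul l4).add ((l2.const_mul 10).mul l3)).add
      (((l1.pow 2).const_mul 10).mul l3)).add ((((l1.const_mul 15).mul (l2.pow 2)).add
      (((l1.pow 3).const_mul 10).mul l2)).add (l1.pow 5)))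
    norm_num at this
    refine this.congr fun y => ?_
    ring
  exact ⟨l1, l2, l3, l4, l5⟩

theorem contDiff_tauLineD (k₁ k₂ A a b η₁ η₂ : ℝ) (n : ℕ) :
    ContDiff ℝ ∞ (tauLineD k₁ k₂ A a b η₁ η₂ n) := by
  unfold tauLineD tauD phase
  fun_prop

namespace SolitonData

variable {κ k₁ k₂ A p q : ℝ}

theorem contDiff_slope (S : SolitonData κ k₁ k₂ A p q) (η₁ η₂ : ℝ) :
    ContDiff ℝ ∞ (slope κ k₁ k₂ A p q η₁ η₂) :=
  contDiff_const.add (contDiff_const.mul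
    (((contDiff_tauLineD ..).div (contDiff_tauLine ..) fun y => (S.tauLine_pos₂ η₁ η₂ y).ne').sub
      ((contDiff_tauLineD ..).div (contDiff_tauLine ..) fun y => (S.tauLine_pos₁ η₁ η₂ y).ne')))

theorem hasDerivAt_iteratedDeriv_slope (S : SolitonData κ k₁ k₂ A p q) (η₁ η₂ : ℝ) (n : ℕ)
    (y : ℝ) : HasDerivAt (iteratedDeriv n (slope κ k₁ k₂ A p q η₁ η₂))
      (iteratedDeriv (n + 1) (slope κ k₁ k₂ A p q η₁ η₂) y) y :=
  hasDerivAt_iteratedDeriv (N := n + 1)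
    ((S.contDiff_slope η₁ η₂).of_le (by exact_mod_cast le_top)) (by omega) y

theorem tendsto_slope_atBot (S : SolitonData κ k₁ k₂ A p q) (η₁ η₂ : ℝ) :
    Tendsto (slope κ k₁ k₂ A p q η₁ η₂) atBot (nhds κ⁻¹) := by
  have hF := (tendsto_logTauD_atBot S.k₁_pos S.k₂_pos S.A_pos one_pos one_pos η₁ η₂).1
  have hG := (tendsto_logTauD_atBot S.k₁_pos S.k₂_pos S.A_pos S.p_pos S.q_pos η₁ η₂).1
  rw [S.slope_eq]
  simpa using ((hG.sub hF).const_mul 2).const_add κ⁻¹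

/-- The value of the Euler-Lagrange expression on the two-soliton slope. -/
theorem slopeExpr_eq (S : SolitonData κ k₁ k₂ A p q) (η₁ η₂ y : ℝ) :
    let s := fun n => iteratedDeriv n (slope κ k₁ k₂ A p q η₁ η₂) y
    slopeExpr (mult₁ κ k₁ k₂) (mult₂ κ k₁ k₂) (s 0) (s 1) (s 2) (s 3) (s 4) =
      slopeExpr (mult₁ κ k₁ k₂) (mult₂ κ k₁ k₂) κ⁻¹ 0 0 0 0 := by
  set l₁ := mult₁ κ k₁ k₂
  set l₂ := mult₂ κ k₁ k₂
  set s := fun n => iteratedDeriv n (slope κ k₁ k₂ A p q η₁ η₂) with hs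
  have d : ∀ n y, HasDerivAt (s n) (s (n + 1) y) y := S.hasDerivAt_iteratedDeriv_slope η₁ η₂
  have dK : ∀ y, s 5 y - 5 / 2 * (s 0 y ^ 2 * s 3 y + 2 * s 0 y * s 1 y * s 2 y)
      - 5 / 2 * (s 1 y ^ 3 + 2 * s 0 y * s 1 y * s 2 y) + 15 / 8 * s 0 y ^ 4 * s 1 y
      - l₂ * (2 * s 3 y - 3 * s 0 y ^ 2 * s 1 y) + 2 * l₁ * s 1 y = 0 := fun y => by
    have h1 := (((((d 4 y).sub ((((d 0 y).fun_pow 2).const_mul (5 / 2)).mul (d 2 y))).sub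
      (((d 0 y).const_mul (5 / 2)).mul ((d 1 y).fun_pow 2))).add
      (((d 0 y).fun_pow 5).const_mul (3 / 8))).sub
      ((((d 2 y).const_mul 2).sub ((d 0 y).fun_pow 3)).const_mul l₂)).add
      ((d 0 y).const_mul (2 * l₁))
    have h2 := h1.unique ((hasDerivAt_const y (3 / 8 * κ⁻¹ ^ 5 + l₂ * κ⁻¹ ^ 3
      + 2 * l₁ * κ⁻¹)).congr_of_eventuallyEq (Eventually.of_forall fun z => ?_))
    · push_cast at h2
      linear_combination h2
    · exact S.slope_stationary η₁ η₂ z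
  have dE : ∀ y, HasDerivAt (fun y => slopeExpr l₁ l₂ (s 0 y) (s 1 y) (s 2 y) (s 3 y) (s 4 y))
      0 y := fun y => by
    refine (((((((((d 0 y).neg.mul (d 4 y)).add ((d 1 y).mul (d 3 y))).sub
      (((d 2 y).fun_pow 2).const_mul (1 / 2))).add
      ((((d 0 y).fun_pow 3).const_mul (5 / 2)).mul (d 2 y))).add
      ((((d 0 y).fun_pow 2).const_mul (5 / 4)).mul ((d 1 y).fun_pow 2))).sub
      (((d 0 y).fun_pow 6).const_mul (5 / 16))).add
      ((((((d 0 y).const_mul 2).mul (d 2 y)).sub ((d 1 y).fun_pow 2)).sub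
        (((d 0 y).fun_pow 4).const_mul (3 / 4))).const_mul l₂)).sub
      (((d 0 y).fun_pow 2).const_mul l₁)).congr_deriv ?_
    push_cast
    simp only [Pi.neg_apply]
    -- The expression is a first integral: its derivative is -s times the derivative of the
    -- stationary expression.
    linear_combination -s 0 y * dK y
  have hc : ∀ z, slopeExpr l₁ l₂ (s 0 z) (s 1 z) (s 2 z) (s 3 z) (s 4 z) =
      slopeExpr l₁ l₂ (s 0 y) (s 1 y) (s 2 y) (s 3 y) (s 4 y) := fun z =>
    is_const_of_deriv_eq_zero (fun y => (dE y).differentiableAt) (fun y => (dE y).deriv) z y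
  obtain ⟨-, f2, f3, f4, f5⟩ :=
    tendsto_logTauD_atBot S.k₁_pos S.k₂_pos S.A_pos one_pos one_pos η₁ η₂
  obtain ⟨-, g2, g3, g4, g5⟩ :=
    tendsto_logTauD_atBot S.k₁_pos S.k₂_pos S.A_pos S.p_pos S.q_pos η₁ η₂
  have t0 : Tendsto (s 0) atBot (nhds κ⁻¹) := by
    simpa only [hs, iteratedDeriv_zero] using S.tendsto_slope_atBot η₁ η₂
  have aux : ∀ n, Tendsto (logTauD k₁ k₂ A 1 1 η₁ η₂ (n + 2)) atBot (nhds 0) →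
      Tendsto (logTauD k₁ k₂ A p q η₁ η₂ (n + 2)) atBot (nhds 0) →
      Tendsto (s (n + 1)) atBot (nhds 0) := fun n hF hG => by
    simp only [hs, S.iteratedDeriv_slope]
    simpa using (hG.sub hF).const_mul 2
  have cont : Continuous fun v : ℝ × ℝ × ℝ × ℝ × ℝ =>
      slopeExpr l₁ l₂ v.1 v.2.1 v.2.2.1 v.2.2.2.1 v.2.2.2.2 := by
    unfold slopeExpr
    fun_prop
  -- As y → -∞ the jet of the slope tends to that of the background, which fixes the value of the
  -- constant independently of the phases.
  have lim := (cont.tendsto (κ⁻¹, 0, 0, 0, 0)).comp (t0.prodMk_nhds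
    ((aux 0 f2 g2).prodMk_nhds ((aux 1 f3 g3).prodMk_nhds ((aux 2 f4 g4).prodMk_nhds
      (aux 3 f5 g5)))))
  exact tendsto_nhds_unique (tendsto_const_nhds.congr fun z => (hc z).symm) lim

end SolitonData

/-! ### The reciprocal transformation -/

/-- The reciprocal transformation `y ↦ x`, as a function of the first phase and `y`. -/
def recip (κ k₁ k₂ A p q η₂ a d η₁ y : ℝ) : ℝ :=
  y / κ + a + 2 * Real.log (tauLine k₁ k₂ A p q η₁ η₂ y / tauLine k₁ k₂ A 1 1 η₁ η₂ y) + d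

/-- The inverse of the reciprocal transformation. -/
def recipInv (κ k₁ k₂ A p q η₂ a d η₁ x : ℝ) : ℝ :=
  Function.invFun (recip κ k₁ k₂ A p q η₂ a d η₁) x

/-- The momentum profile. -/
def profile (κ k₁ k₂ A p q η₂ a d η₁ x : ℝ) : ℝ :=
  (slope κ k₁ k₂ A p q η₁ η₂ (recipInv κ k₁ k₂ A p q η₂ a d η₁ x))⁻¹

/-- The hypothesis on Q is the chain rule ∂_x = s⁻¹ ∂_y, for Q n the n-th y-derivative of the slope
s. The x-derivatives of m = 1/s thus become rational in those y-derivatives. -/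
theorem hasDerivAt_iterate_inv {Q : ℕ → ℝ → ℝ} (hQ : ∀ x, 0 < Q 0 x)
    (d : ∀ n x, HasDerivAt (Q n) (Q (n + 1) x / Q 0 x) x) :
    let m := fun x => (Q 0 x)⁻¹
    (∀ x, deriv m x = -Q 1 x / Q 0 x ^ 3) ∧
    (∀ x, deriv (deriv m) x = -Q 2 x / Q 0 x ^ 4 + 3 * Q 1 x ^ 2 / Q 0 x ^ 5) ∧
    (∀ x, deriv (deriv (deriv m)) x = -Q 3 x / Q 0 x ^ 5 + 10 * Q 1 x * Q 2 x / Q 0 x ^ 6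
      - 15 * Q 1 x ^ 3 / Q 0 x ^ 7) ∧
    ∀ x, deriv (deriv (deriv (deriv m))) x = -Q 4 x / Q 0 x ^ 6 + 15 * Q 1 x * Q 3 x / Q 0 x ^ 7
      + 10 * Q 2 x ^ 2 / Q 0 x ^ 7 - 105 * Q 1 x ^ 2 * Q 2 x / Q 0 x ^ 8
      + 105 * Q 1 x ^ 4 / Q 0 x ^ 9 := by
  intro m
  have ne : ∀ x, Q 0 x ≠ 0 := fun x => (hQ x).ne'
  have i : ∀ n x, Q 0 x ^ n ≠ 0 := fun n x => pow_ne_zero n (ne x)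
  have e1 : ∀ x, deriv m x = -Q 1 x / Q 0 x ^ 3 := fun x => by
    rw [((d 0 x).fun_inv (ne x)).deriv]
    field_simp [ne x]
  have e2 : ∀ x, deriv (deriv m) x = -Q 2 x / Q 0 x ^ 4 + 3 * Q 1 x ^ 2 / Q 0 x ^ 5 := fun x => by
    rw [funext e1, ((d 1 x).fun_neg.fun_div ((d 0 x).fun_pow 3) (i 3 x)).deriv]
    have := ne x
    field_simp
    push_cast
    ring
  have e3 : ∀ x, deriv (deriv (deriv m)) x = -Q 3 x / Q 0 x ^ 5 + 10 * Q 1 x * Q 2 x / Q 0 x ^ 6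
      - 15 * Q 1 x ^ 3 / Q 0 x ^ 7 := fun x => by
    rw [funext e2, (((d 2 x).fun_neg.fun_div ((d 0 x).fun_pow 4) (i 4 x)).fun_add
      ((((d 1 x).fun_pow 2).const_mul 3).fun_div ((d 0 x).fun_pow 5) (i 5 x))).deriv]
    have := ne x
    field_simp
    push_cast
    ring
  refine ⟨e1, e2, e3, fun x => ?_⟩
  rw [funext e3, ((((d 3 x).fun_neg.fun_div ((d 0 x).fun_pow 5) (i 5 x)).fun_add
    ((((d 1 x).const_mul 10).fun_mul (d 2 x)).fun_div ((d 0 x).fun_pow 6) (i 6 x))).fun_sub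
    ((((d 1 x).fun_pow 3).const_mul 15).fun_div ((d 0 x).fun_pow 7) (i 7 x))).deriv]
  have := ne x
  field_simp
  push_cast
  ring

theorem jointSmooth_tauLine (k₁ k₂ A a b η₂ : ℝ) :
    JointSmooth fun s y => tauLine k₁ k₂ A a b s η₂ y := by
  unfold JointSmooth tauLine tau phase
  fun_prop

theorem tau_le_tau {A p q X Y : ℝ} (hA : 0 < A) (hp : 0 < p) (hq : 0 < q) (hp1 : p < 1) (hq1 : q < 1)
    (hX : 0 < X) (hY : 0 < Y) :
    p * q * tau A 1 1 X Y ≤ tau A p q X Y ∧ tau A p q X Y ≤ tau A 1 1 X Y := by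
  have hpq : p * q ≤ 1 := by nlinarith
  have h1 : p * q ≤ p := by nlinarith
  have h2 : p * q ≤ q := by nlinarith
  have hAXY : 0 < A * (X * Y) := by positivity
  simp only [tau]
  constructor <;> nlinarith [mul_le_mul_of_nonneg_right h1 hX.le,
    mul_le_mul_of_nonneg_right h2 hY.le, mul_le_mul_of_nonneg_right hpq hAXY.le,
    mul_le_mul_of_nonneg_right hp1.le hX.le, mul_le_mul_of_nonneg_right hq1.le hY.le]

namespace SolitonData

variable {κ k₁ k₂ A p q : ℝ}

theorem jointSmooth_recip (S : SolitonData κ k₁ k₂ A p q) (η₂ a d : ℝ) :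
    JointSmooth (recip κ k₁ k₂ A p q η₂ a d) := by
  have h : ContDiff ℝ ∞ fun r : ℝ × ℝ => Real.log (tauLine k₁ k₂ A p q r.1 η₂ r.2
      / tauLine k₁ k₂ A 1 1 r.1 η₂ r.2) :=
    ((jointSmooth_tauLine k₁ k₂ A p q η₂).div (jointSmooth_tauLine k₁ k₂ A 1 1 η₂)
      fun r => (S.tauLine_pos₁ r.1 η₂ r.2).ne').log fun r =>
      (div_pos (S.tauLine_pos₂ r.1 η₂ r.2) (S.tauLine_pos₁ r.1 η₂ r.2)).ne'
  exact (((contDiff_snd.div_const κ).add contDiff_const).add (contDiff_const.mul h)).add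
    contDiff_const

theorem hasDerivAt_recip (S : SolitonData κ k₁ k₂ A p q) (η₂ a d η₁ y : ℝ) :
    HasDerivAt (recip κ k₁ k₂ A p q η₂ a d η₁) (slope κ k₁ k₂ A p q η₁ η₂ y) y := by
  have hf := (S.tauLine_pos₁ η₁ η₂ y).ne'
  have hg := (S.tauLine_pos₂ η₁ η₂ y).ne'
  refine (((((hasDerivAt_id y).div_const κ).add_const a).add
    ((((hasDerivAt_tauLine k₁ k₂ A p q η₁ η₂ y).fun_div (hasDerivAt_tauLine k₁ k₂ A 1 1 η₁ η₂ y)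
      hf).log (div_ne_zero hg hf)).const_mul 2)).add_const d).congr_deriv ?_
  rw [slope]
  field_simp

theorem pderiv₂_recip (S : SolitonData κ k₁ k₂ A p q) (η₂ a d : ℝ) :
    pderiv₂ (recip κ k₁ k₂ A p q η₂ a d) = fun η₁ y => slope κ k₁ k₂ A p q η₁ η₂ y :=
  funext fun η₁ => funext fun y => (S.hasDerivAt_recip η₂ a d η₁ y).deriv

/-- The map is increasing since its slope is positive. It differs from y/κ by a bounded function,
because pq ≤ g/f ≤ 1, so it is also onto. -/
theorem recip_bijective (S : SolitonData κ k₁ k₂ A p q) (η₂ a d η₁ : ℝ) :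
    Function.Bijective (recip κ k₁ k₂ A p q η₂ a d η₁) := by
  have hd := S.hasDerivAt_recip η₂ a d η₁
  have bd : ∀ y, Real.log (p * q) ≤
      Real.log (tauLine k₁ k₂ A p q η₁ η₂ y / tauLine k₁ k₂ A 1 1 η₁ η₂ y) ∧
      Real.log (tauLine k₁ k₂ A p q η₁ η₂ y / tauLine k₁ k₂ A 1 1 η₁ η₂ y) ≤ 0 := fun y => by
    have h := tau_le_tau S.A_pos S.p_pos S.q_pos S.p_lt_one S.symm.p_lt_one (phase_pos k₁ η₁ y)
      (phase_pos k₂ η₂ y)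
    have hf := S.tauLine_pos₁ η₁ η₂ y
    have hg := S.tauLine_pos₂ η₁ η₂ y
    exact ⟨Real.log_le_log (mul_pos S.p_pos S.q_pos) ((le_div_iff₀ hf).2 h.1),
      Real.log_nonpos (div_pos hg hf).le ((div_le_one hf).2 h.2)⟩
  refine ⟨(strictMono_of_deriv_pos fun y => ?_).injective, Continuous.surjective
    (continuous_iff_continuousAt.2 fun y => (hd y).continuousAt) ?_ ?_⟩
  · rw [(hd y).deriv]
    exact S.slope_pos η₁ η₂ y
  · refine tendsto_atTop_mono (f := fun y => y / κ + (a + 2 * Real.log (p * q) + d)) (fun y => ?_)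
      (tendsto_atTop_add_const_right _ _ (tendsto_id.atTop_div_const S.κ_pos))
    rw [recip]
    linarith [(bd y).1]
  · refine tendsto_atBot_mono (f := fun y => y / κ + (a + d)) (fun y => ?_)
      (tendsto_atBot_add_const_right _ _ (tendsto_id.atBot_div_const S.κ_pos))
    rw [recip]
    linarith [(bd y).2]

theorem recip_recipInv (S : SolitonData κ k₁ k₂ A p q) (η₂ a d η₁ x : ℝ) :
    recip κ k₁ k₂ A p q η₂ a d η₁ (recipInv κ k₁ k₂ A p q η₂ a d η₁ x) = x :=
  Function.rightInverse_invFun (S.recip_bijective η₂ a d η₁).surjective x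

theorem recipInv_recip (S : SolitonData κ k₁ k₂ A p q) (η₂ a d η₁ y : ℝ) :
    recipInv κ k₁ k₂ A p q η₂ a d η₁ (recip κ k₁ k₂ A p q η₂ a d η₁ y) = y :=
  Function.leftInverse_invFun (S.recip_bijective η₂ a d η₁).injective y

theorem jointSmooth_recipInv (S : SolitonData κ k₁ k₂ A p q) (η₂ a d : ℝ) :
    JointSmooth (recipInv κ k₁ k₂ A p q η₂ a d) :=
  (S.jointSmooth_recip η₂ a d).invFun
    (fun s y => by rw [S.pderiv₂_recip]; exact S.slope_pos s η₂ y) (S.recip_bijective η₂ a d)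

/-- The profile is itself an x-derivative, m = y_x. Its joint smoothness and the independence of the
modes rest on this. -/
theorem hasDerivAt_recipInv (S : SolitonData κ k₁ k₂ A p q) (η₂ a d η₁ x : ℝ) :
    HasDerivAt (recipInv κ k₁ k₂ A p q η₂ a d η₁) (profile κ k₁ k₂ A p q η₂ a d η₁ x) x := by
  have h1 := (S.jointSmooth_recipInv η₂ a d).hasDerivAt₂ η₁ x
  have h2 := (S.hasDerivAt_recip η₂ a d η₁ (recipInv κ k₁ k₂ A p q η₂ a d η₁ x)).comp x h1
  have e : recip κ k₁ k₂ A p q η₂ a d η₁ ∘ recipInv κ k₁ k₂ A p q η₂ a d η₁ = id :=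
    funext (S.recip_recipInv η₂ a d η₁)
  rw [e] at h2
  refine h1.congr_deriv ?_
  rw [profile, ← one_div, eq_div_iff (S.slope_pos _ _ _).ne', mul_comm]
  exact h2.unique (hasDerivAt_id x)

theorem pderiv₂_recipInv (S : SolitonData κ k₁ k₂ A p q) (η₂ a d : ℝ) :
    pderiv₂ (recipInv κ k₁ k₂ A p q η₂ a d) = profile κ k₁ k₂ A p q η₂ a d :=
  funext fun η₁ => funext fun x => (S.hasDerivAt_recipInv η₂ a d η₁ x).deriv

theorem jointSmooth_profile (S : SolitonData κ k₁ k₂ A p q) (η₂ a d : ℝ) :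
    JointSmooth (profile κ k₁ k₂ A p q η₂ a d) :=
  S.pderiv₂_recipInv η₂ a d ▸ (S.jointSmooth_recipInv η₂ a d).jointSmooth₂

theorem profile_pos (S : SolitonData κ k₁ k₂ A p q) (η₂ a d η₁ x : ℝ) :
    0 < profile κ k₁ k₂ A p q η₂ a d η₁ x :=
  inv_pos.2 (S.slope_pos ..)

/-- The Euler-Lagrange equation for the profile. -/
theorem eulerExpr_profile (S : SolitonData κ k₁ k₂ A p q) (η₂ a d η₁ x : ℝ) :
    let M := profile κ k₁ k₂ A p q η₂ a d
    eulerExpr (mult₁ κ k₁ k₂) (mult₂ κ k₁ k₂) (M η₁ x)⁻¹ (pderiv₂ M η₁ x)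
      (pderiv₂ (pderiv₂ M) η₁ x) (pderiv₂ (pderiv₂ (pderiv₂ M)) η₁ x)
      (pderiv₂ (pderiv₂ (pderiv₂ (pderiv₂ M))) η₁ x) =
      slopeExpr (mult₁ κ k₁ k₂) (mult₂ κ k₁ k₂) κ⁻¹ 0 0 0 0 := by
  intro M
  set Q : ℕ → ℝ → ℝ := fun n x =>
    iteratedDeriv n (slope κ k₁ k₂ A p q η₁ η₂) (recipInv κ k₁ k₂ A p q η₂ a d η₁ x) with hQ
  have hM : M η₁ = fun x => (Q 0 x)⁻¹ := funext fun x => by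
    simp only [M, hQ, profile, iteratedDeriv_zero]
  have dQ : ∀ n x, HasDerivAt (Q n) (Q (n + 1) x / Q 0 x) x := fun n x => by
    refine ((S.hasDerivAt_iteratedDeriv_slope η₁ η₂ n _).comp x
      (S.hasDerivAt_recipInv η₂ a d η₁ x)).congr_deriv ?_
    simp only [hQ, profile, iteratedDeriv_zero, div_eq_mul_inv]
  have pos : ∀ x, 0 < Q 0 x := fun x => by
    simp only [hQ, iteratedDeriv_zero]
    exact S.slope_pos ..
  obtain ⟨e1, e2, e3, e4⟩ := hasDerivAt_iterate_inv pos dQ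
  rw [← hM] at e1 e2 e3 e4
  have hE := S.slopeExpr_eq η₁ η₂ (recipInv κ k₁ k₂ A p q η₂ a d η₁ x)
  simp only at hE
  rw [← hE]
  have r1 : pderiv₂ M η₁ x = _ := e1 x
  have r2 : pderiv₂ (pderiv₂ M) η₁ x = _ := e2 x
  have r3 : pderiv₂ (pderiv₂ (pderiv₂ M)) η₁ x = _ := e3 x
  have r4 : pderiv₂ (pderiv₂ (pderiv₂ (pderiv₂ M))) η₁ x = _ := e4 x
  have r0 : (M η₁ x)⁻¹ = Q 0 x := by rw [congrFun hM x, inv_inv]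
  rw [r0, r1, r2, r3, r4]
  change _ = slopeExpr _ _ (Q 0 x) (Q 1 x) (Q 2 x) (Q 3 x) (Q 4 x)
  rw [eulerExpr, slopeExpr]
  have := (pos x).ne'
  field_simp
  ring

/-- The translation modes solve the linearized equation. -/
theorem divForm_pderiv₁_profile (S : SolitonData κ k₁ k₂ A p q) (η₂ a d η₁ x : ℝ) :
    let M := profile κ k₁ k₂ A p q η₂ a d
    divForm (coefA (M η₁)) (coefB (mult₂ κ k₁ k₂) (M η₁))
      (coefC (mult₁ κ k₁ k₂) (mult₂ κ k₁ k₂) (M η₁)) (pderiv₁ M η₁)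
      (iteratedDeriv 1 (pderiv₁ M η₁)) (iteratedDeriv 2 (pderiv₁ M η₁))
      (iteratedDeriv 3 (pderiv₁ M η₁)) (iteratedDeriv 4 (pderiv₁ M η₁)) x = 0 :=
  divForm_pderiv₁_eq_zero (S.jointSmooth_profile η₂ a d) (S.profile_pos η₂ a d)
    (S.eulerExpr_profile η₂ a d) η₁ x

end SolitonData

/-! ### The solution in terms of the slope -/

/-- The derivatives `∂_τ ∂_yⁿ` of the tau-function, where `X_τ = w₁ X` and `Y_τ = w₂ Y`. -/
def tauM (w₁ w₂ k₁ k₂ A a b : ℝ) (n : ℕ) (X Y : ℝ) : ℝ :=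
  w₁ * k₁ ^ n * (a * X) + w₂ * k₂ ^ n * (b * Y) + (w₁ + w₂) * (k₁ + k₂) ^ n * (A * (a * b) * (X * Y))

theorem hasDerivAt_tauM {X Y : ℝ → ℝ} {k₁ k₂ y : ℝ} (hX : HasDerivAt X (k₁ * X y) y)
    (hY : HasDerivAt Y (k₂ * Y y) y) (w₁ w₂ A a b : ℝ) (n : ℕ) :
    HasDerivAt (fun y => tauM w₁ w₂ k₁ k₂ A a b n (X y) (Y y))
      (tauM w₁ w₂ k₁ k₂ A a b (n + 1) (X y) (Y y)) y := by
  refine ((((hX.const_mul a).const_mul (w₁ * k₁ ^ n)).add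
    ((hY.const_mul b).const_mul (w₂ * k₂ ^ n))).add
    (((hX.mul hY).const_mul (A * (a * b))).const_mul ((w₁ + w₂) * (k₁ + k₂) ^ n))).congr_deriv ?_
  simp only [tauM]
  ring

/-- The τ-derivative of `bilinear_two`. That identity holds for all X, Y, so the rates w₁, w₂ are
arbitrary here. -/
theorem bilinear_two_time {κ k₁ k₂ A p q : ℝ} (hp : p * (1 + κ * k₁) = 1 - κ * k₁)
    (hq : q * (1 + κ * k₂) = 1 - κ * k₂) (hA : A * (k₁ + k₂) ^ 2 = (k₁ - k₂) ^ 2)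
    (h1 : 1 + κ * k₁ ≠ 0) (h2 : 1 + κ * k₂ ≠ 0) (h3 : k₁ + k₂ ≠ 0) (w₁ w₂ X Y : ℝ) :
    let f := tau A 1 1 X Y
    let g := tau A p q X Y
    let F := fun n => tauD k₁ k₂ A 1 1 n X Y
    let G := fun n => tauD k₁ k₂ A p q n X Y
    let Ft := fun n => tauM w₁ w₂ k₁ k₂ A 1 1 n X Y
    let Gt := fun n => tauM w₁ w₂ k₁ k₂ A p q n X Y
    κ * (Gt 2 * f + G 2 * Ft 0 - 2 * Gt 1 * F 1 - 2 * G 1 * Ft 1 + Gt 0 * F 2 + g * Ft 2)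
      + (Gt 1 * f + G 1 * Ft 0 - Gt 0 * F 1 - g * Ft 1) = 0 := by
  rw [← eq_div_iff h1] at hp
  rw [← eq_div_iff h2] at hq
  rw [← eq_div_iff (pow_ne_zero 2 h3)] at hA
  subst hp hq hA
  simp only [tau, tauD, tauM]
  field_simp
  ring

/-- In Hirota notation, D_τ (κ D² + D) g·f = 2κ² D g·f. The hypotheses on w₁, w₂ are the dispersion
relation. -/
theorem bilinear_three_time {κ k₁ k₂ A p q w₁ w₂ : ℝ} (hp : p * (1 + κ * k₁) = 1 - κ * k₁)
    (hq : q * (1 + κ * k₂) = 1 - κ * k₂) (hA : A * (k₁ + k₂) ^ 2 = (k₁ - k₂) ^ 2)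
    (h1 : 1 + κ * k₁ ≠ 0) (h2 : 1 + κ * k₂ ≠ 0) (h3 : k₁ + k₂ ≠ 0)
    (h4 : 1 - κ * k₁ ≠ 0) (h5 : 1 - κ * k₂ ≠ 0)
    (hw₁ : w₁ * ((1 - κ * k₁) * (1 + κ * k₁)) = -(2 * κ ^ 3 * k₁))
    (hw₂ : w₂ * ((1 - κ * k₂) * (1 + κ * k₂)) = -(2 * κ ^ 3 * k₂)) (X Y : ℝ) :
    let f := tau A 1 1 X Y
    let g := tau A p q X Y
    let F := fun n => tauD k₁ k₂ A 1 1 n X Y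
    let G := fun n => tauD k₁ k₂ A p q n X Y
    let Ft := fun n => tauM w₁ w₂ k₁ k₂ A 1 1 n X Y
    let Gt := fun n => tauM w₁ w₂ k₁ k₂ A p q n X Y
    κ * (Gt 2 * f - 2 * Gt 1 * F 1 + Gt 0 * F 2 - G 2 * Ft 0 + 2 * G 1 * Ft 1 - g * Ft 2)
      + (Gt 1 * f - Gt 0 * F 1 - G 1 * Ft 0 + g * Ft 1) - 2 * κ ^ 2 * (G 1 * f - g * F 1) = 0 := by
  rw [← eq_div_iff h1] at hp
  rw [← eq_div_iff h2] at hq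
  rw [← eq_div_iff (pow_ne_zero 2 h3)] at hA
  rw [← eq_div_iff (mul_ne_zero h4 h1)] at hw₁
  rw [← eq_div_iff (mul_ne_zero h5 h2)] at hw₂
  subst hp hq hA hw₁ hw₂
  simp only [tau, tauD, tauM]
  field_simp
  ring

/-- The function `(log f)_τ`, divided into its two first derivatives in `y`. -/
theorem hasDerivAt_logTime {f f₁ f₂ m₀ m₁ m₂ : ℝ → ℝ} (hf : ∀ y, 0 < f y)
    (h0 : ∀ y, HasDerivAt f (f₁ y) y) (h1 : ∀ y, HasDerivAt f₁ (f₂ y) y)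
    (d0 : ∀ y, HasDerivAt m₀ (m₁ y) y) (d1 : ∀ y, HasDerivAt m₁ (m₂ y) y) (y : ℝ) :
    HasDerivAt (fun y => m₀ y / f y) (m₁ y / f y - m₀ y / f y * (f₁ y / f y)) y ∧
    HasDerivAt (fun y => m₁ y / f y - m₀ y / f y * (f₁ y / f y))
      (m₂ y / f y - 2 * (m₁ y / f y) * (f₁ y / f y) - m₀ y / f y * (f₂ y / f y)
        + 2 * (m₀ y / f y) * (f₁ y / f y) ^ 2) y := by
  have ne := (hf y).ne'
  constructor
  · refine ((d0 y).fun_div (h0 y) ne).congr_deriv ?_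
    field_simp
  · refine (((d1 y).fun_div (h0 y) ne).fun_sub (((d0 y).fun_div (h0 y) ne).fun_mul
      ((h1 y).fun_div (h0 y) ne))).congr_deriv ?_
    field_simp
    ring

/-- The function `(log f)_{τ y}`. -/
def logTauT (w₁ w₂ k₁ k₂ A a b η₁ η₂ y : ℝ) : ℝ :=
  let X := phase k₁ η₁ y
  let Y := phase k₂ η₂ y
  tauM w₁ w₂ k₁ k₂ A a b 1 X Y / tau A a b X Y
    - tauM w₁ w₂ k₁ k₂ A a b 0 X Y / tau A a b X Y * (tauD k₁ k₂ A a b 1 X Y / tau A a b X Y)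

/-- The function `(log f)_{τ y y}`. -/
def logTauTD (w₁ w₂ k₁ k₂ A a b η₁ η₂ y : ℝ) : ℝ :=
  let X := phase k₁ η₁ y
  let Y := phase k₂ η₂ y
  let f := tau A a b X Y
  let F := fun n => tauD k₁ k₂ A a b n X Y
  let M := fun n => tauM w₁ w₂ k₁ k₂ A a b n X Y
  M 2 / f - 2 * (M 1 / f) * (F 1 / f) - M 0 / f * (F 2 / f) + 2 * (M 0 / f) * (F 1 / f) ^ 2

theorem hasDerivAt_logTauT {A a b : ℝ} (hA : 0 < A) (ha : 0 < a) (hb : 0 < b)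
    (w₁ w₂ k₁ k₂ η₁ η₂ y : ℝ) :
    HasDerivAt (fun y => tauM w₁ w₂ k₁ k₂ A a b 0 (phase k₁ η₁ y) (phase k₂ η₂ y)
      / tauLine k₁ k₂ A a b η₁ η₂ y) (logTauT w₁ w₂ k₁ k₂ A a b η₁ η₂ y) y ∧
    HasDerivAt (logTauT w₁ w₂ k₁ k₂ A a b η₁ η₂) (logTauTD w₁ w₂ k₁ k₂ A a b η₁ η₂ y) y :=
  hasDerivAt_logTime (tauLine_pos hA ha hb k₁ k₂ η₁ η₂) (hasDerivAt_tauLine k₁ k₂ A a b η₁ η₂)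
    (hasDerivAt_tauLineD k₁ k₂ A a b η₁ η₂ 1)
    (fun y => hasDerivAt_tauM (hasDerivAt_phase k₁ η₁ y) (hasDerivAt_phase k₂ η₂ y) w₁ w₂ A a b 0)
    (fun y => hasDerivAt_tauM (hasDerivAt_phase k₁ η₁ y) (hasDerivAt_phase k₂ η₂ y) w₁ w₂ A a b 1) y

namespace SolitonData

variable {κ k₁ k₂ A p q : ℝ}

/-- With U = κ - (log(fg))_τy these say U_y = s (log(g/f))_τy and (log(g/f))_τyy = s U - 1. They are
the two bilinear identities with time derivatives divided by κ f g, after subtraction of a multiple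
of `bilinear_two`. -/
theorem time_identities (S : SolitonData κ k₁ k₂ A p q) {w₁ w₂ : ℝ}
    (hw₁ : w₁ * ((1 - κ * k₁) * (1 + κ * k₁)) = -(2 * κ ^ 3 * k₁))
    (hw₂ : w₂ * ((1 - κ * k₂) * (1 + κ * k₂)) = -(2 * κ ^ 3 * k₂)) (η₁ η₂ y : ℝ) :
    logTauTD w₁ w₂ k₁ k₂ A 1 1 η₁ η₂ y + logTauTD w₁ w₂ k₁ k₂ A p q η₁ η₂ y =
      -((logTauT w₁ w₂ k₁ k₂ A p q η₁ η₂ y - logTauT w₁ w₂ k₁ k₂ A 1 1 η₁ η₂ y)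
        * slope κ k₁ k₂ A p q η₁ η₂ y) ∧
    logTauTD w₁ w₂ k₁ k₂ A p q η₁ η₂ y - logTauTD w₁ w₂ k₁ k₂ A 1 1 η₁ η₂ y =
      slope κ k₁ k₂ A p q η₁ η₂ y * (κ - (logTauT w₁ w₂ k₁ k₂ A 1 1 η₁ η₂ y
        + logTauT w₁ w₂ k₁ k₂ A p q η₁ η₂ y)) - 1 := by
  have f0 := (S.tauLine_pos₁ η₁ η₂ y).ne'
  have g0 := (S.tauLine_pos₂ η₁ η₂ y).ne'
  have hκ := S.κ_pos.ne'
  have n1 := S.κk_lt_one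
  have n2 := S.symm.κk_lt_one
  have B1 := bilinear_two S.hp S.hq S.hA S.one_add_ne S.symm.one_add_ne S.add_ne (phase k₁ η₁ y)
    (phase k₂ η₂ y)
  have B2 := bilinear_two_time S.hp S.hq S.hA S.one_add_ne S.symm.one_add_ne S.add_ne w₁ w₂
    (phase k₁ η₁ y) (phase k₂ η₂ y)
  have B3 := bilinear_three_time S.hp S.hq S.hA S.one_add_ne S.symm.one_add_ne S.add_ne
    (by linarith) (by linarith) hw₁ hw₂ (phase k₁ η₁ y) (phase k₂ η₂ y)
  simp only [logTauTD, logTauT, slope, tauLine, tauLineD] at *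
  generalize tau A 1 1 (phase k₁ η₁ y) (phase k₂ η₂ y) = f at *
  generalize tau A p q (phase k₁ η₁ y) (phase k₂ η₂ y) = g at *
  -- Each derivative is written as f or g times its quotient by that function, so that the claim
  -- becomes polynomial.
  have key : ∀ {u r : ℝ}, r ≠ 0 → ∃ v, u = r * v := fun {u r} h => ⟨u / r, by field_simp⟩
  obtain ⟨F1, hF1⟩ := key (u := tauD k₁ k₂ A 1 1 1 (phase k₁ η₁ y) (phase k₂ η₂ y)) f0
  obtain ⟨F2, hF2⟩ := key (u := tauD k₁ k₂ A 1 1 2 (phase k₁ η₁ y) (phase k₂ η₂ y)) f0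
  obtain ⟨G1, hG1⟩ := key (u := tauD k₁ k₂ A p q 1 (phase k₁ η₁ y) (phase k₂ η₂ y)) g0
  obtain ⟨G2, hG2⟩ := key (u := tauD k₁ k₂ A p q 2 (phase k₁ η₁ y) (phase k₂ η₂ y)) g0
  obtain ⟨M0, hM0⟩ := key (u := tauM w₁ w₂ k₁ k₂ A 1 1 0 (phase k₁ η₁ y) (phase k₂ η₂ y)) f0
  obtain ⟨M1, hM1⟩ := key (u := tauM w₁ w₂ k₁ k₂ A 1 1 1 (phase k₁ η₁ y) (phase k₂ η₂ y)) f0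
  obtain ⟨M2, hM2⟩ := key (u := tauM w₁ w₂ k₁ k₂ A 1 1 2 (phase k₁ η₁ y) (phase k₂ η₂ y)) f0
  obtain ⟨N0, hN0⟩ := key (u := tauM w₁ w₂ k₁ k₂ A p q 0 (phase k₁ η₁ y) (phase k₂ η₂ y)) g0
  obtain ⟨N1, hN1⟩ := key (u := tauM w₁ w₂ k₁ k₂ A p q 1 (phase k₁ η₁ y) (phase k₂ η₂ y)) g0
  obtain ⟨N2, hN2⟩ := key (u := tauM w₁ w₂ k₁ k₂ A p q 2 (phase k₁ η₁ y) (phase k₂ η₂ y)) g0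
  rw [hF1, hF2, hG1, hG2] at B1
  rw [hF1, hF2, hG1, hG2, hM0, hM1, hM2, hN0, hN1, hN2] at B2 B3
  rw [hF1, hF2, hG1, hG2, hM0, hM1, hM2, hN0, hN1, hN2]
  simp only [mul_div_cancel_left₀ _ f0, mul_div_cancel_left₀ _ g0]
  have c0 : f * g * κ ≠ 0 := mul_ne_zero (mul_ne_zero f0 g0) hκ
  have hi : κ * κ⁻¹ = 1 := mul_inv_cancel₀ hκ
  constructor
  · refine mul_left_cancel₀ c0 ?_
    linear_combination B2 - (M0 + N0) * B1 + f * g * ((N1 - N0 * G1) - (M1 - M0 * F1)) * hi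
  · refine mul_left_cancel₀ c0 ?_
    linear_combination B3 - (N0 - M0) * B1 -
      f * g * (κ - ((M1 - M0 * F1) + (N1 - N0 * G1))) * hi

/-- The momentum `U - U_xx` is the reciprocal of the slope. -/
theorem sub_deriv_deriv_eq_profile (S : SolitonData κ k₁ k₂ A p q) {w₁ w₂ : ℝ}
    (hw₁ : w₁ * ((1 - κ * k₁) * (1 + κ * k₁)) = -(2 * κ ^ 3 * k₁))
    (hw₂ : w₂ * ((1 - κ * k₂) * (1 + κ * k₂)) = -(2 * κ ^ 3 * k₂)) (η₁ η₂ a d : ℝ) {U : ℝ → ℝ}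
    (hU : ∀ x, U x = κ - (logTauT w₁ w₂ k₁ k₂ A 1 1 η₁ η₂ (recipInv κ k₁ k₂ A p q η₂ a d η₁ x)
      + logTauT w₁ w₂ k₁ k₂ A p q η₁ η₂ (recipInv κ k₁ k₂ A p q η₂ a d η₁ x))) (x : ℝ) :
    U x - deriv (deriv U) x = profile κ k₁ k₂ A p q η₂ a d η₁ x := by
  have T := S.time_identities hw₁ hw₂ η₁ η₂
  have dF := fun y => (hasDerivAt_logTauT S.A_pos one_pos one_pos w₁ w₂ k₁ k₂ η₁ η₂ y).2
  have dG := fun y => (hasDerivAt_logTauT S.A_pos S.p_pos S.q_pos w₁ w₂ k₁ k₂ η₁ η₂ y).2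
  have dψ := S.hasDerivAt_recipInv η₂ a d η₁
  have hs := fun y => (S.slope_pos η₁ η₂ y).ne'
  -- Since y_x = 1/s, the first identity gives U_x = (log(g/f))_τy; the second then gives U_xx = U -
  -- 1/s.
  have d1 : deriv U = fun x => logTauT w₁ w₂ k₁ k₂ A p q η₁ η₂ (recipInv κ k₁ k₂ A p q η₂ a d η₁ x)
      - logTauT w₁ w₂ k₁ k₂ A 1 1 η₁ η₂ (recipInv κ k₁ k₂ A p q η₂ a d η₁ x) := funext fun x => by
    rw [funext hU]
    refine ((((dF _).add (dG _)).const_sub κ).comp x (dψ x)).deriv.trans ?_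
    rw [(T _).1, profile, neg_neg]
    exact mul_inv_cancel_right₀ (hs _) _
  rw [d1, (((dG _).sub (dF _)).comp x (dψ x) |>.deriv : deriv (fun x => _ - _) x = _), (T _).2, hU,
    profile]
  have := hs (recipInv κ k₁ k₂ A p q η₂ a d η₁ x)
  field_simp
  ring

end SolitonData

/-! ### Bounds for the profile -/

theorem BddDiff.sub {n : ℕ} {φ χ : ℝ → ℝ} (h : BddDiff n φ) (h' : BddDiff n χ) :
    BddDiff n (fun x => φ x - χ x) := by
  simpa [sub_eq_add_neg] using h.add ((bddDiff_const n (-1)).mul h')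

/-- Bilinear interpolation on the unit square. -/
def blend (c₀ c₁ c₂ c₃ s t : ℝ) : ℝ :=
  c₀ * ((1 - s) * (1 - t)) + c₁ * (s * (1 - t)) + c₂ * ((1 - s) * t) + c₃ * (s * t)

theorem le_blend {c c₀ c₁ c₂ c₃ s t : ℝ} (h0 : c ≤ c₀) (h1 : c ≤ c₁) (h2 : c ≤ c₂) (h3 : c ≤ c₃)
    (hs : s ∈ Icc 0 1) (ht : t ∈ Icc 0 1) : c ≤ blend c₀ c₁ c₂ c₃ s t := by
  have s0 : 0 ≤ s := hs.1
  have t0 : 0 ≤ t := ht.1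
  have s1 : 0 ≤ 1 - s := sub_nonneg.2 hs.2
  have t1 : 0 ≤ 1 - t := sub_nonneg.2 ht.2
  have e : blend c₀ c₁ c₂ c₃ s t - c = (c₀ - c) * ((1 - s) * (1 - t)) + (c₁ - c) * (s * (1 - t))
      + (c₂ - c) * ((1 - s) * t) + (c₃ - c) * (s * t) := by
    rw [blend]; ring
  have := sub_nonneg.2 h0
  have := sub_nonneg.2 h1
  have := sub_nonneg.2 h2
  have := sub_nonneg.2 h3
  rw [← sub_nonneg, e]
  positivity

theorem BddDiff.blend {n : ℕ} {s t : ℝ → ℝ} (hs : BddDiff n s) (ht : BddDiff n t)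
    (c₀ c₁ c₂ c₃ : ℝ) : BddDiff n fun x => blend c₀ c₁ c₂ c₃ (s x) (t x) := by
  have c := bddDiff_const n
  have hs' := (c 1).sub hs
  have ht' := (c 1).sub ht
  exact ((((c c₀).mul (hs'.mul ht')).add ((c c₁).mul (hs.mul ht'))).add
    ((c c₂).mul (hs'.mul ht))).add ((c c₃).mul (hs.mul ht))

/-- The tau-function in the variables `X / (1 + X)` and `Y / (1 + Y)`, up to a factor. -/
def tauHat (A a b s t : ℝ) : ℝ := blend 1 a b (A * (a * b)) s t

/-- The derivative of the tau-function in the variables `X / (1 + X)` and `Y / (1 + Y)`, up to a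
factor. -/
def tauDHat (k₁ k₂ A a b s t : ℝ) : ℝ :=
  blend 0 (k₁ * a) (k₂ * b) ((k₁ + k₂) * (A * (a * b))) s t

theorem tau_eq_tauHat (A a b : ℝ) {X Y : ℝ} (hX : 0 < X) (hY : 0 < Y) :
    tau A a b X Y = (1 + X) * (1 + Y) * tauHat A a b (X / (1 + X)) (Y / (1 + Y)) := by
  rw [tau, tauHat, blend]
  field_simp
  ring

theorem tauD_eq_tauDHat (k₁ k₂ A a b : ℝ) {X Y : ℝ} (hX : 0 < X) (hY : 0 < Y) :
    tauD k₁ k₂ A a b 1 X Y =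
      (1 + X) * (1 + Y) * tauDHat k₁ k₂ A a b (X / (1 + X)) (Y / (1 + Y)) := by
  rw [tauD, tauDHat, blend]
  field_simp
  ring

/-- The common factor (1 + X)(1 + Y) cancels, so the quotient extends to the compact unit square,
where the denominator stays away from 0. -/
theorem tauD_div_tau (k₁ k₂ A a b : ℝ) {X Y : ℝ} (hX : 0 < X) (hY : 0 < Y) :
    tauD k₁ k₂ A a b 1 X Y / tau A a b X Y = tauDHat k₁ k₂ A a b (X / (1 + X)) (Y / (1 + Y))
      / tauHat A a b (X / (1 + X)) (Y / (1 + Y)) := by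
  rw [tau_eq_tauHat A a b hX hY, tauD_eq_tauDHat k₁ k₂ A a b hX hY]
  exact mul_div_mul_left _ _ (by positivity)

/-- The slope in the variables `X / (1 + X)` and `Y / (1 + Y)`. -/
def slopeHat (κ k₁ k₂ A p q s t : ℝ) : ℝ :=
  κ⁻¹ + 2 * (tauDHat k₁ k₂ A p q s t * (tauHat A p q s t)⁻¹
    - tauDHat k₁ k₂ A 1 1 s t * (tauHat A 1 1 s t)⁻¹)

theorem slope_eq_slopeHat (κ k₁ k₂ A p q η₁ η₂ y : ℝ) : slope κ k₁ k₂ A p q η₁ η₂ y =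
    slopeHat κ k₁ k₂ A p q (phase k₁ η₁ y / (1 + phase k₁ η₁ y))
      (phase k₂ η₂ y / (1 + phase k₂ η₂ y)) := by
  simp only [slope, slopeHat, tauLine, tauLineD]
  rw [tauD_div_tau k₁ k₂ A p q (phase_pos ..) (phase_pos ..),
    tauD_div_tau k₁ k₂ A 1 1 (phase_pos ..) (phase_pos ..)]
  simp only [div_eq_mul_inv]

theorem div_one_add_mem {X : ℝ} (hX : 0 < X) : X / (1 + X) ∈ Icc (0 : ℝ) 1 :=
  ⟨by positivity, (div_le_one (by positivity)).2 (by linarith)⟩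

/-- Since A, a, b ≤ 1, the smallest of the four corner values is A a b. -/
theorem le_tauHat {A a b s t : ℝ} (hA1 : A ≤ 1) (ha : 0 < a) (ha1 : a ≤ 1) (hb : 0 < b)
    (hb1 : b ≤ 1) (hs : s ∈ Icc 0 1) (ht : t ∈ Icc 0 1) : A * (a * b) ≤ tauHat A a b s t := by
  have h1 : a * b ≤ a := mul_le_of_le_one_right ha.le hb1
  have h2 : a * b ≤ b := mul_le_of_le_one_left hb.le ha1
  have h3 : A * (a * b) ≤ a * b := mul_le_of_le_one_left (by positivity) hA1
  exact le_blend (by linarith) (by linarith) (by linarith) le_rfl hs ht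

theorem tendsto_phase_atTop {k : ℝ} (hk : 0 < k) (η : ℝ) : Tendsto (phase k η) atTop atTop :=
  Real.tendsto_exp_atTop.comp
    ((tendsto_id.atTop_add tendsto_const_nhds).const_mul_atTop hk)

theorem tendsto_div_one_add {X : ℝ → ℝ} (hX : ∀ y, 0 < X y) (h : Tendsto X atTop atTop) :
    Tendsto (fun y => X y / (1 + X y)) atTop (nhds 1) := by
  have h1 : Tendsto (fun y => 1 - (1 + X y)⁻¹) atTop (nhds (1 - 0)) :=
    tendsto_const_nhds.sub (tendsto_inv_atTop_zero.comp (tendsto_atTop_add_const_left _ 1 h))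
  rw [sub_zero] at h1
  refine h1.congr fun y => ?_
  have := hX y
  field_simp
  ring

/-- A positive continuous function with positive limits at infinity is bounded below. -/
theorem exists_pos_forall_le {g : ℝ → ℝ} (hc : Continuous g) (hpos : ∀ y, 0 < g y) {l : ℝ}
    (hl : 0 < l) (hb : Tendsto g atBot (nhds l)) (ht : Tendsto g atTop (nhds l)) :
    ∃ c > 0, ∀ y, c ≤ g y := by
  obtain ⟨a, ha⟩ := eventually_atBot.1 (hb.eventually (lt_mem_nhds (half_lt_self hl)))
  obtain ⟨b, hb⟩ := eventually_atTop.1 (ht.eventually (lt_mem_nhds (half_lt_self hl)))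
  obtain ⟨z, -, hz⟩ := (isCompact_Icc (a := min a b) (b := b)).exists_isMinOn
    (nonempty_Icc.2 (min_le_right a b)) hc.continuousOn
  refine ⟨min (l / 2) (g z), lt_min (half_pos hl) (hpos z), fun y => ?_⟩
  rcases le_total y a with h | h
  · exact (min_le_left _ _).trans (ha y h).le
  rcases le_total b y with h' | h'
  · exact (min_le_left _ _).trans (hb y h').le
  · exact (min_le_right _ _).trans (hz ⟨(min_le_left a b).trans h, h'⟩)

/-- A bounded function with a nonnegative derivative has an integrable derivative. -/
theorem integrable_of_hasDerivAt_nonneg {g g' : ℝ → ℝ} {C : ℝ} (hg : ∀ x, HasDerivAt g (g' x) x)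
    (h0 : ∀ x, 0 ≤ g' x) (hC : ∀ x, |g x| ≤ C) : Integrable g' := by
  have mono : Monotone g := monotone_of_deriv_nonneg (fun x => (hg x).differentiableAt)
    fun x => by rw [(hg x).deriv]; exact h0 x
  have half : ∀ {f f' : ℝ → ℝ}, (∀ x, HasDerivAt f (f' x) x) → (∀ x, 0 ≤ f' x) → Monotone f →
      (∀ x, |f x| ≤ C) → IntegrableOn f' (Ioi 0) := fun {f f'} hf h0 hm hb =>
    integrableOn_Ioi_deriv_of_nonneg' (fun x _ => hf x) (fun x _ => h0 x)
      (tendsto_atTop_ciSup hm ⟨C, by rintro _ ⟨x, rfl⟩; exact (abs_le.1 (hb x)).2⟩)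
  have h1 := half hg h0 mono hC
  have h2 : IntegrableOn (fun x => g' (-x)) (Ioi 0) := by
    refine half (f := fun x => -g (-x)) (fun x => ?_) (fun x => h0 _)
      (fun x y h => neg_le_neg (mono (neg_le_neg h))) (fun x => by rw [abs_neg]; exact hC _)
    exact ((hg (-x)).comp x (hasDerivAt_neg x)).neg.congr_deriv (by ring)
  have h3 : IntegrableOn g' (Iic 0) := by
    rw [← integrableOn_Ici_iff_integrableOn_Ioi] at h2
    have := h2.comp_neg
    simpa using this
  rw [← integrableOn_univ, ← Iic_union_Ioi (a := (0 : ℝ))]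
  exact h3.union h1

namespace SolitonData

variable {κ k₁ k₂ A p q : ℝ}

theorem A_le_one (S : SolitonData κ k₁ k₂ A p q) : A ≤ 1 := by
  have h := S.hA
  have h1 : 0 < (k₁ + k₂) ^ 2 := pow_pos (add_pos S.k₁_pos S.k₂_pos) 2
  by_contra hc
  nlinarith [mul_pos S.k₁_pos S.k₂_pos, mul_pos (sub_pos.2 (not_le.1 hc)) h1]

theorem tauHat_bound₁ (S : SolitonData κ k₁ k₂ A p q) {s t : ℝ} (hs : s ∈ Icc 0 1)
    (ht : t ∈ Icc 0 1) : A * (1 * 1) ≤ tauHat A 1 1 s t :=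
  le_tauHat S.A_le_one one_pos le_rfl one_pos le_rfl hs ht

theorem tauHat_bound₂ (S : SolitonData κ k₁ k₂ A p q) {s t : ℝ} (hs : s ∈ Icc 0 1)
    (ht : t ∈ Icc 0 1) : A * (p * q) ≤ tauHat A p q s t :=
  le_tauHat S.A_le_one S.p_pos S.p_lt_one.le S.q_pos S.symm.p_lt_one.le hs ht

theorem bddDiff_inv_tauHat₁ (S : SolitonData κ k₁ k₂ A p q) {n : ℕ} {s t : ℝ → ℝ}
    (hs : BddDiff n s) (ht : BddDiff n t) (s01 : ∀ x, s x ∈ Icc (0 : ℝ) 1)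
    (t01 : ∀ x, t x ∈ Icc (0 : ℝ) 1) : BddDiff n fun x => (tauHat A 1 1 (s x) (t x))⁻¹ :=
  (hs.blend ht 1 1 1 (A * (1 * 1))).inv (by have := S.A_pos; positivity)
    fun x => S.tauHat_bound₁ (s01 x) (t01 x)

theorem bddDiff_inv_tauHat₂ (S : SolitonData κ k₁ k₂ A p q) {n : ℕ} {s t : ℝ → ℝ}
    (hs : BddDiff n s) (ht : BddDiff n t) (s01 : ∀ x, s x ∈ Icc (0 : ℝ) 1)
    (t01 : ∀ x, t x ∈ Icc (0 : ℝ) 1) : BddDiff n fun x => (tauHat A p q (s x) (t x))⁻¹ :=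
  (hs.blend ht 1 p q (A * (p * q))).inv
    (by have := S.A_pos; have := S.p_pos; have := S.q_pos; positivity)
    fun x => S.tauHat_bound₂ (s01 x) (t01 x)

theorem bddDiff_slopeHat (S : SolitonData κ k₁ k₂ A p q) {n : ℕ} {s t : ℝ → ℝ}
    (hs : BddDiff n s) (ht : BddDiff n t) (s01 : ∀ x, s x ∈ Icc (0 : ℝ) 1)
    (t01 : ∀ x, t x ∈ Icc (0 : ℝ) 1) : BddDiff n fun x => slopeHat κ k₁ k₂ A p q (s x) (t x) :=
  (bddDiff_const n κ⁻¹).add ((bddDiff_const n 2).mul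
    (((hs.blend ht _ _ _ _).mul (S.bddDiff_inv_tauHat₂ hs ht s01 t01)).sub
      ((hs.blend ht _ _ _ _).mul (S.bddDiff_inv_tauHat₁ hs ht s01 t01))))

/-- At the corner (1, 1) both logarithmic derivatives equal k₁ + k₂ and cancel. -/
theorem tendsto_slope_atTop (S : SolitonData κ k₁ k₂ A p q) (η₁ η₂ : ℝ) :
    Tendsto (slope κ k₁ k₂ A p q η₁ η₂) atTop (nhds κ⁻¹) := by
  have hX := tendsto_div_one_add (phase_pos k₁ η₁) (tendsto_phase_atTop S.k₁_pos η₁)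
  have hY := tendsto_div_one_add (phase_pos k₂ η₂) (tendsto_phase_atTop S.k₂_pos η₂)
  have hA := S.A_pos
  have hp := S.p_pos
  have hq := S.q_pos
  have c : ContinuousAt (fun r : ℝ × ℝ => slopeHat κ k₁ k₂ A p q r.1 r.2) (1, 1) := by
    have n1 : A * 1 ≠ 0 := by positivity
    have n2 : A * (p * q) ≠ 0 := by positivity
    unfold slopeHat tauDHat tauHat blend
    refine continuousAt_const.add (continuousAt_const.mul ((ContinuousAt.mul (by fun_prop)
      (ContinuousAt.inv₀ (by fun_prop) ?_)).sub (ContinuousAt.mul (by fun_prop)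
      (ContinuousAt.inv₀ (by fun_prop) ?_))))
    · simpa using n2
    · simpa using n1
  have h := c.tendsto.comp (hX.prodMk_nhds hY)
  have e : slopeHat κ k₁ k₂ A p q 1 1 = κ⁻¹ := by
    simp only [slopeHat, tauDHat, tauHat, blend]
    field_simp
    ring
  simp only [e] at h
  exact h.congr fun y => (slope_eq_slopeHat ..).symm

theorem exists_le_slope (S : SolitonData κ k₁ k₂ A p q) (η₁ η₂ : ℝ) :
    ∃ c > 0, ∀ y, c ≤ slope κ k₁ k₂ A p q η₁ η₂ y :=
  exists_pos_forall_le (S.contDiff_slope η₁ η₂).continuous (S.slope_pos η₁ η₂)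
    (inv_pos.2 S.κ_pos) (S.tendsto_slope_atBot η₁ η₂) (S.tendsto_slope_atTop η₁ η₂)

end SolitonData

/-! ### Decay of the translation modes -/

/-- The function `X / (1 + X)` for the exponential `X`. -/
def sat (k η y : ℝ) : ℝ := phase k η y / (1 + phase k η y)

theorem sat_mem (k η y : ℝ) : sat k η y ∈ Icc (0 : ℝ) 1 := div_one_add_mem (phase_pos ..)

theorem hasDerivAt_sat (k η y : ℝ) :
    HasDerivAt (sat k η) (k * (sat k η y * (1 - sat k η y))) y := by
  have := phase_pos k η y
  have h := hasDerivAt_phase k η y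
  refine (h.fun_div (h.const_add 1) (by positivity)).congr_deriv ?_
  rw [sat]
  field_simp

theorem BddSmooth.coefA {m : ℝ → ℝ} (hi : BddSmooth fun x => (m x)⁻¹) : BddSmooth (coefA m) :=
  hi.zpow_neg 7

theorem BddSmooth.coefB {m : ℝ → ℝ} (hm : BddSmooth m) (hi : BddSmooth fun x => (m x)⁻¹) (l₂ : ℝ) :
    BddSmooth (coefB l₂ m) :=
  (((((hi.zpow_neg 9).const_mul 42).mul (hm.deriv.pow 2)).sub
    (((hi.zpow_neg 8).const_mul 14).mul hm.deriv.deriv)).sub ((hi.zpow_neg 7).const_mul (5 / 2))).sub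
    ((hi.zpow_neg 5).const_mul (2 * l₂))

theorem BddSmooth.coefC {m : ℝ → ℝ} (hm : BddSmooth m) (hi : BddSmooth fun x => (m x)⁻¹)
    (l₁ l₂ : ℝ) : BddSmooth (coefC l₁ l₂ m) := by
  have z := hi.zpow_neg
  have d := hm.deriv
  have dd := d.deriv
  have hq : BddSmooth (qPot l₂ m) :=
    (((((((((z 9).const_mul 28).mul (dd.pow 2)).add (((z 9).const_mul 70).mul (d.pow 2))).sub
      ((z 7).deriv.deriv.const_mul (5 / 2))).sub (((z 11).const_mul 315).mul (d.pow 4))).sub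
      (((z 10).mul (d.pow 3)).deriv.const_mul 126)).sub
      (((z 8).mul dd).deriv.deriv.const_mul 7)).add
      (((z 7).const_mul (30 * l₂)).mul (d.pow 2))).sub ((z 5).deriv.deriv.const_mul (2 * l₂))
  exact ((((z 7).const_mul (15 / 8)).add ((z 3).const_mul (2 * l₁))).add
    ((z 5).const_mul (3 * l₂))).add hq

/-- The factor of a translation mode that stays bounded. -/
def modeHat (A p q t : ℝ) : ℝ :=
  p * (1 - t + A * q * t) - (1 - t + q * t) * (1 - t + A * t)

/-- Only the first exponential varies with the first phase, hence the wave number 0 for the second.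
The factor s(1 - s) carries the decay of the first mode at both ends. -/
theorem tauHat_wronskian (k A p q s t : ℝ) :
    tauDHat k 0 A p q s t * tauHat A 1 1 s t - tauHat A p q s t * tauDHat k 0 A 1 1 s t =
      k * (s * (1 - s)) * modeHat A p q t := by
  simp only [tauDHat, tauHat, blend, modeHat]
  ring

namespace SolitonData

variable {κ k₁ k₂ A p q : ℝ}

theorem tauHat_pos₁ (S : SolitonData κ k₁ k₂ A p q) {s t : ℝ} (hs : s ∈ Icc 0 1)
    (ht : t ∈ Icc 0 1) : 0 < tauHat A 1 1 s t :=
  (by have := S.A_pos; positivity : (0 : ℝ) < A * (1 * 1)).trans_le (S.tauHat_bound₁ hs ht)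

theorem tauHat_pos₂ (S : SolitonData κ k₁ k₂ A p q) {s t : ℝ} (hs : s ∈ Icc 0 1)
    (ht : t ∈ Icc 0 1) : 0 < tauHat A p q s t :=
  (by have := S.A_pos; have := S.p_pos; have := S.q_pos; positivity :
    (0 : ℝ) < A * (p * q)).trans_le (S.tauHat_bound₂ hs ht)

theorem profile_inv_eq (κ k₁ k₂ A p q η₂ a d η₁ : ℝ) :
    (fun x => (profile κ k₁ k₂ A p q η₂ a d η₁ x)⁻¹) = fun x => slopeHat κ k₁ k₂ A p q
      (sat k₁ η₁ (recipInv κ k₁ k₂ A p q η₂ a d η₁ x))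
      (sat k₂ η₂ (recipInv κ k₁ k₂ A p q η₂ a d η₁ x)) :=
  funext fun x => by rw [profile, inv_inv, slope_eq_slopeHat]; rfl

theorem hasDerivAt_sat_recipInv (S : SolitonData κ k₁ k₂ A p q) (η₂ a d η₁ k η x : ℝ) :
    HasDerivAt (fun x => sat k η (recipInv κ k₁ k₂ A p q η₂ a d η₁ x))
      (k * (sat k η (recipInv κ k₁ k₂ A p q η₂ a d η₁ x)
        * (1 - sat k η (recipInv κ k₁ k₂ A p q η₂ a d η₁ x)))
        * profile κ k₁ k₂ A p q η₂ a d η₁ x) x :=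
  (hasDerivAt_sat k η _).comp x (S.hasDerivAt_recipInv η₂ a d η₁ x)

theorem bddDiff_profile (S : SolitonData κ k₁ k₂ A p q) (η₂ a d η₁ : ℝ) {n : ℕ}
    (h₁ : BddDiff n fun x => sat k₁ η₁ (recipInv κ k₁ k₂ A p q η₂ a d η₁ x))
    (h₂ : BddDiff n fun x => sat k₂ η₂ (recipInv κ k₁ k₂ A p q η₂ a d η₁ x)) :
    BddDiff n (fun x => (profile κ k₁ k₂ A p q η₂ a d η₁ x)⁻¹) ∧
      BddDiff n (profile κ k₁ k₂ A p q η₂ a d η₁) := by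
  have h : BddDiff n (fun x => (profile κ k₁ k₂ A p q η₂ a d η₁ x)⁻¹) := by
    rw [profile_inv_eq]
    exact S.bddDiff_slopeHat h₁ h₂ (fun x => sat_mem ..) (fun x => sat_mem ..)
  obtain ⟨c, hc, hle⟩ := S.exists_le_slope η₁ η₂
  have h' := h.inv hc fun x => by rw [profile, inv_inv]; exact hle _
  simp only [inv_inv] at h'
  exact ⟨h, h'⟩

/-- A bootstrap. The x-derivative of σ = e^ξ/(1 + e^ξ) is k σ(1 - σ) m, and m is a smooth function
of the two such σ, so n bounded derivatives of these yield n for m and then n + 1 for them. -/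
theorem bddDiff_sat (S : SolitonData κ k₁ k₂ A p q) (η₂ a d η₁ : ℝ) (n : ℕ) :
    BddDiff n (fun x => sat k₁ η₁ (recipInv κ k₁ k₂ A p q η₂ a d η₁ x)) ∧
      BddDiff n fun x => sat k₂ η₂ (recipInv κ k₁ k₂ A p q η₂ a d η₁ x) := by
  have bdd : ∀ k η, ∃ C, ∀ x, |sat k η (recipInv κ k₁ k₂ A p q η₂ a d η₁ x)| ≤ C := fun k η =>
    ⟨1, fun x => abs_le.2 ⟨by linarith [(sat_mem k η (recipInv κ k₁ k₂ A p q η₂ a d η₁ x)).1],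
      (sat_mem ..).2⟩⟩
  induction n with
  | zero => exact ⟨bdd k₁ η₁, bdd k₂ η₂⟩
  | succ n ih =>
    have hm := (S.bddDiff_profile η₂ a d η₁ ih.1 ih.2).2
    have step : ∀ k η, BddDiff n (fun x => sat k η (recipInv κ k₁ k₂ A p q η₂ a d η₁ x)) →
        BddDiff (n + 1) fun x => sat k η (recipInv κ k₁ k₂ A p q η₂ a d η₁ x) := fun k η h => by
      have D := S.hasDerivAt_sat_recipInv η₂ a d η₁ k η
      refine ⟨bdd k η, fun x => (D x).differentiableAt, ?_⟩
      rw [funext fun x => (D x).deriv]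
      exact ((bddDiff_const n k).mul (h.mul ((bddDiff_const n 1).sub h))).mul hm
    exact ⟨step k₁ η₁ ih.1, step k₂ η₂ ih.2⟩

theorem bddSmooth_sat₁ (S : SolitonData κ k₁ k₂ A p q) (η₂ a d η₁ : ℝ) :
    BddSmooth fun x => sat k₁ η₁ (recipInv κ k₁ k₂ A p q η₂ a d η₁ x) :=
  fun n => (S.bddDiff_sat η₂ a d η₁ n).1

theorem bddSmooth_sat₂ (S : SolitonData κ k₁ k₂ A p q) (η₂ a d η₁ : ℝ) :
    BddSmooth fun x => sat k₂ η₂ (recipInv κ k₁ k₂ A p q η₂ a d η₁ x) :=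
  fun n => (S.bddDiff_sat η₂ a d η₁ n).2

theorem bddSmooth_profile (S : SolitonData κ k₁ k₂ A p q) (η₂ a d η₁ : ℝ) :
    BddSmooth (profile κ k₁ k₂ A p q η₂ a d η₁) :=
  fun n => (S.bddDiff_profile η₂ a d η₁ (S.bddSmooth_sat₁ _ _ _ _ n) (S.bddSmooth_sat₂ _ _ _ _ n)).2

theorem bddSmooth_inv_profile (S : SolitonData κ k₁ k₂ A p q) (η₂ a d η₁ : ℝ) :
    BddSmooth fun x => (profile κ k₁ k₂ A p q η₂ a d η₁ x)⁻¹ :=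
  fun n => (S.bddDiff_profile η₂ a d η₁ (S.bddSmooth_sat₁ _ _ _ _ n) (S.bddSmooth_sat₂ _ _ _ _ n)).1

/-- The derivative of the reciprocal transformation in the first phase. -/
theorem pderiv₁_recip (S : SolitonData κ k₁ k₂ A p q) (η₂ a d η₁ y : ℝ) :
    pderiv₁ (recip κ k₁ k₂ A p q η₂ a d) η₁ y =
      sat k₁ η₁ y * (1 - sat k₁ η₁ y) * (2 * k₁ * modeHat A p q (sat k₂ η₂ y)
        * ((tauHat A p q (sat k₁ η₁ y) (sat k₂ η₂ y))⁻¹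
          * (tauHat A 1 1 (sat k₁ η₁ y) (sat k₂ η₂ y))⁻¹)) := by
  have hX : HasDerivAt (fun s => phase k₁ s y) (k₁ * phase k₁ η₁ y) η₁ := by
    have := hasDerivAt_phase k₁ y η₁
    have e : (fun s => phase k₁ s y) = phase k₁ y := funext fun s => by rw [phase, phase, add_comm]
    rw [e, phase, add_comm]
    exact this
  have hY : HasDerivAt (fun _ => phase k₂ η₂ y) (0 * phase k₂ η₂ y) η₁ := by
    rw [zero_mul]
    exact hasDerivAt_const η₁ _
  have hf := (S.tauLine_pos₁ η₁ η₂ y).ne'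
  have hg := (S.tauLine_pos₂ η₁ η₂ y).ne'
  have D : HasDerivAt (fun s => recip κ k₁ k₂ A p q η₂ a d s y)
      (2 * (tauD k₁ 0 A p q 1 (phase k₁ η₁ y) (phase k₂ η₂ y) / tauLine k₁ k₂ A p q η₁ η₂ y
        - tauD k₁ 0 A 1 1 1 (phase k₁ η₁ y) (phase k₂ η₂ y) / tauLine k₁ k₂ A 1 1 η₁ η₂ y)) η₁ := by
    refine (((((hasDerivAt_tau hX hY A p q).fun_div (hasDerivAt_tau hX hY A 1 1) hf).log
      (div_ne_zero hg hf)).const_mul 2).const_add (y / κ + a)).add_const d |>.congr_deriv ?_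
    simp only [tauLine] at hf hg ⊢
    field_simp
  refine D.deriv.trans ?_
  simp only [tauLine]
  rw [tauD_div_tau k₁ 0 A p q (phase_pos ..) (phase_pos ..),
    tauD_div_tau k₁ 0 A 1 1 (phase_pos ..) (phase_pos ..)]
  change 2 * (tauDHat k₁ 0 A p q (sat k₁ η₁ y) (sat k₂ η₂ y) / tauHat A p q (sat k₁ η₁ y) (sat k₂ η₂ y)
    - tauDHat k₁ 0 A 1 1 (sat k₁ η₁ y) (sat k₂ η₂ y) / tauHat A 1 1 (sat k₁ η₁ y) (sat k₂ η₂ y)) = _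
  have h1 := (S.tauHat_pos₁ (sat_mem k₁ η₁ y) (sat_mem k₂ η₂ y)).ne'
  have h2 := (S.tauHat_pos₂ (sat_mem k₁ η₁ y) (sat_mem k₂ η₂ y)).ne'
  rw [div_sub_div _ _ h2 h1, tauHat_wronskian]
  field_simp

/-- Implicit differentiation of x(η₁, y(η₁, x)) = x in the phase. -/
theorem pderiv₁_recipInv (S : SolitonData κ k₁ k₂ A p q) (η₂ a d η₁ x : ℝ) :
    pderiv₁ (recipInv κ k₁ k₂ A p q η₂ a d) η₁ x =
      -(pderiv₁ (recip κ k₁ k₂ A p q η₂ a d) η₁ (recipInv κ k₁ k₂ A p q η₂ a d η₁ x)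
        * profile κ k₁ k₂ A p q η₂ a d η₁ x) := by
  have h := (S.jointSmooth_recip η₂ a d).hasDerivAt_comp (hasDerivAt_id η₁)
    ((S.jointSmooth_recipInv η₂ a d).hasDerivAt₁ η₁ x)
  have e : (fun r => recip κ k₁ k₂ A p q η₂ a d (id r) (recipInv κ k₁ k₂ A p q η₂ a d r x)) =
      fun _ => x := funext fun r => S.recip_recipInv η₂ a d r x
  rw [e] at h
  have h0 := h.unique (hasDerivAt_const η₁ x)
  rw [S.pderiv₂_recip, id, one_mul] at h0
  have hs := (S.slope_pos η₁ η₂ (recipInv κ k₁ k₂ A p q η₂ a d η₁ x)).ne'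
  rw [profile]
  field_simp
  linear_combination h0

/-- The translation mode and its derivatives are products of a fixed square integrable function
and bounded functions. -/
theorem exists_iteratedDeriv_pderiv₁ (S : SolitonData κ k₁ k₂ A p q) (η₂ a d η₁ : ℝ) :
    ∃ ρ : ℝ → ℝ, MemLp ρ 2 volume ∧
      (∃ φ, BddSmooth φ ∧ pderiv₁ (recipInv κ k₁ k₂ A p q η₂ a d) η₁ = fun x => ρ x * φ x) ∧
      ∀ n, ∃ φ, BddSmooth φ ∧ iteratedDeriv n (pderiv₁ (profile κ k₁ k₂ A p q η₂ a d) η₁) =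
        fun x => ρ x * φ x := by
  set s := fun x => sat k₁ η₁ (recipInv κ k₁ k₂ A p q η₂ a d η₁ x) with hs
  set t := fun x => sat k₂ η₂ (recipInv κ k₁ k₂ A p q η₂ a d η₁ x) with ht
  set m := profile κ k₁ k₂ A p q η₂ a d η₁ with hm
  have bs : BddSmooth s := S.bddSmooth_sat₁ η₂ a d η₁
  have bt : BddSmooth t := S.bddSmooth_sat₂ η₂ a d η₁
  have bm : BddSmooth m := S.bddSmooth_profile η₂ a d η₁
  have bi : BddSmooth fun x => (m x)⁻¹ := S.bddSmooth_inv_profile η₂ a d η₁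
  have s01 : ∀ x, s x ∈ Icc (0 : ℝ) 1 := fun x => sat_mem ..
  have t01 : ∀ x, t x ∈ Icc (0 : ℝ) 1 := fun x => sat_mem ..
  have ds : ∀ x, HasDerivAt s (k₁ * (s x * (1 - s x)) * m x) x :=
    S.hasDerivAt_sat_recipInv η₂ a d η₁ k₁ η₁
  have hρ0 : ∀ x, 0 ≤ s x * (1 - s x) := fun x => mul_nonneg (s01 x).1 (sub_nonneg.2 (s01 x).2)
  have bρ : BddSmooth fun x => s x * (1 - s x) := bs.mul ((BddSmooth.const 1).sub bs)
  have hk := S.k₁_pos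
  have mpos : ∀ x, 0 < m x := S.profile_pos η₂ a d η₁
  -- This is s', the derivative of a bounded nondecreasing function. Since m is bounded below, (s(1
  -- - s))² is a bounded multiple of s'.
  have int : Integrable fun x => k₁ * (s x * (1 - s x)) * m x :=
    integrable_of_hasDerivAt_nonneg (C := 1) ds
      (fun x => mul_nonneg (mul_nonneg hk.le (hρ0 x)) (mpos x).le)
      (fun x => abs_le.2 ⟨by linarith [(s01 x).1], (s01 x).2⟩)
  have memρ : MemLp (fun x => s x * (1 - s x)) 2 volume := by
    rw [memLp_two_iff_integrable_sq bρ.continuous.aestronglyMeasurable]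
    have bq : BddSmooth fun x => k₁⁻¹ * (m x)⁻¹ * (s x * (1 - s x)) := (bi.const_mul k₁⁻¹).mul bρ
    obtain ⟨C, hC⟩ := bq.bdd
    refine (int.bdd_mul (c := C) bq.continuous.aestronglyMeasurable
      (Eventually.of_forall hC)).congr (Eventually.of_forall fun x => ?_)
    have := (mpos x).ne'
    field_simp
  have hχ : BddSmooth fun x => (1 - 2 * s x) * (k₁ * m x) :=
    ((BddSmooth.const 1).sub (bs.const_mul 2)).mul (bm.const_mul k₁)
  have dρ : ∀ x, HasDerivAt (fun x => s x * (1 - s x))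
      (s x * (1 - s x) * ((1 - 2 * s x) * (k₁ * m x))) x := fun x =>
    ((ds x).mul ((ds x).const_sub 1)).congr_deriv (by ring)
  have bmode : BddSmooth fun x => modeHat A p q (t x) := by
    have c := BddSmooth.const
    exact ((c p).mul (((c 1).sub bt).add (bt.const_mul (A * q)))).sub
      ((((c 1).sub bt).add (bt.const_mul q)).mul (((c 1).sub bt).add (bt.const_mul A)))
  set φ₀ : ℝ → ℝ := fun x => -((2 * k₁ * modeHat A p q (t x) * ((tauHat A p q (s x) (t x))⁻¹
    * (tauHat A 1 1 (s x) (t x))⁻¹)) * m x) with hφ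
  have bφ : BddSmooth φ₀ := BddSmooth.neg (((bmode.const_mul (2 * k₁)).mul
    (BddSmooth.mul (fun n => S.bddDiff_inv_tauHat₂ (bs n) (bt n) s01 t01)
      fun n => S.bddDiff_inv_tauHat₁ (bs n) (bt n) s01 t01)).mul bm)
  have e0 : pderiv₁ (recipInv κ k₁ k₂ A p q η₂ a d) η₁ = fun x => s x * (1 - s x) * φ₀ x :=
    funext fun x => by
      rw [S.pderiv₁_recipInv, S.pderiv₁_recip]
      simp only [hφ, hs, ht, hm]
      ring
  -- From m = y_x: the phase derivative of m is the x-derivative of the phase derivative of y.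
  have e1 : pderiv₁ (profile κ k₁ k₂ A p q η₂ a d) η₁ =
      deriv (pderiv₁ (recipInv κ k₁ k₂ A p q η₂ a d) η₁) := by
    rw [← S.pderiv₂_recipInv, (S.jointSmooth_recipInv η₂ a d).pderiv_comm]
    rfl
  refine ⟨_, memρ, ⟨φ₀, bφ, e0⟩, fun n => ?_⟩
  induction n with
  | zero =>
    obtain ⟨φ', b, hd⟩ := exists_deriv_eq_mul hχ dρ bφ
    refine ⟨φ', b, ?_⟩
    rw [iteratedDeriv_zero, e1, e0]
    exact funext fun x => (hd x).deriv
  | succ n ih =>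
    obtain ⟨φ, b, h⟩ := ih
    obtain ⟨φ', b', hd⟩ := exists_deriv_eq_mul hχ dρ b
    refine ⟨φ', b', ?_⟩
    rw [iteratedDeriv_succ, h]
    exact funext fun x => (hd x).deriv

/-- The translation mode is a classical square integrable solution. -/
theorem isL2Solution_pderiv₁ (S : SolitonData κ k₁ k₂ A p q) (η₂ a d η₁ : ℝ) :
    let M := profile κ k₁ k₂ A p q η₂ a d
    IsL2Solution (coefA (M η₁)) (coefB (mult₂ κ k₁ k₂) (M η₁))
      (coefC (mult₁ κ k₁ k₂) (mult₂ κ k₁ k₂) (M η₁)) (pderiv₁ M η₁) where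
  contDiff := mod_cast contDiff_infty.1
    ((S.jointSmooth_profile η₂ a d).jointSmooth₁.contDiff_right η₁) 4
  eq_zero := S.divForm_pderiv₁_profile η₂ a d η₁
  memLp n _ := by
    obtain ⟨ρ, hρ, -, h⟩ := S.exists_iteratedDeriv_pderiv₁ η₂ a d η₁
    obtain ⟨φ, hφ, e⟩ := h n
    rw [e]
    exact memLp_mul_bdd hρ hφ

end SolitonData

/-! ### The kernel for the two-soliton -/

theorem tauHat_swap (A a b s t : ℝ) : tauHat A a b s t = tauHat A b a t s := by
  simp only [tauHat, blend]
  ring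

/-- The transformation is symmetric in the two solitons, so statements about the second phase follow
from those about the first. -/
theorem recip_swap (κ k₁ k₂ A p q η₂ a d η₁ : ℝ) :
    recip κ k₁ k₂ A p q η₂ a d η₁ = recip κ k₂ k₁ A q p η₁ a d η₂ := by
  funext y
  simp only [recip, tauLine]
  rw [tau_swap A p q, tau_swap A 1 1]

theorem recipInv_swap (κ k₁ k₂ A p q η₂ a d η₁ : ℝ) :
    recipInv κ k₁ k₂ A p q η₂ a d η₁ = recipInv κ k₂ k₁ A q p η₁ a d η₂ := by
  funext x
  rw [recipInv, recip_swap, recipInv]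

theorem profile_swap (κ k₁ k₂ A p q η₂ a d η₁ : ℝ) :
    profile κ k₁ k₂ A p q η₂ a d η₁ = profile κ k₂ k₁ A q p η₁ a d η₂ := by
  funext x
  simp only [profile, slope, tauLine, tauLineD]
  rw [recipInv_swap, tau_swap A p q, tau_swap A 1 1, tauD_swap k₁ k₂ A p q, tauD_swap k₁ k₂ A 1 1]

theorem mult₁_swap (κ k₁ k₂ : ℝ) : mult₁ κ k₁ k₂ = mult₁ κ k₂ k₁ := by
  simp only [mult₁]
  ring

theorem mult₂_swap (κ k₁ k₂ : ℝ) : mult₂ κ k₁ k₂ = mult₂ κ k₂ k₁ := by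
  simp only [mult₂]
  ring

theorem tendsto_sat_atBot {k : ℝ} (hk : 0 < k) (η : ℝ) : Tendsto (sat k η) atBot (nhds 0) := by
  have h := tendsto_phase_atBot hk η
  have := h.div (h.const_add 1) (by norm_num)
  rwa [zero_div] at this

theorem tendsto_sat_div_sat_atBot {k₁ k₂ : ℝ} (hk₁ : 0 < k₁) (hk₂ : 0 < k₂) (h : k₂ < k₁)
    (η₁ η₂ : ℝ) : Tendsto (fun y => sat k₁ η₁ y / sat k₂ η₂ y) atBot (nhds 0) := by
  have hX := tendsto_phase_atBot hk₁ η₁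
  have hY := tendsto_phase_atBot hk₂ η₂
  have hk := sub_pos.2 h
  have h1 := (tendsto_phase_atBot hk ((k₁ * η₁ - k₂ * η₂) / (k₁ - k₂))).mul
    ((hY.const_add 1).div (hX.const_add 1) (by norm_num))
  rw [zero_mul] at h1
  refine h1.congr fun y => ?_
  have e : phase (k₁ - k₂) ((k₁ * η₁ - k₂ * η₂) / (k₁ - k₂)) y = phase k₁ η₁ y / phase k₂ η₂ y := by
    rw [phase, phase, phase, ← Real.exp_sub]
    congr 1
    field_simp
    ring
  have hX0 := phase_pos k₁ η₁ y
  have hY0 := phase_pos k₂ η₂ y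
  rw [e, Pi.div_apply, sat, sat]
  field_simp

theorem continuous_modeHat (A p q : ℝ) : Continuous (modeHat A p q) := by
  unfold modeHat
  fun_prop

theorem sat_pos (k η y : ℝ) : 0 < sat k η y := div_pos (phase_pos ..) (by linarith [phase_pos k η y])

theorem one_sub_sat_pos (k η y : ℝ) : 0 < 1 - sat k η y := by
  have := phase_pos k η y
  rw [sub_pos, sat, div_lt_one (by linarith)]
  linarith

namespace SolitonData

variable {κ k₁ k₂ A p q : ℝ}

/-- As y → -∞ the exponential with the larger wave number is negligible. Division by the slower one
leaves β(q - 1) = 0 in the limit; then the first term alone gives α(p - 1) = 0. -/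
theorem eq_zero_of_lt (S : SolitonData κ k₁ k₂ A p q) (h : k₂ < k₁) (η₁ η₂ : ℝ) {α β : ℝ}
    (H : ∀ y, α * (sat k₁ η₁ y * (1 - sat k₁ η₁ y) * modeHat A p q (sat k₂ η₂ y))
      + β * (sat k₂ η₂ y * (1 - sat k₂ η₂ y) * modeHat A q p (sat k₁ η₁ y)) = 0) :
    α = 0 ∧ β = 0 := by
  have s0 := tendsto_sat_atBot S.k₁_pos η₁
  have t0 := tendsto_sat_atBot S.k₂_pos η₂
  have r0 := tendsto_sat_div_sat_atBot S.k₁_pos S.k₂_pos h η₁ η₂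
  have m1 := ((continuous_modeHat A p q).tendsto 0).comp t0
  have m2 := ((continuous_modeHat A q p).tendsto 0).comp s0
  have lim := (((r0.mul (s0.const_sub 1)).mul m1).const_mul α).add
    (((t0.const_sub 1).mul m2).const_mul β)
  have hβ : β = 0 := by
    have e : ∀ y, α * (sat k₁ η₁ y / sat k₂ η₂ y * (1 - sat k₁ η₁ y) * modeHat A p q (sat k₂ η₂ y))
        + β * ((1 - sat k₂ η₂ y) * modeHat A q p (sat k₁ η₁ y)) = 0 := fun y => by
      have ht := (sat_pos k₂ η₂ y).ne'
      field_simp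
      linear_combination H y
    have := tendsto_nhds_unique tendsto_const_nhds (lim.congr e)
    have hq := S.symm.p_lt_one
    have h2 : β * (q - 1) = 0 := by
      simp only [modeHat] at this
      linear_combination -this
    exact (mul_eq_zero.1 h2).resolve_right (by linarith)
  refine ⟨?_, hβ⟩
  have e : ∀ y, α * modeHat A p q (sat k₂ η₂ y) = 0 := fun y => by
    have hs := (mul_pos (sat_pos k₁ η₁ y) (one_sub_sat_pos k₁ η₁ y)).ne'
    have := H y
    rw [hβ] at this
    refine mul_left_cancel₀ hs ?_
    linear_combination this
  have := tendsto_nhds_unique tendsto_const_nhds ((m1.const_mul α).congr e)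
  have hp := S.p_lt_one
  have h2 : α * (p - 1) = 0 := by
    simp only [modeHat] at this
    linear_combination -this
  exact (mul_eq_zero.1 h2).resolve_right (by linarith)

/-- The translation modes are linearly independent. -/
theorem eq_zero_of_pderiv₁_profile (S : SolitonData κ k₁ k₂ A p q) (η₁ η₂ a d : ℝ) {α β : ℝ}
    (H : ∀ x, α * pderiv₁ (profile κ k₁ k₂ A p q η₂ a d) η₁ x
      + β * pderiv₁ (profile κ k₂ k₁ A q p η₁ a d) η₂ x = 0) : α = 0 ∧ β = 0 := by
  have D : ∀ {k₁ k₂ p q : ℝ}, SolitonData κ k₁ k₂ A p q → ∀ η₂ η₁ x,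
      HasDerivAt (pderiv₁ (recipInv κ k₁ k₂ A p q η₂ a d) η₁)
        (pderiv₁ (profile κ k₁ k₂ A p q η₂ a d) η₁ x) x := fun {k₁ k₂ p q} S η₂ η₁ x => by
    rw [← S.pderiv₂_recipInv, (S.jointSmooth_recipInv η₂ a d).pderiv_comm]
    exact (S.jointSmooth_recipInv η₂ a d).jointSmooth₁.hasDerivAt₂ η₁ x
  have M : ∀ {k₁ k₂ p q : ℝ}, SolitonData κ k₁ k₂ A p q → ∀ η₂ η₁,
      MemLp (pderiv₁ (recipInv κ k₁ k₂ A p q η₂ a d) η₁) 2 volume := fun {k₁ k₂ p q} S η₂ η₁ => by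
    obtain ⟨ρ, hρ, ⟨φ, hφ, e⟩, -⟩ := S.exists_iteratedDeriv_pderiv₁ η₂ a d η₁
    rw [e]
    exact memLp_mul_bdd hρ hφ
  -- The corresponding combination of phase derivatives of y has x-derivative zero by hypothesis,
  -- and it is square integrable, so it vanishes identically.
  set g := fun x => α * pderiv₁ (recipInv κ k₁ k₂ A p q η₂ a d) η₁ x
    + β * pderiv₁ (recipInv κ k₂ k₁ A q p η₁ a d) η₂ x with hg
  have dg : ∀ x, HasDerivAt g 0 x := fun x =>
    (((D S η₂ η₁ x).const_mul α).add ((D S.symm η₁ η₂ x).const_mul β)).congr_deriv (H x)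
  have gc : ∀ x, g x = g 0 := fun x =>
    is_const_of_deriv_eq_zero (fun x => (dg x).differentiableAt) (fun x => (dg x).deriv) x 0
  have Mg : MemLp g 2 volume := ((M S η₂ η₁).const_mul α).add ((M S.symm η₁ η₂).const_mul β)
  have g0 : g 0 = 0 := by
    rw [funext gc, memLp_const_iff (by norm_num) (by norm_num)] at Mg
    simpa using Mg
  -- Evaluation at x = x(y) removes the inverse function, and the common nonzero factors of the two
  -- terms cancel.
  have key : ∀ y, α * (k₁ * (sat k₁ η₁ y * (1 - sat k₁ η₁ y) * modeHat A p q (sat k₂ η₂ y)))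
      + β * (k₂ * (sat k₂ η₂ y * (1 - sat k₂ η₂ y) * modeHat A q p (sat k₁ η₁ y))) = 0 := fun y => by
    have h := (gc (recip κ k₁ k₂ A p q η₂ a d η₁ y)).trans g0
    simp only [hg] at h
    rw [S.pderiv₁_recipInv, S.symm.pderiv₁_recipInv, recipInv_swap κ k₂ k₁,
      profile_swap κ k₂ k₁,
      S.recipInv_recip, S.pderiv₁_recip, S.symm.pderiv₁_recip, tauHat_swap A q p,
      tauHat_swap A 1 1 (sat k₂ η₂ y)] at h
    have h1 := (S.tauHat_pos₁ (sat_mem k₁ η₁ y) (sat_mem k₂ η₂ y)).ne'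
    have h2 := (S.tauHat_pos₂ (sat_mem k₁ η₁ y) (sat_mem k₂ η₂ y)).ne'
    have h3 := (S.profile_pos η₂ a d η₁ (recip κ k₁ k₂ A p q η₂ a d η₁ y)).ne'
    refine mul_left_cancel₀ (mul_ne_zero (mul_ne_zero two_ne_zero h3)
      (mul_ne_zero (inv_ne_zero h1) (inv_ne_zero h2))) ?_
    linear_combination -h
  have hk₁ := S.k₁_pos.ne'
  have hk₂ := S.k₂_pos.ne'
  rcases lt_or_gt_of_ne S.ne with hlt | hlt
  · obtain ⟨h1, h2⟩ := S.symm.eq_zero_of_lt hlt η₂ η₁ (α := β * k₂) (β := α * k₁)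
      fun y => by linear_combination key y
    exact ⟨(mul_eq_zero.1 h2).resolve_right hk₁, (mul_eq_zero.1 h1).resolve_right hk₂⟩
  · obtain ⟨h1, h2⟩ := S.eq_zero_of_lt hlt η₁ η₂ (α := α * k₁) (β := β * k₂)
      fun y => by linear_combination key y
    exact ⟨(mul_eq_zero.1 h1).resolve_right hk₁, (mul_eq_zero.1 h2).resolve_right hk₂⟩

theorem ker_eq_span (S : SolitonData κ k₁ k₂ A p q) (η₁ η₂ a d : ℝ) :
    let m := profile κ k₁ k₂ A p q η₂ a d η₁
    ∃ (h₁ : MemLp (pderiv₁ (profile κ k₁ k₂ A p q η₂ a d) η₁) 2 volume)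
      (h₂ : MemLp (pderiv₁ (profile κ k₂ k₁ A q p η₁ a d) η₂) 2 volume),
      LinearIndependent ℝ ![h₁.toLp, h₂.toLp] ∧
      {h : Lp ℝ 2 (volume : Measure ℝ) | MemH 4 h ∧
        opL (mult₁ κ k₁ k₂) (mult₂ κ k₁ k₂) m h =ᵐ[volume] 0} =
        (Submodule.span ℝ {h₁.toLp, h₂.toLp} : Set (Lp ℝ 2 (volume : Measure ℝ))) := by
  have bm := S.bddSmooth_profile η₂ a d η₁
  have bi := S.bddSmooth_inv_profile η₂ a d η₁
  have pos := S.profile_pos η₂ a d η₁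
  have K₂ := S.symm.isL2Solution_pderiv₁ η₁ a d η₂
  simp only [profile_swap κ k₂ k₁, mult₁_swap κ k₂ k₁, mult₂_swap κ k₂ k₁] at K₂
  refine ker_opL_eq_span bi.coefA (BddSmooth.coefB bm bi _) (BddSmooth.coefC bm bi _ _) ?_
    (fun x => zpow_ne_zero _ (pos x).ne') (S.isL2Solution_pderiv₁ η₂ a d η₁) ?_
    fun α β => S.eq_zero_of_pderiv₁_profile η₁ η₂ a d
  · have : (fun x => (coefA (profile κ k₁ k₂ A p q η₂ a d η₁) x)⁻¹) =
        fun x => profile κ k₁ k₂ A p q η₂ a d η₁ x ^ 7 := funext fun x => by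
      rw [coefA, zpow_neg, inv_inv]
      rfl
    rw [this]
    exact bm.pow 7
  · exact K₂

end SolitonData

/-! ### The parameters of the two-soliton -/

theorem mul_waveNumber_sq {κ c : ℝ} (hκ : 0 < κ) (hc : 3 * κ ^ 2 < c) :
    (κ * waveNumber κ c) ^ 2 = 1 - 2 * κ ^ 2 / (c - κ ^ 2) := by
  have h1 : 0 < κ ^ 2 := by positivity
  have h2 : 0 < c - κ ^ 2 := by linarith
  rw [waveNumber, mul_div_cancel₀ _ hκ.ne', Real.sq_sqrt (div_nonneg (by linarith) h2.le)]
  field_simp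
  ring

theorem waveNumber_pos {κ c : ℝ} (hκ : 0 < κ) (hc : 3 * κ ^ 2 < c) : 0 < waveNumber κ c := by
  have h1 : 0 < κ ^ 2 := by positivity
  exact div_pos (Real.sqrt_pos.2 (div_pos (by linarith) (by linarith))) hκ

/-- The threshold c = 9κ² corresponds exactly to κk = √3/2 = sin(π/3). -/
theorem four_mul_waveNumber_lt {κ c : ℝ} (hκ : 0 < κ) (hc : 3 * κ ^ 2 < c) (hc' : c < 9 * κ ^ 2) :
    4 * (κ * waveNumber κ c) ^ 2 < 3 := by
  have h1 : 0 < κ ^ 2 := by positivity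
  have h2 : 0 < c - κ ^ 2 := by linarith
  have h3 : 1 / 4 < 2 * κ ^ 2 / (c - κ ^ 2) := by
    rw [lt_div_iff₀ h2]
    linarith
  rw [mul_waveNumber_sq hκ hc]
  linarith

theorem expNegPsi_mul {κ c : ℝ} (hκ : 0 < κ) (hc : 3 * κ ^ 2 < c) :
    expNegPsi κ c * (1 + κ * waveNumber κ c) = 1 - κ * waveNumber κ c := by
  have := mul_pos hκ (waveNumber_pos hκ hc)
  exact div_mul_cancel₀ _ (by linarith)

theorem solitonData {κ c₁ c₂ : ℝ} (hκ : 0 < κ) (hc₂ : 3 * κ ^ 2 < c₂) (hc : c₂ < c₁)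
    (hc₁ : c₁ < 9 * κ ^ 2) : SolitonData κ (waveNumber κ c₁) (waveNumber κ c₂)
      (interaction κ c₁ c₂) (expNegPsi κ c₁) (expNegPsi κ c₂) where
  κ_pos := hκ
  k₁_pos := waveNumber_pos hκ (hc₂.trans hc)
  k₂_pos := waveNumber_pos hκ hc₂
  ne h := by
    have h1 := mul_waveNumber_sq hκ (hc₂.trans hc)
    rw [h, mul_waveNumber_sq hκ hc₂] at h1
    have h2 : 0 < κ ^ 2 := by positivity
    have h3 : 2 * κ ^ 2 / (c₁ - κ ^ 2) < 2 * κ ^ 2 / (c₂ - κ ^ 2) :=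
      div_lt_div_of_pos_left (by positivity) (by linarith) (by linarith)
    linarith
  lt₁ := four_mul_waveNumber_lt hκ (hc₂.trans hc) hc₁
  lt₂ := four_mul_waveNumber_lt hκ hc₂ (hc.trans hc₁)
  hp := expNegPsi_mul hκ (hc₂.trans hc)
  hq := expNegPsi_mul hκ hc₂
  hA := by
    have := add_pos (waveNumber_pos hκ (hc₂.trans hc)) (waveNumber_pos hκ hc₂)
    rw [interaction, div_pow]
    exact div_mul_cancel₀ _ (by positivity)

theorem waveNumber_sq {κ c : ℝ} (hκ : 0 < κ) (hc : 3 * κ ^ 2 < c) :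
    waveNumber κ c ^ 2 = κ⁻¹ ^ 2 - 2 * (c - κ ^ 2)⁻¹ := by
  have h1 : 0 < κ ^ 2 := by positivity
  have h2 : 0 < c - κ ^ 2 := by linarith
  have h := mul_waveNumber_sq hκ hc
  rw [mul_pow] at h
  refine mul_left_cancel₀ h1.ne' (h.trans ?_)
  field_simp

theorem lam₁_eq {κ c₁ c₂ : ℝ} (hκ : 0 < κ) (hc₁ : 3 * κ ^ 2 < c₁) (hc₂ : 3 * κ ^ 2 < c₂) :
    lam₁ κ c₁ c₂ = mult₁ κ (waveNumber κ c₁) (waveNumber κ c₂) := by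
  rw [mult₁, waveNumber_sq hκ hc₁, waveNumber_sq hκ hc₂, lam₁]
  simp only [div_eq_mul_inv, mul_inv, inv_pow]
  ring

theorem lam₂_eq {κ c₁ c₂ : ℝ} (hκ : 0 < κ) (hc₁ : 3 * κ ^ 2 < c₁) (hc₂ : 3 * κ ^ 2 < c₂) :
    lam₂ κ c₁ c₂ = mult₂ κ (waveNumber κ c₁) (waveNumber κ c₂) := by
  rw [mult₂, waveNumber_sq hκ hc₁, waveNumber_sq hκ hc₂, lam₂]
  simp only [one_div, mul_inv, inv_pow]
  ring

/-- The number -k c̃ is the rate ∂_τ ξ; this is the dispersion relation required by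
`bilinear_three_time`. -/
theorem SolitonData.weight_eq {κ k₁ k₂ A p q : ℝ} (S : SolitonData κ k₁ k₂ A p q) :
    -(k₁ * recSpeed κ k₁) * ((1 - κ * k₁) * (1 + κ * k₁)) = -(2 * κ ^ 3 * k₁) := by
  have h1 := S.κk_pos
  have h2 := S.κk_lt_one
  have h3 : (1 - κ * k₁) * (1 + κ * k₁) ≠ 0 := mul_ne_zero (by linarith) (by linarith)
  have e : 1 - (κ * k₁) ^ 2 = (1 - κ * k₁) * (1 + κ * k₁) := by ring
  have h := div_mul_cancel₀ (2 * κ ^ 3) h3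
  rw [recSpeed, e]
  linear_combination -k₁ * h

/-! ### The profile of the two-soliton -/

section profile

variable (κ c₁ c₂ d y₁ y₂ τ y : ℝ)

theorem exp_xi (c y₀ : ℝ) : Real.exp (xi κ c y₀ τ y) =
    phase (waveNumber κ c) (y₀ - recSpeed κ (waveNumber κ c) * τ) y := by
  rw [xi, phase]
  congr 1
  ring

theorem tauF_eq : tauF κ c₁ c₂ y₁ y₂ τ y =
    tauLine (waveNumber κ c₁) (waveNumber κ c₂) (interaction κ c₁ c₂) 1 1
      (y₁ - recSpeed κ (waveNumber κ c₁) * τ) (y₂ - recSpeed κ (waveNumber κ c₂) * τ) y := by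
  rw [tauF, Real.exp_add, exp_xi, exp_xi, tauLine, tau]
  ring

theorem tauG_eq : tauG κ c₁ c₂ y₁ y₂ τ y =
    tauLine (waveNumber κ c₁) (waveNumber κ c₂) (interaction κ c₁ c₂) (expNegPsi κ c₁)
      (expNegPsi κ c₂) (y₁ - recSpeed κ (waveNumber κ c₁) * τ)
      (y₂ - recSpeed κ (waveNumber κ c₂) * τ) y := by
  rw [tauG, Real.exp_add, exp_xi, exp_xi, tauLine, tau]

theorem yRec_eq (x : ℝ) : yRec κ c₁ c₂ d y₁ y₂ τ x =
    recipInv κ (waveNumber κ c₁) (waveNumber κ c₂) (interaction κ c₁ c₂) (expNegPsi κ c₁)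
      (expNegPsi κ c₂) (y₂ - recSpeed κ (waveNumber κ c₂) * τ) (κ ^ 2 * τ) d
      (y₁ - recSpeed κ (waveNumber κ c₁) * τ) x := by
  rw [yRec, recipInv]
  congr 1
  funext y
  rw [xRec, recip, tauF_eq, tauG_eq]

end profile

/-- Time enters only through the phases, so in τ each exponential has logarithmic derivative -k C,
and `hasDerivAt_tau` applies with these rates in place of the wave numbers. -/
theorem hasDerivAt_tauLine_time (k₁ k₂ A a b y₁ y₂ C₁ C₂ τ y : ℝ) :
    HasDerivAt (fun s => tauLine k₁ k₂ A a b (y₁ - C₁ * s) (y₂ - C₂ * s) y)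
      (tauM (-(k₁ * C₁)) (-(k₂ * C₂)) k₁ k₂ A a b 0 (phase k₁ (y₁ - C₁ * τ) y)
        (phase k₂ (y₂ - C₂ * τ) y)) τ := by
  have h : ∀ k C y₀, HasDerivAt (fun s => phase k (y₀ - C * s) y)
      (-(k * C) * phase k (y₀ - C * τ) y) τ := fun k C y₀ => by
    refine (((((hasDerivAt_id τ).const_mul C).const_sub y₀).const_add y).const_mul k).exp.congr_deriv
      ?_
    simp only [phase, id]
    ring
  refine (hasDerivAt_tau (h k₁ C₁ y₁) (h k₂ C₂ y₂) A a b).congr_deriv ?_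
  simp [tauD, tauM]

theorem SolitonData.deriv_deriv_log {κ k₁ k₂ A p q : ℝ} (S : SolitonData κ k₁ k₂ A p q)
    (y₁ y₂ C₁ C₂ τ y : ℝ) :
    let T := fun a b => logTauT (-(k₁ * C₁)) (-(k₂ * C₂)) k₁ k₂ A a b (y₁ - C₁ * τ) (y₂ - C₂ * τ)
    deriv (fun z => deriv (fun s => Real.log (tauLine k₁ k₂ A 1 1 (y₁ - C₁ * s) (y₂ - C₂ * s) z
      * tauLine k₁ k₂ A p q (y₁ - C₁ * s) (y₂ - C₂ * s) z)) τ) y = T 1 1 y + T p q y := by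
  intro T
  have inner : ∀ z, deriv (fun s => Real.log (tauLine k₁ k₂ A 1 1 (y₁ - C₁ * s) (y₂ - C₂ * s) z
      * tauLine k₁ k₂ A p q (y₁ - C₁ * s) (y₂ - C₂ * s) z)) τ =
      tauM (-(k₁ * C₁)) (-(k₂ * C₂)) k₁ k₂ A 1 1 0 (phase k₁ (y₁ - C₁ * τ) z)
        (phase k₂ (y₂ - C₂ * τ) z) / tauLine k₁ k₂ A 1 1 (y₁ - C₁ * τ) (y₂ - C₂ * τ) z
      + tauM (-(k₁ * C₁)) (-(k₂ * C₂)) k₁ k₂ A p q 0 (phase k₁ (y₁ - C₁ * τ) z)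
        (phase k₂ (y₂ - C₂ * τ) z) / tauLine k₁ k₂ A p q (y₁ - C₁ * τ) (y₂ - C₂ * τ) z := fun z => by
    have hf := (S.tauLine_pos₁ (y₁ - C₁ * τ) (y₂ - C₂ * τ) z).ne'
    have hg := (S.tauLine_pos₂ (y₁ - C₁ * τ) (y₂ - C₂ * τ) z).ne'
    refine (((hasDerivAt_tauLine_time k₁ k₂ A 1 1 y₁ y₂ C₁ C₂ τ z).fun_mul
      (hasDerivAt_tauLine_time k₁ k₂ A p q y₁ y₂ C₁ C₂ τ z)).log (mul_ne_zero hf hg)).deriv.trans ?_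
    field_simp
  rw [funext inner]
  exact ((hasDerivAt_logTauT S.A_pos one_pos one_pos _ _ k₁ k₂ _ _ y).1.add
    (hasDerivAt_logTauT S.A_pos S.p_pos S.q_pos _ _ k₁ k₂ _ _ y).1).deriv

/-- The momentum profile of the two-soliton. -/
theorem mu_eq_profile {κ c₁ c₂ : ℝ} (hκ : 0 < κ) (hc₂ : 3 * κ ^ 2 < c₂) (hc : c₂ < c₁)
    (hc₁ : c₁ < 9 * κ ^ 2) (d y₁ y₂ t x : ℝ) :
    mu κ c₁ c₂ d y₁ y₂ t x = profile κ (waveNumber κ c₁) (waveNumber κ c₂) (interaction κ c₁ c₂)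
      (expNegPsi κ c₁) (expNegPsi κ c₂) (y₂ - recSpeed κ (waveNumber κ c₂) * t) (κ ^ 2 * t) d
      (y₁ - recSpeed κ (waveNumber κ c₁) * t) x := by
  have S := solitonData hκ hc₂ hc hc₁
  refine S.sub_deriv_deriv_eq_profile S.weight_eq S.symm.weight_eq _ _ _ _ (fun z => ?_) x
  rw [twoSoliton, uRec, yRec_eq]
  simp only [tauF_eq, tauG_eq]
  rw [S.deriv_deriv_log]

end MCH

end

/-! ### The kernel of the second variation at the two-soliton -/

theorem lemma4p3 (κ c₁ c₂ d : ℝ) (hκ : 0 < κ) (hc₂ : 3 * κ ^ 2 < c₂) (hc : c₂ < c₁)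
    (hc₁ : c₁ < 9 * κ ^ 2) (y₁ y₂ t : ℝ) :
    (∀ x, DifferentiableAt ℝ (fun s => MCH.mu κ c₁ c₂ d s y₂ t x) y₁) ∧
    (∀ x, DifferentiableAt ℝ (fun s => MCH.mu κ c₁ c₂ d y₁ s t x) y₂) ∧
    ∃ (h₁ : MemLp (MCH.mu₁ κ c₁ c₂ d y₁ y₂ t) 2 volume)
      (h₂ : MemLp (MCH.mu₂ κ c₁ c₂ d y₁ y₂ t) 2 volume),
      LinearIndependent ℝ ![h₁.toLp, h₂.toLp] ∧
      MCH.kerL κ c₁ c₂ d y₁ y₂ t =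
        (Submodule.span ℝ {h₁.toLp, h₂.toLp} : Set (Lp ℝ 2 (volume : Measure ℝ))) := by
  have S := MCH.solitonData hκ hc₂ hc hc₁
  have e := MCH.mu_eq_profile hκ hc₂ hc hc₁ d
  -- At fixed t the phases y₁, y₂ are only shifted by constants, so derivatives in them are
  -- derivatives in η₁, η₂.
  set η₁ := y₁ - MCH.recSpeed κ (MCH.waveNumber κ c₁) * t with hη₁
  set η₂ := y₂ - MCH.recSpeed κ (MCH.waveNumber κ c₂) * t with hη₂
  have D₁ : ∀ x, HasDerivAt (fun s => MCH.mu κ c₁ c₂ d s y₂ t x) (MCH.pderiv₁ (MCH.profile κ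
      (MCH.waveNumber κ c₁) (MCH.waveNumber κ c₂) (MCH.interaction κ c₁ c₂) (MCH.expNegPsi κ c₁)
      (MCH.expNegPsi κ c₂) η₂ (κ ^ 2 * t) d) η₁ x) y₁ := fun x => by
    simp only [e]
    exact ((S.jointSmooth_profile η₂ (κ ^ 2 * t) d).hasDerivAt₁ η₁ x).comp_sub_const y₁ _
  have D₂ : ∀ x, HasDerivAt (fun s => MCH.mu κ c₁ c₂ d y₁ s t x) (MCH.pderiv₁ (MCH.profile κ
      (MCH.waveNumber κ c₂) (MCH.waveNumber κ c₁) (MCH.interaction κ c₁ c₂) (MCH.expNegPsi κ c₂)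
      (MCH.expNegPsi κ c₁) η₁ (κ ^ 2 * t) d) η₂ x) y₂ := fun x => by
    simp only [e]
    -- The solitons are exchanged so that the second phase becomes the differentiated argument of
    -- the profile.
    simp only [MCH.profile_swap κ (MCH.waveNumber κ c₁)]
    exact ((S.symm.jointSmooth_profile η₁ (κ ^ 2 * t) d).hasDerivAt₁ η₂ x).comp_sub_const y₂ _
  refine ⟨fun x => (D₁ x).differentiableAt, fun x => (D₂ x).differentiableAt, ?_⟩
  have E₁ : MCH.mu₁ κ c₁ c₂ d y₁ y₂ t = _ := funext fun x => (D₁ x).deriv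
  have E₂ : MCH.mu₂ κ c₁ c₂ d y₁ y₂ t = _ := funext fun x => (D₂ x).deriv
  rw [E₁, E₂, MCH.kerL, MCH.lam₁_eq hκ (hc₂.trans hc) hc₂, MCH.lam₂_eq hκ (hc₂.trans hc) hc₂,
    funext (e y₁ y₂ t)]
  exact S.ker_eq_span η₁ η₂ (κ ^ 2 * t) d
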